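/- Let $(\mathcal D,\wedge,S^0)$ be a pointed closed symmetric monoidal model category, with internal Hom objects $\mathrm{Hom}$, and write $[A,B]$ for the set of maps from $A$ to $B$ in $\mathrm{Ho}(\mathcal D)$. Let $T$ be a cofibrant object of $\mathcal D$ such that $-\wedge T$ preserves weak equivalences and such that $T$ is equipped with a cogroup structure in $\mathrm{Ho}(\mathcal D)$ and with a sign, that is, an automorphism $(-1)_T$ of $T$ in $\mathrm{Ho}(\mathcal D)$ with $(-1)_T^2=1$ such that (1) for all $n\ge 1$ and $\tau\in\Sigma_n$ the permutation $\tau$ of the factors of $T^n=T^{\wedge n}$ equals $|\tau|_T\wedge T^{n-1}$ in $\mathrm{Ho}(\mathcal D)$, where $|\tau|_T=(-1)_T$ if $\tau$ is odd and $|\tau|_T=1$ if $\tau$ is even, and (2) $(-1)_T\wedge T=T\wedge(-1)_T$ in $\mathrm{Ho}(\mathcal D)$. Let $\mathcal B$ be a class of cofibrant objects of $\mathcal D$. *Spectra.* A $T$-spectrum $X$ consists of objects $X_n$ ($n\ge 0$) of $\mathcal D$ and maps $\sigma_n:X_n\wedge T\to X_{n+1}$; it is symmetric if every $X_n$ has a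 left $\Sigma_n$-action such that the iterated structure maps $X_m\wedge T^l\to X_{m+l}$ are $\Sigma_m\times\Sigma_l$-equivariant. Let $(\mathrm{sh}X)_n=X_{1+n}$ with structure maps $\sigma_{1+n}$; let $(T\wedge X)_n=T\wedge X_n$ with structure maps $T\wedge\sigma_n$; let $(\Omega X)_n=\mathrm{Hom}(T,X_n)$ with structure maps $\mathrm{Hom}(T,X_n)\wedge T\to \mathrm{Hom}(T,X_{n+1})$ adjoint to $\mathrm{Hom}(T,X_n)\wedge T\wedge T\to X_n\wedge T\to X_{n+1}$, the map obtained by evaluating with the last factor $T$ and then applying $\sigma_n$. If $X$ is symmetric so are these spectra, where $\gamma\in\Sigma_n$ acts on $X_{1+n}$ as $1+\gamma\in\Sigma_{1+n}$, and on $T\wedge X_n$ and $\mathrm{Hom}(T,X_n)$ through $X_n$. *Stable homotopy groups.* For $q\in\mathbb Z$ and $V\in\mathcal B$ let $\pi_q^V(X)=\operatorname{colim}_{m\ge 0,\,q+m\ge 1}[V\wedge T^{q+m},X_m]$ along the maps $f\mapsto\sigma_m\circ(f\wedge T)$, with the group structure induced by the cogroup structure of the first factor $T$. The sign of $T$ acts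 on $\pi_q^V(X)$ by $[f]\mapsto[f\circ(V\wedge(-1)_T\wedge T^{q+m-1})]$. *The $\mathcal M$-action.* Let $\mathcal M$ be the monoid of injective maps $\mathbb N\to\mathbb N$ under composition. If $X$ is symmetric, $\mathcal M$ acts on $\pi_q^V(X)$ as follows: for $g\in\mathcal M$ and $f\in[V\wedge T^{q+m},X_m]$ choose $n\ge m$ and $\gamma\in\Sigma_n$ which agrees with $g$ on the first $m$ elements, let $f'\in[V\wedge T^{q+n},X_n]$ be the image of $f$, and put $g\cdot[f]=[\gamma\circ f'\circ(V\wedge|\gamma|_T\wedge T^{q+n-1})]$. For $g\in\mathcal M$ let $1+g\in\mathcal M$ fix the first element of $\mathbb N$ and be given by $x\mapsto g(x-1)+1$ on the others; for an $\mathcal M$-module $W$ let $W(1)$ be $W$ with $g$ acting as $1+g$. A symmetric spectrum $X$ is *semistable* if $\mathcal M$ acts trivially on $\pi_q^V(X)$ for all $q\in\mathbb Z$ and $V\in\mathcal B$. **Proposition.** Let $X$ be a $T$-spectrum in $\mathcal D$, $q\in\mathbb Z$ and $V\in\mathcal B$. There are isomorphisms of groups, compatible with the action of the sign of $T$: 1.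 $\pi_{q+1}^V(\mathrm{sh}X)\cong\pi_q^V(X)$, sending the class of $f:V\wedge T^{(q+1)+m}\to(\mathrm{sh}X)_m=X_{1+m}$ to the class of $f:V\wedge T^{q+(1+m)}\to X_{1+m}$; 2. if all $X_n$ are fibrant, $\pi_q^V(\Omega X)\cong\pi_{q+1}^V(X)$, sending the class of $f:V\wedge T^{q+m}\to\mathrm{Hom}(T,X_m)$ to the class of the composition of the map $V\wedge T\wedge T^{q+m}\to V\wedge T^{q+m}\wedge T$ that moves the first factor $T$ to the end with the adjoint $V\wedge T^{q+m}\wedge T\to X_m$ of $f$; 3. $\pi_q^V(X)\cong\pi_{1+q}^V(T\wedge X)$, sending the class of $f:V\wedge T^{q+m}\to X_m$ to the class of $V\wedge T\wedge T^{q+m}\cong T\wedge V\wedge T^{q+m}\xrightarrow{T\wedge f}T\wedge X_m$. If $X$ is a symmetric spectrum, these are isomorphisms of $\mathcal M$-modules $\pi_{q+1}^V(\mathrm{sh}X)\cong\pi_q^V(X)(1)$, $\pi_q^V(\Omega X)\cong\pi_{q+1}^V(X)$ and $\pi_q^V(X)\cong\pi_{1+q}^V(T\wedge X)$. Consequently,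 for every symmetric $T$-spectrum $X$ and every level fibrant replacement $X\to JX$ (a map of symmetric spectra that is a weak equivalence on every level, with all $(JX)_n$ fibrant), the following are equivalent: $X$ is semistable; $T\wedge X$ is semistable; $\Omega JX$ is semistable; $\mathrm{sh}X$ is semistable. -/

import Mathlib

open CategoryTheory Limits MonoidalCategory HomotopicalAlgebra

universe v u

set_option linter.unusedSectionVars false

noncomputable section

namespace StableHtpy

/-! ### Monoidal model categories and the homotopy category -/

/-- The two axioms relating the tensor product and the model structure of a monoidal model category:
the pushout product axiom (tested on an arbitrary choice of the pushout) and the unit axiom. -/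
class MonoidalModelCategory (D : Type u) [Category.{v} D] [ModelCategory D]
    [MonoidalCategory D] : Prop where
  pushout_product {A B X Y P : D} (i : A ⟶ B) (j : X ⟶ Y) (a : B ⊗ X ⟶ P) (b : A ⊗ Y ⟶ P)
    (φ : P ⟶ B ⊗ Y) (sq : IsPushout (i ▷ X) (A ◁ j) a b) (ha : a ≫ φ = B ◁ j)
    (hb : b ≫ φ = i ▷ Y) (hi : Cofibration i) (hj : Cofibration j) :
    Cofibration φ ∧ (WeakEquivalence i ∨ WeakEquivalence j → WeakEquivalence φ)
  unit {Q : D} (p : Q ⟶ 𝟙_ D) (hQ : IsCofibrant Q) (hp : WeakEquivalence p) (A : D)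
    (hA : IsCofibrant A) : WeakEquivalence (p ▷ A) ∧ WeakEquivalence (A ◁ p)

/-- The functor `- ∧ T` preserves weak equivalences. -/
class SmashPreservesWeakEquivalences {D : Type u} [Category.{v} D] [ModelCategory D]
    [MonoidalCategory D] (T : D) : Prop where
  smash {A B : D} (f : A ⟶ B) (hf : WeakEquivalence f) : WeakEquivalence (f ▷ T)

/-- The homotopy category `Ho(D)`: the localization of `D` at the weak equivalences. -/
abbrev Ho (D : Type u) [Category.{v} D] [ModelCategory D] := (weakEquivalences D).Localization

/-- The localization functor `D ⥤ Ho(D)`. -/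
abbrev toHo (D : Type u) [Category.{v} D] [ModelCategory D] : D ⥤ Ho D := (weakEquivalences D).Q

section

variable {D : Type u} [Category.{v} D] [ModelCategory D]

/-- `HoHom A B` is the set `[A, B]` of maps from `A` to `B` in `Ho(D)`. -/
abbrev HoHom (A B : D) := (toHo D).obj A ⟶ (toHo D).obj B

/-- A map of `D`, considered in `Ho(D)`. -/
abbrev hoMap {A B : D} (f : A ⟶ B) : HoHom A B := (toHo D).map f

lemma isIso_hoMap {A B : D} (f : A ⟶ B) [hf : WeakEquivalence f] : IsIso (hoMap f) :=
  Localization.inverts (toHo D) (weakEquivalences D) f ((weakEquivalence_iff f).1 hf)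

/-- A coproduct of cofibrant objects in `D` is also a coproduct in `Ho(D)`. -/
lemma existsUnique_ho_desc {A B C : D} [IsCofibrant A] [IsCofibrant B] (i : A ⟶ C) (j : B ⟶ C)
    (h : IsColimit (BinaryCofan.mk i j)) {Y : D} (f : HoHom A Y) (g : HoHom B Y) :
    ∃! u : HoHom C Y, hoMap i ≫ u = f ∧ hoMap j ≫ u = g := by
  have : IsCofibrant C := by
    have hj : Cofibration j := by
      rw [cofibration_iff]
      exact MorphismProperty.of_isPushout
        (IsPushout.of_isColimit_binaryCofan_of_isInitial h initialIsInitial)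
        ((cofibration_iff _).1 (inferInstance : Cofibration (initial.to A)))
    exact isCofibrant_of_cofibration j
  obtain ⟨Z, r, _, _, _⟩ : ∃ (Z : D) (i : Y ⟶ Z), Cofibration i ∧ WeakEquivalence i ∧
      IsFibrant Z := ⟨_, FibrantObject.HoCat.iResolutionObj Y, inferInstance, inferInstance,
        inferInstance⟩
  have := isIso_hoMap r
  obtain ⟨f', hf'⟩ := map_surjective_of_isLocalization (toHo D) _ _ (f ≫ hoMap r)
  obtain ⟨g', hg'⟩ := map_surjective_of_isLocalization (toHo D) _ _ (g ≫ hoMap r)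
  obtain ⟨w, hw₁, hw₂⟩ : ∃ w : C ⟶ Z, i ≫ w = f' ∧ j ≫ w = g' :=
    ⟨_, (BinaryCofan.IsColimit.desc' h f' g').2⟩
  refine ⟨hoMap w ≫ inv (hoMap r), ⟨?_, ?_⟩, ?_⟩
  · rw [← Category.assoc, IsIso.comp_inv_eq, ← hf', ← Functor.map_comp]
    rw [hw₁]
  · rw [← Category.assoc, IsIso.comp_inv_eq, ← hg', ← Functor.map_comp]
    rw [hw₂]
  · rintro u ⟨hu₁, hu₂⟩
    obtain ⟨u', hu'⟩ := map_surjective_of_isLocalization (toHo D) _ _ (u ≫ hoMap r)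
    rw [IsIso.eq_comp_inv, ← hu', ← RightHomotopyRel.iff_map_eq]
    have h₁ : RightHomotopyRel (i ≫ u') (i ≫ w) := by
      rw [RightHomotopyRel.iff_map_eq (toHo D), Functor.map_comp, hu', ← Category.assoc, hu₁, ← hf', hw₁]
    have h₂ : RightHomotopyRel (j ≫ u') (j ≫ w) := by
      rw [RightHomotopyRel.iff_map_eq (toHo D), Functor.map_comp, hu', ← Category.assoc, hu₂, ← hg', hw₂]
    obtain ⟨P, hP⟩ := PathObject.exists_very_good Z
    obtain ⟨k, hk₁, hk₂⟩ : ∃ k : C ⟶ P.P, i ≫ k = (h₁.rightHomotopy P).h ∧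
        j ≫ k = (h₂.rightHomotopy P).h := ⟨_, (BinaryCofan.IsColimit.desc' h _ _).2⟩
    have ext : ∀ {a b : C ⟶ Z}, i ≫ a = i ≫ b → j ≫ a = j ≫ b → a = b :=
      fun h₁ h₂ => BinaryCofan.IsColimit.hom_ext h h₁ h₂
    refine ⟨P, ⟨⟨k, ?_, ?_⟩⟩⟩
    · refine ext ?_ ?_
      · rw [← Category.assoc, hk₁]; exact (h₁.rightHomotopy P).h₀
      · rw [← Category.assoc, hk₂]; exact (h₂.rightHomotopy P).h₀
    · refine ext ?_ ?_
      · rw [← Category.assoc, hk₁]; exact (h₁.rightHomotopy P).h₁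
      · rw [← Category.assoc, hk₂]; exact (h₂.rightHomotopy P).h₁

/-- Maps of `Ho(D)` between cofibrant objects are fractions of maps between cofibrant objects. -/
lemma exists_ho_fraction {A B : D} [IsCofibrant A] [IsCofibrant B] (f : HoHom A B) :
    ∃ (Z : D) (_ : IsCofibrant Z) (f' : A ⟶ Z) (r : B ⟶ Z), WeakEquivalence r ∧
      f ≫ hoMap r = hoMap f' := by
  obtain ⟨Z, r, _, _, _⟩ : ∃ (Z : D) (i : B ⟶ Z), Cofibration i ∧ WeakEquivalence i ∧
      IsFibrant Z := ⟨_, FibrantObject.HoCat.iResolutionObj B, inferInstance, inferInstance,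
        inferInstance⟩
  obtain ⟨f', hf'⟩ := map_surjective_of_isLocalization (toHo D) _ _ (f ≫ hoMap r)
  exact ⟨Z, isCofibrant_of_cofibration r, f', r, inferInstance, hf'.symm⟩

end

section

variable {D : Type u} [Category.{v} D] [ModelCategory D] [MonoidalCategory D] [SymmetricCategory D]
  [MonoidalClosed D]

/-! ### Smash products in the homotopy category -/

/-- As it preserves weak equivalences, `- ∧ T` induces a functor on `Ho(D)`. -/
def hoSmashFunctor (T : D) [hT : SmashPreservesWeakEquivalences T] : Ho D ⥤ Ho D :=
  Localization.Construction.lift (tensorRight T ⋙ toHo D) (fun _ _ f hf =>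
    have := hT.smash f ((weakEquivalence_iff f).2 hf)
    isIso_hoMap (f ▷ T))

/-- The map `f ∧ T` of `Ho(D)`, for a map `f` of `Ho(D)`. -/
def hoSmash (T : D) [SmashPreservesWeakEquivalences T] {A B : D} (f : HoHom A B) :
    HoHom (A ⊗ T) (B ⊗ T) := (hoSmashFunctor T).map f

lemma whiskerLeft_weakEquivalence (T : D) [hT : SmashPreservesWeakEquivalences T] {A B : D}
    (f : A ⟶ B) (hf : WeakEquivalence f) : WeakEquivalence (T ◁ f) := by
  have h := hT.smash f hf
  rw [weakEquivalence_iff] at h ⊢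
  refine ((weakEquivalences D).arrow_mk_iso_iff (Arrow.isoMk (β_ A T) (β_ B T) ?_)).1 h
  exact (BraidedCategory.braiding_naturality_left f T).symm

/-- As it preserves weak equivalences, `T ∧ -` induces a functor on `Ho(D)`. -/
def hoSmashLeftFunctor (T : D) [SmashPreservesWeakEquivalences T] : Ho D ⥤ Ho D :=
  Localization.Construction.lift (tensorLeft T ⋙ toHo D) (fun _ _ f hf =>
    have := whiskerLeft_weakEquivalence T f ((weakEquivalence_iff f).2 hf)
    isIso_hoMap (T ◁ f))

/-- The map `T ∧ f` of `Ho(D)`, for a map `f` of `Ho(D)`. -/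
def hoSmashLeft (T : D) [SmashPreservesWeakEquivalences T] {A B : D} (f : HoHom A B) :
    HoHom (T ⊗ A) (T ⊗ B) := (hoSmashLeftFunctor T).map f

lemma hoSmash_hoMap (T : D) [SmashPreservesWeakEquivalences T] {A B : D} (f : A ⟶ B) :
    hoSmash T (hoMap f) = hoMap (f ▷ T) := by
  have := Functor.congr_hom (Localization.Construction.fac (W := weakEquivalences D)
    (tensorRight T ⋙ toHo D) (fun _ _ f hf =>
    have := SmashPreservesWeakEquivalences.smash (T := T) f ((weakEquivalence_iff f).2 hf)
    isIso_hoMap (f ▷ T))) f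
  simpa using! this

lemma hoSmash_comp (T : D) [SmashPreservesWeakEquivalences T] {A B C : D} (f : HoHom A B)
    (g : HoHom B C) : hoSmash T (f ≫ g) = hoSmash T f ≫ hoSmash T g :=
  (hoSmashFunctor T).map_comp f g

lemma hoSmash_id (T : D) [SmashPreservesWeakEquivalences T] (A : D) :
    hoSmash T (𝟙 ((toHo D).obj A)) = 𝟙 ((toHo D).obj (A ⊗ T)) :=
  (hoSmashFunctor T).map_id _

section

variable [MonoidalModelCategory D]

lemma whiskerLeft_cofibration (V : D) [hV : IsCofibrant V] {A B : D} (j : A ⟶ B)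
    [hj : Cofibration j] :
    Cofibration (V ◁ j) ∧ (WeakEquivalence j → WeakEquivalence (V ◁ j)) := by
  have hI : ∀ X : D, IsInitial ((⊥_ D) ⊗ X) := fun X =>
    IsInitial.isInitialObj (tensorRight X) _ initialIsInitial
  have : IsIso ((⊥_ D) ◁ j) :=
    ⟨(hI B).to _, (hI A).hom_ext _ _, (hI B).hom_ext _ _⟩
  have sq : IsPushout (initial.to V ▷ A) ((⊥_ D) ◁ j) (𝟙 (V ⊗ A)) ((hI B).to _) :=
    IsPushout.of_vert_isIso ⟨(hI A).hom_ext _ _⟩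
  have := MonoidalModelCategory.pushout_product (initial.to V) j _ _ (V ◁ j) sq
    (Category.id_comp _) ((hI B).hom_ext _ _) hV hj
  exact ⟨this.1, fun h => this.2 (Or.inr h)⟩

instance isCofibrant_tensor (A B : D) [hA : IsCofibrant A] [hB : IsCofibrant B] :
    IsCofibrant (A ⊗ B) := by
  have h := (whiskerLeft_cofibration A (initial.to B)).1
  rwa [isCofibrant_iff_of_isInitial (A ◁ initial.to B)
    (IsInitial.isInitialObj (tensorLeft A) _ initialIsInitial)]

/-- For `V` cofibrant, `V ∧ -` preserves weak equivalences between cofibrant objects. -/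
lemma whiskerLeft_weakEquivalence_of_cofibrant (V : D) [IsCofibrant V] {A B : D} [IsCofibrant A]
    [IsCofibrant B] (f : A ⟶ B) [hf : WeakEquivalence f] : WeakEquivalence (V ◁ f) := by
  obtain ⟨h⟩ := (inferInstance : Nonempty (CofibrantBrownFactorization f))
  have : Cofibration h.i := (cofibration_iff _).2 h.hi
  have h₁ : WeakEquivalence (V ◁ h.i) := (whiskerLeft_cofibration V h.i).2 inferInstance
  have h₂ : WeakEquivalence (V ◁ h.s) := (whiskerLeft_cofibration V h.s).2 inferInstance
  have h₃ : WeakEquivalence (V ◁ h.p) :=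
    have e : V ◁ h.s ≫ V ◁ h.p = 𝟙 _ := by
      rw [← MonoidalCategory.whiskerLeft_comp, h.s_p, MonoidalCategory.whiskerLeft_id]
    have : WeakEquivalence (V ◁ h.s ≫ V ◁ h.p) := by rw [e]; infer_instance
    weakEquivalence_of_precomp (V ◁ h.s) (V ◁ h.p)
  have e : V ◁ f = V ◁ h.i ≫ V ◁ h.p := by rw [← MonoidalCategory.whiskerLeft_comp, h.fac]
  rw [e]; infer_instance

/-- Restricted to cofibrant objects, the functor `V ∧ -` to `Ho(D)` inverts weak equivalences. -/
lemma cofSmash_inverts (V : D) [IsCofibrant V] :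
    (weakEquivalences (CofibrantObject D)).IsInvertedBy
      (CofibrantObject.ι ⋙ tensorLeft V ⋙ toHo D) := fun _ _ f hf =>
  have : WeakEquivalence f.hom := (weakEquivalence_iff _).2 hf
  have := whiskerLeft_weakEquivalence_of_cofibrant V f.hom
  isIso_hoMap (V ◁ f.hom)

/-- For `V` cofibrant, the total left derived functor of `V ∧ -`; here `Ho(D)` is considered as
the localization of the category of cofibrant objects. -/
def cofSmashFunctor (V : D) [IsCofibrant V] : Ho D ⥤ Ho D :=
  Localization.lift _ (cofSmash_inverts V) (CofibrantObject.ι ⋙ toHo D)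

/-- On cofibrant objects the derived functor of `V ∧ -` is given by `V ∧ -`. -/
def cofSmashIso (V : D) [IsCofibrant V] (A : D) [IsCofibrant A] :
    (cofSmashFunctor V).obj ((toHo D).obj A) ≅ (toHo D).obj (V ⊗ A) :=
  (Localization.fac _ (cofSmash_inverts V) (CofibrantObject.ι ⋙ toHo D)).app (.mk A)

/-- The map `V ∧ f` of `Ho(D)`, for `V` cofibrant and a map `f` of `Ho(D)` between objects that are
cofibrant in `D`. -/
def cofSmash (V : D) [IsCofibrant V] {A B : D} [IsCofibrant A] [IsCofibrant B] (f : HoHom A B) :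
    HoHom (V ⊗ A) (V ⊗ B) :=
  (cofSmashIso V A).inv ≫ (cofSmashFunctor V).map f ≫ (cofSmashIso V B).hom

lemma cofSmash_hoMap (V : D) [IsCofibrant V] {A B : D} [IsCofibrant A] [IsCofibrant B]
    (f : A ⟶ B) : cofSmash V (hoMap f) = hoMap (V ◁ f) := by
  rw [cofSmash, Iso.inv_comp_eq]
  exact (Localization.fac _ (cofSmash_inverts V) (CofibrantObject.ι ⋙ toHo D)).hom.naturality
    (CofibrantObject.homMk f)

lemma cofSmash_comp (V : D) [IsCofibrant V] {A B C : D} [IsCofibrant A] [IsCofibrant B]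
    [IsCofibrant C] (f : HoHom A B) (g : HoHom B C) :
    cofSmash V (f ≫ g) = cofSmash V f ≫ cofSmash V g := by
  simp [cofSmash]

lemma cofSmash_id (V : D) [IsCofibrant V] (A : D) [IsCofibrant A] :
    cofSmash V (𝟙 ((toHo D).obj A)) = 𝟙 ((toHo D).obj (V ⊗ A)) := by
  simp [cofSmash]

/-- `V ∧ (f ∧ T) = (V ∧ f) ∧ T` in `Ho(D)`. -/
lemma cofSmash_hoSmash (V T : D) [IsCofibrant V] [IsCofibrant T] [SmashPreservesWeakEquivalences T]
    {A B : D} [IsCofibrant A] [IsCofibrant B] (f : HoHom A B) :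
    hoSmash T (cofSmash V f) ≫ hoMap (α_ V B T).hom =
      hoMap (α_ V A T).hom ≫ cofSmash V (hoSmash T f) := by
  obtain ⟨Z, _, f', r, _, h⟩ := exists_ho_fraction f
  have := whiskerLeft_weakEquivalence_of_cofibrant V (r ▷ T)
    (hf := SmashPreservesWeakEquivalences.smash r inferInstance)
  have := isIso_hoMap (V ◁ r ▷ T)
  have key : ∀ {X Y : D} [IsCofibrant X] [IsCofibrant Y] (g : X ⟶ Y),
      hoSmash T (cofSmash V (hoMap g)) ≫ hoMap (α_ V Y T).hom =
      hoMap (α_ V X T).hom ≫ cofSmash V (hoSmash T (hoMap g)) := fun g => by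
    rw [cofSmash_hoMap, hoSmash_hoMap, hoSmash_hoMap, cofSmash_hoMap, ← Functor.map_comp,
      ← Functor.map_comp, associator_naturality_middle]
  rw [← cancel_mono (hoMap (V ◁ r ▷ T)), ← cofSmash_hoMap V (r ▷ T), ← hoSmash_hoMap,
    Category.assoc, Category.assoc, ← key, ← cofSmash_comp, ← hoSmash_comp, h, ← key, ← h,
    cofSmash_comp, hoSmash_comp, Category.assoc]

/-- `(V ∧ W) ∧ f = V ∧ (W ∧ f)` in `Ho(D)`. -/
lemma cofSmash_cofSmash (V W : D) [IsCofibrant V] [IsCofibrant W]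
    {A B : D} [IsCofibrant A] [IsCofibrant B] (f : HoHom A B) :
    cofSmash (V ⊗ W) f ≫ hoMap (α_ V W B).hom =
      hoMap (α_ V W A).hom ≫ cofSmash V (cofSmash W f) := by
  obtain ⟨Z, _, f', r, _, h⟩ := exists_ho_fraction f
  have := whiskerLeft_weakEquivalence_of_cofibrant W r
  have := whiskerLeft_weakEquivalence_of_cofibrant V (W ◁ r)
  have := isIso_hoMap (V ◁ W ◁ r)
  have key : ∀ {X Y : D} [IsCofibrant X] [IsCofibrant Y] (g : X ⟶ Y),
      cofSmash (V ⊗ W) (hoMap g) ≫ hoMap (α_ V W Y).hom =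
      hoMap (α_ V W X).hom ≫ cofSmash V (cofSmash W (hoMap g)) := fun g => by
    rw [cofSmash_hoMap, cofSmash_hoMap, cofSmash_hoMap, ← Functor.map_comp, ← Functor.map_comp,
      associator_naturality_right]
  rw [← cancel_mono (hoMap (V ◁ W ◁ r)), ← cofSmash_hoMap V (W ◁ r), ← cofSmash_hoMap W r,
    Category.assoc, Category.assoc, ← key, ← cofSmash_comp, ← cofSmash_comp, h, ← key, ← h,
    cofSmash_comp, Category.assoc]

end

end

section

variable {D : Type u} [Category.{v} D] [ModelCategory D] [MonoidalCategory D] [SymmetricCategory D]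
  [MonoidalClosed D]

/-! ### Smash powers and permutations of the factors -/

/-- `smashPow T A n` is `A ∧ T ∧ ⋯ ∧ T` with `n` factors `T`, bracketed to the left. -/
def smashPow (T A : D) : ℕ → D
  | 0 => A
  | n + 1 => smashPow T A n ⊗ T

/-- The map `f ∧ T ∧ ⋯ ∧ T`. -/
def smashPowMap (T : D) {A B : D} (f : A ⟶ B) : ∀ n : ℕ, smashPow T A n ⟶ smashPow T B n
  | 0 => f
  | n + 1 => smashPowMap T f n ▷ T

/-- The map `A ∧ T ∧ T ⟶ A ∧ T ∧ T` exchanging the two factors `T`. -/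
def swapLast (T A : D) : (A ⊗ T) ⊗ T ⟶ (A ⊗ T) ⊗ T :=
  (α_ A T T).hom ≫ A ◁ (β_ T T).hom ≫ (α_ A T T).inv

lemma swapLast_naturality (T : D) {A B : D} (f : A ⟶ B) :
    swapLast T A ≫ f ▷ T ▷ T = f ▷ T ▷ T ≫ swapLast T B := by
  simp only [swapLast, Category.assoc, ← associator_inv_naturality_left,
    associator_naturality_left_assoc, whisker_exchange_assoc]

/-- The permutation in `Σ_{m+n}` which is `γ` on the first `m` and `τ` on the last `n` elements. -/
def blockSum {m n : ℕ} (γ : Equiv.Perm (Fin m)) (τ : Equiv.Perm (Fin n)) :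
    Equiv.Perm (Fin (m + n)) :=
  finSumFinEquiv.permCongr (Equiv.Perm.sumCongr γ τ)

lemma blockSum_val {m n : ℕ} (γ : Equiv.Perm (Fin m)) (τ : Equiv.Perm (Fin n)) (i : Fin (m + n)) :
    (blockSum γ τ i : ℕ) = if h : (i : ℕ) < m then (γ ⟨i, h⟩ : ℕ) else m + τ ⟨i - m, by omega⟩ := by
  induction i using Fin.addCases <;> simp [blockSum, Equiv.permCongr_apply]

lemma blockSum_mul {m n : ℕ} (γ γ' : Equiv.Perm (Fin m)) (τ τ' : Equiv.Perm (Fin n)) :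
    blockSum (γ * γ') (τ * τ') = blockSum γ τ * blockSum γ' τ' := by
  ext i
  induction i using Fin.addCases <;> simp [blockSum, Equiv.permCongr_apply]

lemma blockSum_one (m n : ℕ) :
    blockSum (1 : Equiv.Perm (Fin m)) (1 : Equiv.Perm (Fin n)) = 1 := by
  simp only [blockSum, Equiv.Perm.sumCongr_one]
  ext; simp [Equiv.permCongr_apply]

lemma blockSum_assoc {l m n : ℕ} (γ : Equiv.Perm (Fin l)) (δ : Equiv.Perm (Fin m))
    (τ : Equiv.Perm (Fin n)) (i : ℕ) (hi : i < l + m + n) :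
    (blockSum (blockSum γ δ) τ ⟨i, hi⟩ : ℕ) = blockSum γ (blockSum δ τ) ⟨i, by omega⟩ := by
  rw [blockSum_val, blockSum_val]
  by_cases h₁ : i < l
  · simp [blockSum_val, h₁, show i < l + m by omega]
  · by_cases h₂ : i < l + m
    · simp [blockSum_val, h₁, h₂, show i - l < m by omega]
    · simp [blockSum_val, h₁, h₂, show ¬ i - l < m by omega, Nat.sub_sub, Nat.add_assoc]

lemma sign_blockSum {m n : ℕ} (γ : Equiv.Perm (Fin m)) (τ : Equiv.Perm (Fin n)) :
    Equiv.Perm.sign (blockSum γ τ) = Equiv.Perm.sign γ * Equiv.Perm.sign τ := by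
  rw [blockSum, Equiv.Perm.sign_permCongr, Equiv.Perm.sign_sumCongr]

/-- `SmashPerm T A τ t` expresses that `t : A ∧ T^n ⟶ A ∧ T^n` is the map that permutes the factors
`T` according to `τ ∈ Σ_n`, moving the `i`-th factor to the place `τ i`: the map `t` is a composition
of exchanges of adjacent factors, and `τ` is the composition of the corresponding transpositions. -/
inductive SmashPerm (T A : D) :
    ∀ {n : ℕ}, Equiv.Perm (Fin n) → (smashPow T A n ⟶ smashPow T A n) → Prop
  | one (n : ℕ) : SmashPerm T A (1 : Equiv.Perm (Fin n)) (𝟙 _)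
  | mul {n : ℕ} {τ τ' : Equiv.Perm (Fin n)} {t t' : smashPow T A n ⟶ smashPow T A n} :
      SmashPerm T A τ t → SmashPerm T A τ' t' → SmashPerm T A (τ' * τ) (t ≫ t')
  | smash {n : ℕ} {τ : Equiv.Perm (Fin n)} {t : smashPow T A n ⟶ smashPow T A n} :
      SmashPerm T A τ t → SmashPerm T A (n := n + 1) (blockSum τ (1 : Equiv.Perm (Fin 1))) (t ▷ T)
  | swap (n : ℕ) :
      SmashPerm T A (n := n + 2) (blockSum (1 : Equiv.Perm (Fin n)) (Equiv.swap (0 : Fin 2) 1))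
        (swapLast T (smashPow T A n))

/-! ### Spectra and symmetric spectra -/

/-- A `T`-spectrum in `D`: objects `X_n` with structure maps `σ_n : X_n ∧ T ⟶ X_{n+1}`. -/
structure TSpectrum (T : D) where
  obj : ℕ → D
  σ : ∀ n, obj n ⊗ T ⟶ obj (n + 1)

/-- The iterated structure map `σ^l : X_m ∧ T^l ⟶ X_{m+l}`. -/
def TSpectrum.iter {T : D} (X : TSpectrum T) (m : ℕ) : ∀ l, smashPow T (X.obj m) l ⟶ X.obj (m + l)
  | 0 => 𝟙 _
  | l + 1 => X.iter m l ▷ T ≫ X.σ (m + l)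

/-- A symmetric `T`-spectrum in `D`: a `T`-spectrum with (left) actions of `Σ_n` on `X_n` such that
the iterated structure map `σ^l : X_m ∧ T^l ⟶ X_{m+l}` is `Σ_m × Σ_l`-equivariant. -/
structure SymSpectrum (T : D) extends TSpectrum T where
  act : ∀ n, Equiv.Perm (Fin n) →* End (obj n)
  equivariant : ∀ (m l : ℕ) (γ : Equiv.Perm (Fin m)) (τ : Equiv.Perm (Fin l))
    (t : smashPow T (obj m) l ⟶ smashPow T (obj m) l), SmashPerm T (obj m) τ t →
    smashPowMap T (act m γ) l ≫ t ≫ toTSpectrum.iter m l =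
      toTSpectrum.iter m l ≫ act (m + l) (blockSum γ τ)


lemma equivariant_step (T : D) {A B C : D} {g : A ⟶ A} {x : A ⟶ B} {b : B ⟶ B} {s : B ⊗ T ⟶ C}
    {c : C ⟶ C} (h : g ≫ x = x ≫ b) (hs : b ▷ T ≫ s = s ≫ c) :
    g ▷ T ≫ x ▷ T ≫ s = (x ▷ T ≫ s) ≫ c := by
  rw [← comp_whiskerRight_assoc, h, comp_whiskerRight_assoc, hs, Category.assoc]

lemma equivariant_swap_step (T : D) {A B C E : D} {x : A ⟶ B} {s : B ⊗ T ⟶ C} {s' : C ⊗ T ⟶ E}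
    {e : E ⟶ E} (h : swapLast T B ≫ s ▷ T ≫ s' = s ▷ T ≫ s' ≫ e) :
    swapLast T A ≫ (x ▷ T ≫ s) ▷ T ≫ s' = ((x ▷ T ≫ s) ▷ T ≫ s') ≫ e := by
  have h' := swapLast_naturality T x
  simp only [comp_whiskerRight, Category.assoc]
  rw [reassoc_of% h', h]

lemma TSpectrum.iter_smashPowMap {T : D} (X : TSpectrum T)
    (act : ∀ n, Equiv.Perm (Fin n) →* End (X.obj n))
    (h₁ : ∀ (m : ℕ) (γ : Equiv.Perm (Fin m)), (act m γ : X.obj m ⟶ X.obj m) ▷ T ≫ X.σ m =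
      X.σ m ≫ act (m + 1) (blockSum γ (1 : Equiv.Perm (Fin 1))))
    (m l : ℕ) (γ : Equiv.Perm (Fin m)) :
    smashPowMap T (act m γ) l ≫ X.iter m l =
      X.iter m l ≫ act (m + l) (blockSum γ (1 : Equiv.Perm (Fin l))) := by
  induction l with
  | zero =>
    have : blockSum γ (1 : Equiv.Perm (Fin 0)) = γ := by
      ext i; simpa using! blockSum_val γ (1 : Equiv.Perm (Fin 0)) i
    rw [this]
    exact (Category.comp_id _).trans (Category.id_comp _).symm
  | succ l ih =>
    have : blockSum (blockSum γ (1 : Equiv.Perm (Fin l))) (1 : Equiv.Perm (Fin 1)) =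
        blockSum γ (1 : Equiv.Perm (Fin (l + 1))) := by
      rw [← blockSum_one l 1]; ext i; exact blockSum_assoc γ 1 1 i i.2
    exact equivariant_step T ih (this ▸ h₁ (m + l) _)

lemma TSpectrum.iter_smashPerm {T : D} (X : TSpectrum T)
    (act : ∀ n, Equiv.Perm (Fin n) →* End (X.obj n))
    (h₁ : ∀ (m : ℕ) (γ : Equiv.Perm (Fin m)), (act m γ : X.obj m ⟶ X.obj m) ▷ T ≫ X.σ m =
      X.σ m ≫ act (m + 1) (blockSum γ (1 : Equiv.Perm (Fin 1))))
    (h₂ : ∀ m : ℕ, swapLast T (X.obj m) ≫ X.σ m ▷ T ≫ X.σ (m + 1) =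
      X.σ m ▷ T ≫ X.σ (m + 1) ≫
        act (m + 2) (blockSum (1 : Equiv.Perm (Fin m)) (Equiv.swap (0 : Fin 2) 1)))
    (m : ℕ) {l : ℕ} {τ : Equiv.Perm (Fin l)} {t : smashPow T (X.obj m) l ⟶ smashPow T (X.obj m) l}
    (ht : SmashPerm T (X.obj m) τ t) :
    t ≫ X.iter m l = X.iter m l ≫ act (m + l) (blockSum (1 : Equiv.Perm (Fin m)) τ) := by
  induction ht with
  | one n =>
    rw [blockSum_one, map_one, Category.id_comp]; exact (Category.comp_id _).symm
  | @mul n τ τ' t t' _ _ ih ih' =>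
    rw [Category.assoc, ih', ← Category.assoc, ih, Category.assoc]
    congr 1
    rw [← mul_one (1 : Equiv.Perm (Fin m)), blockSum_mul, map_mul, mul_one]
    rfl
  | @smash n τ t _ ih =>
    have : blockSum (blockSum (1 : Equiv.Perm (Fin m)) τ) (1 : Equiv.Perm (Fin 1)) =
        blockSum (1 : Equiv.Perm (Fin m)) (blockSum τ (1 : Equiv.Perm (Fin 1))) := by
      ext i; exact blockSum_assoc 1 τ 1 i i.2
    exact equivariant_step T ih (this ▸ h₁ (m + n) _)
  | swap n =>
    have : blockSum (1 : Equiv.Perm (Fin (m + n))) (Equiv.swap (0 : Fin 2) 1) =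
        blockSum (1 : Equiv.Perm (Fin m))
          (blockSum (1 : Equiv.Perm (Fin n)) (Equiv.swap (0 : Fin 2) 1)) := by
      rw [← blockSum_one m n]; ext i; exact blockSum_assoc 1 1 _ i i.2
    exact equivariant_swap_step T (this ▸ h₂ (m + n))

/-- It suffices to check equivariance for one structure map with respect to `Σ_m` and for two
structure maps with respect to the exchange of the two factors `T`. -/
def SymSpectrum.ofGenerators {T : D} (X : TSpectrum T)
    (act : ∀ n, Equiv.Perm (Fin n) →* End (X.obj n))
    (h₁ : ∀ (m : ℕ) (γ : Equiv.Perm (Fin m)), (act m γ : X.obj m ⟶ X.obj m) ▷ T ≫ X.σ m =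
      X.σ m ≫ act (m + 1) (blockSum γ (1 : Equiv.Perm (Fin 1))))
    (h₂ : ∀ m : ℕ, swapLast T (X.obj m) ≫ X.σ m ▷ T ≫ X.σ (m + 1) =
      X.σ m ▷ T ≫ X.σ (m + 1) ≫
        act (m + 2) (blockSum (1 : Equiv.Perm (Fin m)) (Equiv.swap (0 : Fin 2) 1))) :
    SymSpectrum T where
  toTSpectrum := X
  act := act
  equivariant m l γ τ t ht := by
    rw [X.iter_smashPerm act h₁ h₂ m ht, ← Category.assoc, X.iter_smashPowMap act h₁,
      Category.assoc]
    congr 1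
    rw [← mul_one τ, ← one_mul γ, blockSum_mul, map_mul, one_mul, mul_one]
    rfl

lemma SymSpectrum.equivariant_one {T : D} (X : SymSpectrum T) (m : ℕ) (γ : Equiv.Perm (Fin m)) :
    (X.act m γ : X.obj m ⟶ X.obj m) ▷ T ≫ X.σ m =
      X.σ m ≫ X.act (m + 1) (blockSum γ (1 : Equiv.Perm (Fin 1))) := by
  have aux : ∀ {A C : D} {a : A ⟶ A} {s : A ⊗ T ⟶ C} {e : C ⟶ C},
      a ▷ T ≫ 𝟙 (A ⊗ T) ≫ (𝟙 A ▷ T ≫ s) = (𝟙 A ▷ T ≫ s) ≫ e → a ▷ T ≫ s = s ≫ e := by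
    intro A C a s e h; simpa using h
  exact aux (X.equivariant m 1 γ 1 _ (.one 1))

lemma SymSpectrum.equivariant_swap {T : D} (X : SymSpectrum T) (m : ℕ) :
    swapLast T (X.obj m) ≫ X.σ m ▷ T ≫ X.σ (m + 1) = X.σ m ▷ T ≫ X.σ (m + 1) ≫
        X.act (m + 2) (blockSum (1 : Equiv.Perm (Fin m)) (Equiv.swap (0 : Fin 2) 1)) := by
  have aux : ∀ {A C E : D} {a : A ⟶ A} {s : A ⊗ T ⟶ C} {s' : C ⊗ T ⟶ E} {e : E ⟶ E}, a = 𝟙 A →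
      a ▷ T ▷ T ≫ swapLast T A ≫ ((𝟙 A ▷ T ≫ s) ▷ T ≫ s') = ((𝟙 A ▷ T ≫ s) ▷ T ≫ s') ≫ e →
      swapLast T A ≫ s ▷ T ≫ s' = s ▷ T ≫ s' ≫ e := by
    intro A C E a s s' e ha h; subst ha; simpa using h
  have hs : blockSum (1 : Equiv.Perm (Fin 0)) (Equiv.swap (0 : Fin 2) 1) = Equiv.swap 0 1 := by
    decide
  refine aux ?_ (hs ▸ X.equivariant m 2 1 _ _ (.swap 0))
  rw [map_one]; rfl

/-- The `T`-spectrum `sh X` with `(sh X)_n = X_{1+n}`. -/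
def TSpectrum.sh {T : D} (X : TSpectrum T) : TSpectrum T where
  obj n := X.obj (1 + n)
  σ n := X.σ (1 + n)

/-- The `T`-spectrum `T ∧ X` with structure maps `T ∧ σ_n`. -/
def TSpectrum.smash {T : D} (X : TSpectrum T) : TSpectrum T where
  obj n := T ⊗ X.obj n
  σ n := (α_ T (X.obj n) T).hom ≫ T ◁ X.σ n

/-- The evaluation `Hom(T, A) ∧ T ⟶ A`. -/
def evRight (T A : D) : (ihom T).obj A ⊗ T ⟶ A := (β_ _ _).hom ≫ (ihom.ev T).app A

/-- For `s : A ∧ T ⟶ B`, the map `Hom(T, A) ∧ T ⟶ Hom(T, B)` adjoint to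
`Hom(T, A) ∧ T ∧ T ⟶ A ∧ T ⟶ B`, where the evaluation uses the last factor `T`. -/
def loopσ (T : D) {A B : D} (s : A ⊗ T ⟶ B) : (ihom T).obj A ⊗ T ⟶ (ihom T).obj B :=
  MonoidalClosed.curry ((α_ T ((ihom T).obj A) T).inv ≫ (ihom.ev T).app A ▷ T ≫ s)

/-- The map `loopσ s` is characterized by `ev ∘ (loopσ s ∧ T) = s ∘ (ev ∧ T) ∘ (1 ∧ t)`, with the
exchange `t` of the two factors `T`. -/
lemma loopσ_evRight (T : D) {A B : D} (s : A ⊗ T ⟶ B) :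
    loopσ T s ▷ T ≫ evRight T B = swapLast T _ ≫ evRight T A ▷ T ≫ s := by
  have h : T ◁ loopσ T s ≫ (ihom.ev T).app B =
      (α_ T ((ihom T).obj A) T).inv ≫ (ihom.ev T).app A ▷ T ≫ s :=
    (MonoidalClosed.uncurry_eq _).symm.trans (MonoidalClosed.uncurry_curry _)
  have h' : (β_ ((ihom T).obj A ⊗ T) T).hom ≫ (α_ T ((ihom T).obj A) T).inv =
      swapLast T _ ≫ (β_ ((ihom T).obj A) T).hom ▷ T := by
    rw [swapLast, BraidedCategory.braiding_tensor_left_hom]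
    simp
  have h'' : loopσ T s ▷ T ≫ (β_ ((ihom T).obj B) T).hom =
      (β_ ((ihom T).obj A ⊗ T) T).hom ≫ T ◁ loopσ T s :=
    BraidedCategory.braiding_naturality_left _ _
  rw [evRight, evRight, reassoc_of% h'', h, reassoc_of% h', comp_whiskerRight_assoc]

lemma evRight_naturality (T : D) {A B : D} (f : A ⟶ B) :
    (ihom T).map f ▷ T ≫ evRight T B = evRight T A ≫ f := by
  simp [evRight]

lemma evRight_ext (T : D) {Z A : D} {f g : Z ⟶ (ihom T).obj A}
    (h : f ▷ T ≫ evRight T A = g ▷ T ≫ evRight T A) : f = g := by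
  simp only [evRight, BraidedCategory.braiding_naturality_left_assoc, cancel_epi] at h
  apply MonoidalClosed.uncurry_injective
  rwa [MonoidalClosed.uncurry_eq, MonoidalClosed.uncurry_eq]

lemma loopσ_equivariant (T : D) {A B : D} {s : A ⊗ T ⟶ B} {a : A ⟶ A} {b : B ⟶ B}
    (h : a ▷ T ≫ s = s ≫ b) :
    (ihom T).map a ▷ T ≫ loopσ T s = loopσ T s ≫ (ihom T).map b := by
  apply evRight_ext
  have h₁ := swapLast_naturality T ((ihom T).map a)
  rw [comp_whiskerRight_assoc, comp_whiskerRight_assoc, evRight_naturality, loopσ_evRight,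
    ← reassoc_of% h₁, ← comp_whiskerRight_assoc, evRight_naturality, comp_whiskerRight_assoc, h,
    ← reassoc_of% (loopσ_evRight T s)]

lemma swapLast_braid (T A : D) :
    swapLast T A ▷ T ≫ swapLast T (A ⊗ T) ≫ swapLast T A ▷ T =
      swapLast T (A ⊗ T) ≫ swapLast T A ▷ T ≫ swapLast T (A ⊗ T) := by
  have h₁ : swapLast T A ▷ T = (α_ (A ⊗ T) T T).hom ≫ (α_ A T (T ⊗ T)).hom ≫
      A ◁ ((α_ T T T).inv ≫ (β_ T T).hom ▷ T ≫ (α_ T T T).hom) ≫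
      (α_ A T (T ⊗ T)).inv ≫ (α_ (A ⊗ T) T T).inv := by
    simp only [swapLast]; monoidal
  have h₂ : swapLast T (A ⊗ T) = (α_ (A ⊗ T) T T).hom ≫ (α_ A T (T ⊗ T)).hom ≫
      A ◁ (T ◁ (β_ T T).hom) ≫ (α_ A T (T ⊗ T)).inv ≫ (α_ (A ⊗ T) T T).inv := by
    simp only [swapLast]; monoidal
  have h := BraidedCategory.yang_baxter T T T
  rw [h₁, h₂]
  simpa using congrArg (fun x => (α_ (A ⊗ T) T T).hom ≫ (α_ A T (T ⊗ T)).hom ≫ A ◁ x ≫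
    (α_ A T (T ⊗ T)).inv ≫ (α_ (A ⊗ T) T T).inv) h

lemma loopσ_swap (T : D) {A B C : D} {s : A ⊗ T ⟶ B} {s' : B ⊗ T ⟶ C} {e : C ⟶ C}
    (h : swapLast T A ≫ s ▷ T ≫ s' = s ▷ T ≫ s' ≫ e) :
    swapLast T _ ≫ loopσ T s ▷ T ≫ loopσ T s' =
      loopσ T s ▷ T ≫ loopσ T s' ≫ (ihom T).map e := by
  apply evRight_ext
  have h₁ := swapLast_naturality T (loopσ T s)
  have h₂ := swapLast_naturality T (evRight T A)
  have h₃ := swapLast_braid T ((ihom T).obj A)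
  simp only [comp_whiskerRight, Category.assoc, evRight_naturality]
  rw [loopσ_evRight, reassoc_of% (loopσ_evRight T s'), ← reassoc_of% h₁,
    ← comp_whiskerRight_assoc (loopσ T s ▷ T), loopσ_evRight]
  simp only [comp_whiskerRight, Category.assoc]
  have h₄ : loopσ T s ▷ T ▷ T ≫ evRight T B ▷ T = swapLast T _ ▷ T ≫ evRight T A ▷ T ▷ T ≫ s ▷ T := by
    rw [← comp_whiskerRight, loopσ_evRight, comp_whiskerRight, comp_whiskerRight]
  rw [← reassoc_of% h₁, reassoc_of% h₄, ← h, ← reassoc_of% h₂, reassoc_of% h₃]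

/-- The `T`-spectrum `Ω X` with `(Ω X)_n = Hom(T, X_n)`. Its structure map is adjoint to
`Hom(T, X_n) ∧ T ∧ T ⟶ X_n ∧ T ⟶ X_{n+1}`, where the evaluation uses the last factor `T`. -/
def TSpectrum.loop {T : D} (X : TSpectrum T) : TSpectrum T where
  obj n := (ihom T).obj (X.obj n)
  σ n := loopσ T (X.σ n)

lemma smashσ_swap (T : D) {A B C : D} {s : A ⊗ T ⟶ B} {s' : B ⊗ T ⟶ C} {e : C ⟶ C}
    (h : swapLast T A ≫ s ▷ T ≫ s' = s ▷ T ≫ s' ≫ e) :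
    swapLast T (T ⊗ A) ≫ ((α_ T A T).hom ≫ T ◁ s) ▷ T ≫ (α_ T B T).hom ≫ T ◁ s' =
      ((α_ T A T).hom ≫ T ◁ s) ▷ T ≫ ((α_ T B T).hom ≫ T ◁ s') ≫ T ◁ e := by
  have h₁ : swapLast T (T ⊗ A) ≫ (α_ T A T).hom ▷ T ≫ (α_ T (A ⊗ T) T).hom =
      (α_ T A T).hom ▷ T ≫ (α_ T (A ⊗ T) T).hom ≫ T ◁ swapLast T A := by
    simp only [swapLast]
    simp
  simp only [comp_whiskerRight, Category.assoc, associator_naturality_middle_assoc]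
  rw [reassoc_of% h₁, ← MonoidalCategory.whiskerLeft_comp, ← MonoidalCategory.whiskerLeft_comp, h]
  simp

/-- The symmetric spectrum `sh X`; here `γ ∈ Σ_n` acts on `X_{1+n}` as `1 + γ ∈ Σ_{1+n}`. -/
def SymSpectrum.sh {T : D} (X : SymSpectrum T) : SymSpectrum T :=
  .ofGenerators X.toTSpectrum.sh
    (fun n =>
      { toFun := fun γ => X.act (1 + n) (blockSum (1 : Equiv.Perm (Fin 1)) γ)
        map_one' := by rw [blockSum_one, map_one]; rfl
        map_mul' := fun γ γ' => by
          rw [← mul_one (1 : Equiv.Perm (Fin 1)), blockSum_mul, map_mul, mul_one]; rfl })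
    (fun m γ => by
      have : blockSum (blockSum (1 : Equiv.Perm (Fin 1)) γ) (1 : Equiv.Perm (Fin 1)) =
          blockSum (1 : Equiv.Perm (Fin 1)) (blockSum γ (1 : Equiv.Perm (Fin 1))) := by
        ext i; exact blockSum_assoc 1 γ 1 i i.2
      have h := X.equivariant_one (1 + m) (blockSum (1 : Equiv.Perm (Fin 1)) γ)
      rw [this] at h
      exact h)
    (fun m => by
      have : blockSum (1 : Equiv.Perm (Fin (1 + m))) (Equiv.swap (0 : Fin 2) 1) =
          blockSum (1 : Equiv.Perm (Fin 1))
            (blockSum (1 : Equiv.Perm (Fin m)) (Equiv.swap (0 : Fin 2) 1)) := by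
        rw [← blockSum_one 1 m]; ext i; exact blockSum_assoc 1 1 _ i i.2
      have h := X.equivariant_swap (1 + m)
      rw [this] at h
      exact h)

/-- The symmetric spectrum `T ∧ X`, with the action of `Σ_n` on the factor `X_n`. -/
def SymSpectrum.smash {T : D} (X : SymSpectrum T) : SymSpectrum T :=
  .ofGenerators X.toTSpectrum.smash
    (fun n =>
      { toFun := fun γ => T ◁ (X.act n γ : X.obj n ⟶ X.obj n)
        map_one' := by rw [map_one]; exact MonoidalCategory.whiskerLeft_id _ _
        map_mul' := fun γ γ' => by
          rw [map_mul]; exact MonoidalCategory.whiskerLeft_comp _ _ _ })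
    (fun m γ => by
      have aux : ∀ {A B : D} {a : A ⟶ A} {s : A ⊗ T ⟶ B} {b : B ⟶ B}, a ▷ T ≫ s = s ≫ b →
          (T ◁ a) ▷ T ≫ (α_ T A T).hom ≫ T ◁ s = ((α_ T A T).hom ≫ T ◁ s) ≫ T ◁ b := by
        intro A B a s b h
        rw [associator_naturality_middle_assoc, ← MonoidalCategory.whiskerLeft_comp, h,
          MonoidalCategory.whiskerLeft_comp, Category.assoc]
      exact aux (X.equivariant_one m γ))
    (fun m => smashσ_swap T (X.equivariant_swap m))

/-- The symmetric spectrum `Ω X`, with the action of `Σ_n` induced by that on `X_n`. -/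
def SymSpectrum.loop {T : D} (X : SymSpectrum T) : SymSpectrum T :=
  .ofGenerators X.toTSpectrum.loop
    (fun n =>
      { toFun := fun γ => (ihom T).map (X.act n γ : X.obj n ⟶ X.obj n)
        map_one' := by rw [map_one]; exact (ihom T).map_id _
        map_mul' := fun γ γ' => by
          rw [map_mul]; exact (ihom T).map_comp _ _ })
    (fun m γ => loopσ_equivariant T (X.equivariant_one m γ))
    (fun m => loopσ_swap T (X.equivariant_swap m))

end

section

variable {D : Type u} [Category.{v} D] [ModelCategory D] [MonoidalCategory D] [SymmetricCategory D]
  [MonoidalClosed D] [MonoidalModelCategory D]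

/-! ### Cogroup structures -/

/-- A cogroup structure on `T` in `Ho(D)`: a group structure on `[T, Y]`, natural in `Y`. -/
class HoCogroup (T : D) where
  [grp : ∀ Y : Ho D, AddGroup ((toHo D).obj T ⟶ Y)]
  add_comp {Y Z : Ho D} (f g : (toHo D).obj T ⟶ Y) (h : Y ⟶ Z) : (f + g) ≫ h = f ≫ h + g ≫ h

instance HoCogroup.instAddGroup (T : D) [HoCogroup T] (Y : Ho D) :
    AddGroup ((toHo D).obj T ⟶ Y) := HoCogroup.grp Y

/-- The map `f ∧ T ∧ ⋯ ∧ T` of `Ho(D)`, for a map `f` of `Ho(D)`. -/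
def hoPow (T : D) [SmashPreservesWeakEquivalences T] {A B : D} (f : HoHom A B) :
    ∀ n : ℕ, HoHom (smashPow T A n) (smashPow T B n)
  | 0 => f
  | n + 1 => hoSmash T (hoPow T f n)

lemma hoPow_comp (T : D) [SmashPreservesWeakEquivalences T] {A B C : D} (f : HoHom A B)
    (g : HoHom B C) (n : ℕ) : hoPow T (f ≫ g) n = hoPow T f n ≫ hoPow T g n := by
  induction n with
  | zero => rfl
  | succ n ih => exact (congrArg (hoSmash T) ih).trans (hoSmash_comp T _ _)

lemma hoPow_id (T : D) [SmashPreservesWeakEquivalences T] (A : D) (n : ℕ) :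
    hoPow T (𝟙 ((toHo D).obj A)) n = 𝟙 _ := by
  induction n with
  | zero => rfl
  | succ n ih => exact (congrArg (hoSmash T) ih).trans (hoSmash_id T _)

lemma hoPow_hoMap (T : D) [SmashPreservesWeakEquivalences T] {A B : D} (f : A ⟶ B) (n : ℕ) :
    hoPow T (hoMap f) n = hoMap (smashPowMap T f n) := by
  induction n with
  | zero => rfl
  | succ n ih => exact (congrArg (hoSmash T) ih).trans (hoSmash_hoMap T _)

lemma isCofibrant_smashPow (T A : D) [IsCofibrant T] [IsCofibrant A] (n : ℕ) :
    IsCofibrant (smashPow T A n) := by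
  induction n with
  | zero => assumption
  | succ n ih => exact isCofibrant_tensor _ _

lemma nonempty_isColimit_smashPow (T : D) {A B C : D} (i : A ⟶ C) (j : B ⟶ C)
    (h : IsColimit (BinaryCofan.mk i j)) (n : ℕ) :
    Nonempty (IsColimit (BinaryCofan.mk (smashPowMap T i n) (smashPowMap T j n))) := by
  induction n with
  | zero => exact ⟨h⟩
  | succ n ih => exact ih.map fun h => mapIsColimitOfPreservesOfIsColimit (tensorRight T) _ _ h

instance isCofibrant_coprod (A B : D) [IsCofibrant A] [IsCofibrant B] : IsCofibrant (A ⨿ B) := by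
  have hj : Cofibration (coprod.inr : B ⟶ A ⨿ B) := by
    rw [cofibration_iff]
    exact MorphismProperty.of_isPushout
      (IsPushout.of_isColimit_binaryCofan_of_isInitial (coprodIsCoprod A B) initialIsInitial)
      ((cofibration_iff _).1 (inferInstance : Cofibration (initial.to A)))
  exact isCofibrant_of_cofibration (coprod.inr : B ⟶ A ⨿ B)

/-- The map `V ∧ f ∧ T ∧ ⋯ ∧ T` of `Ho(D)`, for cofibrant `V` and a map `f` of `Ho(D)` between
objects that are cofibrant in `D`. -/
def midMap (T V : D) [SmashPreservesWeakEquivalences T] [IsCofibrant V] (k : ℕ) {A B : D}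
    [IsCofibrant A] [IsCofibrant B] (f : HoHom A B) :
    HoHom (smashPow T (V ⊗ A) k) (smashPow T (V ⊗ B) k) := hoPow T (cofSmash V f) k

section

variable (T V : D) [SmashPreservesWeakEquivalences T] [IsCofibrant V] (k : ℕ)

lemma midMap_comp {A B C : D} [IsCofibrant A] [IsCofibrant B] [IsCofibrant C] (f : HoHom A B)
    (g : HoHom B C) : midMap T V k (f ≫ g) = midMap T V k f ≫ midMap T V k g := by
  rw [midMap, cofSmash_comp, hoPow_comp]; rfl

lemma midMap_id (A : D) [IsCofibrant A] : midMap T V k (𝟙 ((toHo D).obj A)) = 𝟙 _ := by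
  rw [midMap, cofSmash_id, hoPow_id]

/-- `V ∧ (A ∨ B) ∧ T^k` is a coproduct of `V ∧ A ∧ T^k` and `V ∧ B ∧ T^k` in `Ho(D)`. -/
lemma existsUnique_midMap_desc [IsCofibrant T] {A B Y : D} [IsCofibrant A] [IsCofibrant B]
    (f : HoHom (smashPow T (V ⊗ A) k) Y) (g : HoHom (smashPow T (V ⊗ B) k) Y) :
    ∃! u : HoHom (smashPow T (V ⊗ (A ⨿ B)) k) Y,
      midMap T V k (hoMap coprod.inl) ≫ u = f ∧ midMap T V k (hoMap coprod.inr) ≫ u = g := by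
  have := isCofibrant_smashPow T (V ⊗ A) k
  have := isCofibrant_smashPow T (V ⊗ B) k
  obtain ⟨h⟩ := nonempty_isColimit_smashPow T (V ◁ (coprod.inl : A ⟶ A ⨿ B)) (V ◁ coprod.inr)
    (mapIsColimitOfPreservesOfIsColimit (tensorLeft V) _ _ (coprodIsCoprod A B)) k
  simp only [midMap, cofSmash_hoMap, hoPow_hoMap]
  exact existsUnique_ho_desc _ _ h f g

/-- The map out of `V ∧ (A ∨ B) ∧ T^k` in `Ho(D)` with given components. -/
def midDesc [IsCofibrant T] {A B Y : D} [IsCofibrant A] [IsCofibrant B]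
    (f : HoHom (smashPow T (V ⊗ A) k) Y) (g : HoHom (smashPow T (V ⊗ B) k) Y) :
    HoHom (smashPow T (V ⊗ (A ⨿ B)) k) Y := (existsUnique_midMap_desc T V k f g).choose

lemma inl_midDesc [IsCofibrant T] {A B Y : D} [IsCofibrant A] [IsCofibrant B]
    (f : HoHom (smashPow T (V ⊗ A) k) Y) (g : HoHom (smashPow T (V ⊗ B) k) Y) :
    midMap T V k (hoMap coprod.inl) ≫ midDesc T V k f g = f :=
  (existsUnique_midMap_desc T V k f g).choose_spec.1.1

lemma inr_midDesc [IsCofibrant T] {A B Y : D} [IsCofibrant A] [IsCofibrant B]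
    (f : HoHom (smashPow T (V ⊗ A) k) Y) (g : HoHom (smashPow T (V ⊗ B) k) Y) :
    midMap T V k (hoMap coprod.inr) ≫ midDesc T V k f g = g :=
  (existsUnique_midMap_desc T V k f g).choose_spec.1.2

lemma eq_midDesc [IsCofibrant T] {A B Y : D} [IsCofibrant A] [IsCofibrant B]
    {f : HoHom (smashPow T (V ⊗ A) k) Y} {g : HoHom (smashPow T (V ⊗ B) k) Y}
    {u : HoHom (smashPow T (V ⊗ (A ⨿ B)) k) Y} (h₁ : midMap T V k (hoMap coprod.inl) ≫ u = f)
    (h₂ : midMap T V k (hoMap coprod.inr) ≫ u = g) : u = midDesc T V k f g :=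
  (existsUnique_midMap_desc T V k f g).unique ⟨h₁, h₂⟩ ⟨inl_midDesc .., inr_midDesc ..⟩

end

/-- The comultiplication `T ⟶ T ∨ T` in `Ho(D)`. -/
def comult (T : D) [HoCogroup T] : HoHom T (T ⨿ T) :=
  (hoMap coprod.inl : HoHom T (T ⨿ T)) + hoMap coprod.inr

section

variable {T V : D} [IsCofibrant T] [SmashPreservesWeakEquivalences T] [HoCogroup T] [IsCofibrant V]
  {k : ℕ} {Y : D}

/-- The sum of `f, g ∈ [V ∧ T^{k+1}, Y]` is the composition of
`V ∧ T^{k+1} ⟶ V ∧ (T ∨ T) ∧ T^k ≅ (V ∧ T^{k+1}) ∨ (V ∧ T^{k+1})`, given by the comultiplication of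
the first factor `T`, with the map `(f, g)`. -/
def midAdd (f g : HoHom (smashPow T (V ⊗ T) k) Y) : HoHom (smashPow T (V ⊗ T) k) Y :=
  midMap T V k (comult T) ≫ midDesc T V k f g

lemma midMap_add {C : D} [IsCofibrant C] (a b : HoHom T C)
    (u : HoHom (smashPow T (V ⊗ C) k) Y) :
    midMap T V k (a + b) ≫ u = midAdd (midMap T V k a ≫ u) (midMap T V k b ≫ u) := by
  obtain ⟨w, ⟨h₁, h₂⟩, -⟩ := existsUnique_ho_desc _ _ (coprodIsCoprod T T) a b
  have h : a + b = comult T ≫ w := by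
    rw [comult, HoCogroup.add_comp, ← h₁, ← h₂]
  rw [h, midMap_comp, Category.assoc, midAdd]
  congr 1
  apply eq_midDesc
  · rw [← Category.assoc, ← midMap_comp, h₁]
  · rw [← Category.assoc, ← midMap_comp, h₂]

lemma midAdd_comp {Z : D} (f g : HoHom (smashPow T (V ⊗ T) k) Y) (u : HoHom Y Z) :
    midAdd f g ≫ u = midAdd (f ≫ u) (g ≫ u) := by
  rw [midAdd, midAdd, Category.assoc]
  congr 1
  apply eq_midDesc
  · rw [← Category.assoc, inl_midDesc]
  · rw [← Category.assoc, inr_midDesc]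

lemma hoSmash_midAdd (f g : HoHom (smashPow T (V ⊗ T) k) Y) :
    hoSmash T (midAdd f g) = midAdd (k := k + 1) (hoSmash T f) (hoSmash T g) := by
  have h : hoSmash T (midDesc T V k f g) = midDesc T V (k + 1) (hoSmash T f) (hoSmash T g) := by
    exact eq_midDesc T V (k + 1)
      ((hoSmash_comp T _ _).symm.trans (congrArg _ (inl_midDesc T V k f g)))
      ((hoSmash_comp T _ _).symm.trans (congrArg _ (inr_midDesc T V k f g)))
  exact (hoSmash_comp T _ _).trans (congrArg (hoSmash T (midMap T V k (comult T)) ≫ ·) h)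

lemma HoCogroup.zero_comp {Y Z : Ho D} (h : Y ⟶ Z) :
    (0 : (toHo D).obj T ⟶ Y) ≫ h = 0 := by
  have := HoCogroup.add_comp (0 : (toHo D).obj T ⟶ Y) 0 h
  rw [add_zero] at this
  exact left_eq_add.1 this

lemma midMap_zero (f g : HoHom (smashPow T (V ⊗ T) k) Y) :
    midMap T V k (0 : HoHom T T) ≫ f = midMap T V k (0 : HoHom T T) ≫ g := by
  have h : ∀ i : HoHom T (T ⨿ T), midMap T V k (0 : HoHom T T) ≫ midMap T V k i =
      midMap T V k (0 : HoHom T (T ⨿ T)) := fun i => by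
    rw [← midMap_comp, HoCogroup.zero_comp]
  have h₁ := inl_midDesc T V k f g
  have h₂ := inr_midDesc T V k f g
  rw [← h₁]
  nth_rw 2 [← h₂]
  rw [← Category.assoc, h, ← Category.assoc, h]

lemma midAdd_assoc (f g h : HoHom (smashPow T (V ⊗ T) k) Y) :
    midAdd (midAdd f g) h = midAdd f (midAdd g h) := by
  let u := midDesc T V k f (midDesc T V k g h)
  have h₁ : midMap T V k (hoMap coprod.inl) ≫ u = f := inl_midDesc ..
  have h₂ : midMap T V k (hoMap coprod.inl ≫ hoMap coprod.inr) ≫ u = g := by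
    rw [midMap_comp, Category.assoc, inr_midDesc, inl_midDesc]
  have h₃ : midMap T V k (hoMap coprod.inr ≫ hoMap coprod.inr) ≫ u = h := by
    rw [midMap_comp, Category.assoc, inr_midDesc, inr_midDesc]
  rw [← h₁, ← h₂, ← h₃, ← midMap_add, ← midMap_add, ← midMap_add, ← midMap_add, add_assoc]

lemma zero_midAdd (f g : HoHom (smashPow T (V ⊗ T) k) Y) :
    midAdd (midMap T V k (0 : HoHom T T) ≫ g) f = f := by
  have h := midMap_add (0 : HoHom T T) (𝟙 _) f
  rwa [zero_add, midMap_id, Category.id_comp, midMap_zero f g, eq_comm] at h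

lemma neg_midAdd (f g : HoHom (smashPow T (V ⊗ T) k) Y) :
    midAdd (midMap T V k (-𝟙 ((toHo D).obj T)) ≫ f) f = midMap T V k (0 : HoHom T T) ≫ g := by
  have h := midMap_add (-𝟙 ((toHo D).obj T)) (𝟙 _) f
  rwa [neg_add_cancel, midMap_id, Category.id_comp, midMap_zero f g, eq_comm] at h

end

/-- `Level T V k Y` is the group `[V ∧ T^{k+1}, Y]`. -/
def Level (T V : D) (k : ℕ) (Y : D) := HoHom (smashPow T (V ⊗ T) k) Y

variable {T V : D} [IsCofibrant T] [SmashPreservesWeakEquivalences T] [HoCogroup T] [IsCofibrant V]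
  [HasZeroObject D]

/-- The group structure on `[V ∧ T^{k+1}, Y]` given by the comultiplication of the first factor
`T`. -/
instance Level.instAddGroup {k : ℕ} {Y : D} : AddGroup (Level T V k Y) :=
  letI : Add (Level T V k Y) := ⟨midAdd⟩
  letI : Zero (Level T V k Y) := ⟨midMap T V k (0 : HoHom T T) ≫
    hoMap ((isZero_zero D).from_ _ ≫ (isZero_zero D).to_ _)⟩
  letI : Neg (Level T V k Y) := ⟨fun f => midMap T V k (-𝟙 ((toHo D).obj T)) ≫ f⟩
  AddGroup.ofLeftAxioms midAdd_assoc (fun f => zero_midAdd f _) (fun f => neg_midAdd f _)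

end

section

variable {D : Type u} [Category.{v} D] [ModelCategory D] [MonoidalCategory D] [SymmetricCategory D]
  [MonoidalClosed D] [MonoidalModelCategory D]

/-! ### Signs -/

/-- `|τ|`: it is `s` if the permutation `τ` is odd, and the identity otherwise. -/
def permSign {T : D} (s : HoHom T T) {n : ℕ} (τ : Equiv.Perm (Fin n)) : HoHom T T :=
  if Equiv.Perm.sign τ = 1 then 𝟙 _ else s

/-- The map `e ∧ T^{n-1}` of `Ho(D)`, for a map `e : A ∧ T ⟶ A ∧ T` in `Ho(D)`
(and the identity of `A` if `n = 0`). -/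
def firstMap (T : D) [SmashPreservesWeakEquivalences T] {A : D} (e : HoHom (A ⊗ T) (A ⊗ T)) :
    ∀ n : ℕ, HoHom (smashPow T A n) (smashPow T A n)
  | 0 => 𝟙 _
  | 1 => e
  | n + 2 => hoSmash T (firstMap T e (n + 1))

/-- A sign of `T`: an automorphism `s` of `T` in `Ho(D)` with `s² = 1` such that every permutation
`τ` of the factors of `T^n` coincides with `|τ| ∧ T^{n-1}`, and `s ∧ T = T ∧ s`.
Here `T^n` is `S⁰ ∧ T ∧ ⋯ ∧ T`. -/
class SmashSign (T : D) [IsCofibrant T] [SmashPreservesWeakEquivalences T] where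
  s : HoHom T T
  s_comp_s : s ≫ s = 𝟙 _
  perm_eq (n : ℕ) (τ : Equiv.Perm (Fin n)) (t : smashPow T (𝟙_ D) n ⟶ smashPow T (𝟙_ D) n) :
    SmashPerm T (𝟙_ D) τ t →
      hoMap t = firstMap T (hoMap (λ_ T).hom ≫ permSign s τ ≫ hoMap (λ_ T).inv) n
  smash_eq : hoSmash T s = cofSmash T s

section

variable {T : D} [IsCofibrant T] [SmashPreservesWeakEquivalences T]

lemma permSign_mul {s : HoHom T T} (hs : s ≫ s = 𝟙 _) {n : ℕ} (γ γ' : Equiv.Perm (Fin n)) :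
    permSign s γ ≫ permSign s γ' = permSign s (γ * γ') := by
  rcases Int.units_eq_one_or (Equiv.Perm.sign γ) with h | h <;>
  rcases Int.units_eq_one_or (Equiv.Perm.sign γ') with h' | h' <;>
  simp [permSign, h, h', hs]

lemma permSign_one (s : HoHom T T) (n : ℕ) : permSign s (1 : Equiv.Perm (Fin n)) = 𝟙 _ := by
  simp [permSign]

lemma permSign_blockSum_one (s : HoHom T T) {m : ℕ} (γ : Equiv.Perm (Fin m)) (n : ℕ) :
    permSign s (blockSum γ (1 : Equiv.Perm (Fin n))) = permSign s γ := by
  simp [permSign, sign_blockSum]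

lemma permSign_swap (s : HoHom T T) (n : ℕ) :
    permSign s (blockSum (1 : Equiv.Perm (Fin n)) (Equiv.swap (0 : Fin 2) 1)) = s := by
  have : Equiv.Perm.sign (Equiv.swap (0 : Fin 2) 1) = -1 := Equiv.Perm.sign_swap (by decide)
  simp [permSign, sign_blockSum, this]

lemma hoSmash_naturality_swapLast {A B : D} (f : HoHom A B) :
    hoMap (swapLast T A) ≫ hoSmash T (hoSmash T f) =
      hoSmash T (hoSmash T f) ≫ hoMap (swapLast T B) := by
  let F : Ho D ⥤ Ho D := hoSmashFunctor T ⋙ hoSmashFunctor T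
  have hF {X Y : D} (g : X ⟶ Y) :
      hoSmash T (hoSmash T (hoMap g)) ≫ hoMap (swapLast T Y) =
        hoMap (swapLast T X) ≫ hoSmash T (hoSmash T (hoMap g)) := by
    rw [hoSmash_hoMap, hoSmash_hoMap, ← Functor.map_comp, ← Functor.map_comp, swapLast_naturality]
  let τ : toHo D ⋙ F ⟶ toHo D ⋙ F :=
    { app := fun X => hoMap (swapLast T X)
      naturality := fun _ _ g => hF g }
  have h := (Localization.Construction.natTransExtension τ).naturality f
  have hτ (X : D) : (Localization.Construction.natTransExtension τ).app ((toHo D).obj X) =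
    hoMap (swapLast T X) := Localization.Construction.NatTransExtension.app_eq τ X
  rw [hτ, hτ] at h
  exact h.symm

lemma SmashSign.braiding_eq [SmashSign T] : hoMap (β_ T T).hom = hoSmash T (SmashSign.s (T := T)) := by
  have h₁ : hoMap (swapLast T (𝟙_ D)) =
      hoSmash T (hoMap (λ_ T).hom ≫ SmashSign.s (T := T) ≫ hoMap (λ_ T).inv) := by
    have h := SmashSign.perm_eq 2 _ _ (SmashPerm.swap (T := T) (A := 𝟙_ D) 0)
    rw [permSign_swap] at h
    exact h
  have h₂ : (β_ T T).hom = (λ_ T).inv ▷ T ≫ swapLast T (𝟙_ D) ≫ (λ_ T).hom ▷ T := by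
    simp [swapLast]
  have h₃ : hoMap ((λ_ T).inv ▷ T) ≫ hoMap (swapLast T (𝟙_ D)) ≫ hoMap ((λ_ T).hom ▷ T) =
      hoSmash T (SmashSign.s (T := T)) := by
    rw [h₁, ← hoSmash_hoMap, ← hoSmash_hoMap, ← hoSmash_comp, ← hoSmash_comp]
    congr 1
    simp [hoMap, ← Functor.map_comp, ← Functor.map_comp_assoc]
  rw [h₂, ← h₃, hoMap, Functor.map_comp, Functor.map_comp]

/-- On `V ∧ T^{k+2}`, exchanging the last two factors `T` coincides with `V ∧ s ∧ T^{k+1}`. -/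
lemma SmashSign.swapLast_eq [SmashSign T] (V : D) [IsCofibrant V] (k : ℕ) :
    hoMap (swapLast T (smashPow T (V ⊗ T) k)) = midMap T V (k + 2) (SmashSign.s (T := T)) := by
  have hc (j : ℕ) : IsCofibrant (smashPow T (V ⊗ T) j) := isCofibrant_smashPow T _ j
  have ha (A : D) : hoMap (α_ A T T).hom ≫ hoMap (α_ A T T).inv = 𝟙 _ :=
    ((toHo D).map_comp _ _).symm.trans
      ((congrArg _ (Iso.hom_inv_id _)).trans ((toHo D).map_id _))
  have ha' (A : D) [IsCofibrant A] : hoMap (α_ A T T).hom ≫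
      cofSmash A (hoSmash T (SmashSign.s (T := T))) ≫ hoMap (α_ A T T).inv =
        hoSmash T (cofSmash A (SmashSign.s (T := T))) := by
    rw [← Category.assoc, ← cofSmash_hoSmash, Category.assoc, ha, Category.comp_id]
  have hb (A : D) [IsCofibrant A] : cofSmash (A ⊗ T) (SmashSign.s (T := T)) =
      hoSmash T (cofSmash A (SmashSign.s (T := T))) := by
    rw [← ha', SmashSign.smash_eq, ← Category.assoc, ← cofSmash_cofSmash, Category.assoc, ha,
      Category.comp_id]
  have h (j : ℕ) : cofSmash (smashPow T (V ⊗ T) j) (SmashSign.s (T := T)) =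
      midMap T V (j + 1) (SmashSign.s (T := T)) := by
    induction j with
    | zero => exact hb V
    | succ j ih => exact (hb _).trans (congrArg (hoSmash T) ih)
  refine Eq.trans ?_ (congrArg (hoSmash T) (h k))
  rw [← ha', ← SmashSign.braiding_eq, cofSmash_hoMap, ← Functor.map_comp, ← Functor.map_comp]
  rfl

end

end

section

/-! ### The injection monoid -/

/-- The monoid of self-injections of `ℕ`. -/
def InjMonoid := ℕ ↪ ℕ

instance : FunLike InjMonoid ℕ ℕ := inferInstanceAs (FunLike (ℕ ↪ ℕ) ℕ ℕ)

lemma InjMonoid.injective (f : InjMonoid) : Function.Injective f := Function.Embedding.inj' f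

instance : Monoid InjMonoid where
  mul f g := Function.Embedding.trans g f
  one := Function.Embedding.refl ℕ
  mul_assoc _ _ _ := rfl
  one_mul _ := rfl
  mul_one _ := rfl

/-- The injection `n + f`: the identity on `{0, …, n - 1}`, and `x ↦ f (x - n) + n` on the rest. -/
def InjMonoid.plus (n : ℕ) (f : InjMonoid) : InjMonoid where
  toFun x := if x < n then x else f (x - n) + n
  inj' x y h := by
    dsimp only at h
    split_ifs at h with h₁ h₂ h₂
    · exact h
    · omega
    · omega
    · have := f.injective (Nat.add_right_cancel h)
      omega

lemma InjMonoid.exists_perm (f : InjMonoid) (a b : ℕ) :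
    ∃ (N : ℕ) (_ : a ≤ N) (γ : Equiv.Perm (Fin (b + N))),
      ∀ i : Fin (b + N), (i : ℕ) < b + a → (γ i : ℕ) = f i := by
  let N := a + (Finset.range (b + a)).sup (fun i => f i + 1)
  have hN : ∀ i < b + a, f i < b + N := fun i hi => by
    have : f i + 1 ≤
        (Finset.range (b + a)).sup (fun i => f i + 1) :=
      Finset.le_sup (f := fun i => f i + 1) (Finset.mem_range.2 hi)
    omega
  let g : {i : Fin (b + N) // (i : ℕ) < b + a} → Fin (b + N) := fun i =>
    ⟨f i, hN _ i.2⟩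
  have hg : Function.Injective g := fun i j h => by
    ext; exact f.injective (Fin.mk.inj h)
  let e := Equiv.ofInjective g hg
  refine ⟨N, Nat.le_add_right _ _, Equiv.extendSubtype (q := (· ∈ Set.range g)) e, fun i hi => ?_⟩
  have := Equiv.extendSubtype_apply_of_mem (q := (· ∈ Set.range g)) e i hi
  exact congrArg Fin.val this

/-- Permutations of `{0, …, n - 1}` that fix `{0, …, a - 1}` are generated by exchanges of adjacent
elements. -/
lemma perm_mem_of_fix {n a : ℕ} (H : Submonoid (Equiv.Perm (Fin n)))
    (hH : ∀ (j : ℕ) (_ : a ≤ j) (hj : j + 1 < n), Equiv.swap ⟨j, by omega⟩ ⟨j + 1, hj⟩ ∈ H)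
    (δ : Equiv.Perm (Fin n)) (hδ : ∀ i : Fin n, (i : ℕ) < a → δ i = i) : δ ∈ H := by
  have hswap : ∀ (d x : ℕ) (_ : a ≤ x) (hd : x + d < n),
      Equiv.swap ⟨x, by omega⟩ ⟨x + d, hd⟩ ∈ H := by
    intro d
    induction d with
    | zero =>
      intro x hx hd
      simpa [Equiv.Perm.one_def] using H.one_mem
    | succ d ih =>
      intro x hx hd
      rcases Nat.eq_zero_or_pos d with rfl | h0
      · exact hH x hx hd
      · have h := H.mul_mem (H.mul_mem (hH (x + d) (by omega) hd) (ih x hx (by omega)))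
          (hH (x + d) (by omega) hd)
        rw [Equiv.swap_mul_swap_mul_swap (by simp; omega) (by simp; omega)] at h
        rw [Equiv.swap_comm]
        exact h
  have hswap' : ∀ x y : Fin n, a ≤ x → x < y → Equiv.swap x y ∈ H := fun x y hx hxy => by
    have h := hswap (y - x) x hx (by omega)
    have e : (⟨x + (y - x), by omega⟩ : Fin n) = y := by ext; simp; omega
    rwa [e] at h
  have hδ' : ∀ x : Fin n, a ≤ (δ x : ℕ) ↔ a ≤ (x : ℕ) := fun x => by
    constructor
    · intro h
      by_contra hx
      rw [hδ x (by omega)] at h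
      exact hx h
    · intro h
      by_contra hx
      have := δ.injective (hδ (δ x) (by omega))
      rw [this] at hx
      exact hx h
  have hδ'' : ∀ x, δ x ≠ x → a ≤ (x : ℕ) := fun x hx => by
    by_contra h
    exact hx (hδ x (by omega))
  have key : ∀ σ : Equiv.Perm {i : Fin n // a ≤ (i : ℕ)}, Equiv.Perm.ofSubtype σ ∈ H := fun σ => by
    refine Equiv.Perm.swap_induction_on σ ?_ ?_
    · rw [map_one]; exact H.one_mem
    · intro σ x y hxy hσ
      rw [map_mul, Equiv.Perm.ofSubtype_swap_eq]
      refine H.mul_mem ?_ hσ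
      rcases lt_trichotomy x y with h | h | h
      · exact hswap' _ _ x.2 h
      · exact absurd h hxy
      · rw [Equiv.swap_comm]; exact hswap' _ _ y.2 h
  have := key (δ.subtypePerm hδ')
  rwa [Equiv.Perm.ofSubtype_subtypePerm hδ' hδ''] at this

end

section

variable {D : Type u} [Category.{v} D] [ModelCategory D] [HasZeroObject D] [MonoidalCategory D]
  [SymmetricCategory D] [MonoidalClosed D] [MonoidalModelCategory D]
  {T : D} [IsCofibrant T] [SmashPreservesWeakEquivalences T]

/-! ### Stable homotopy groups -/

section

variable [HoCogroup T]

/-- The homomorphism `[V ∧ T^{k+1}, X_m] ⟶ [V ∧ T^{k+2}, X_{m+1}]` given by `f ↦ σ ∘ (f ∧ T)`. -/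
def TSpectrum.step (X : TSpectrum T) (V : D) [IsCofibrant V] (k m : ℕ) :
    Level T V k (X.obj m) →+ Level T V (k + 1) (X.obj (m + 1)) where
  toFun f := hoSmash T f ≫ hoMap (X.σ m)
  map_zero' := by
    have key : ∀ f : HoHom (smashPow T (V ⊗ T) k) (X.obj m),
        midAdd f f = f → midAdd (k := k + 1) (hoSmash T f ≫ hoMap (X.σ m))
          (hoSmash T f ≫ hoMap (X.σ m)) = hoSmash T f ≫ hoMap (X.σ m) := fun f hf =>
      (midAdd_comp (k := k + 1) _ _ _).symm.trans
        (congrArg (· ≫ hoMap (X.σ m)) ((hoSmash_midAdd f f).symm.trans (congrArg _ hf)))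
    have h := key (0 : Level T V k (X.obj m)) (add_zero (0 : Level T V k (X.obj m)))
    exact left_eq_add.1 (Eq.symm (a := ((_ + _ : Level T V (k + 1) (X.obj (m + 1))))) h)
  map_add' f g := (congrArg (· ≫ hoMap (X.σ m)) (hoSmash_midAdd f g)).trans
    (midAdd_comp (k := k + 1) _ _ _)

/-- The first of the groups `[V ∧ T^{q+m}, X_m]` with `q + m ≥ 1` is the one with
`q + m = firstExp q + 1` and `m = firstIdx q`. -/
def firstExp (q : ℤ) : ℕ := (q - 1).toNat

/-- See `firstExp`. -/
def firstIdx (q : ℤ) : ℕ := (1 - q).toNat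

/-- The sequence of the groups `[V ∧ T^{q+m}, X_m]` with `q + m ≥ 1`, indexed by
`n = m - firstIdx q`. -/
abbrev TSpectrum.seq (X : TSpectrum T) (q : ℤ) (V : D) (n : ℕ) :=
  Level T V (firstExp q + n) (X.obj (firstIdx q + n))

/-- The compositions of the maps `f ↦ σ ∘ (f ∧ T)`. -/
def TSpectrum.trans (X : TSpectrum T) (q : ℤ) (V : D) [IsCofibrant V] (i j : ℕ) (h : i ≤ j) :
    X.seq q V i →+ X.seq q V j :=
  Nat.leRecOn (C := fun j => X.seq q V i →+ X.seq q V j) h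
    (fun {n} g => (X.step V (firstExp q + n) (firstIdx q + n)).comp g) (AddMonoidHom.id _)

lemma TSpectrum.trans_self (X : TSpectrum T) (q : ℤ) (V : D) [IsCofibrant V] (i : ℕ) :
    X.trans q V i i le_rfl = AddMonoidHom.id _ :=
  Nat.leRecOn_self (C := fun j => X.seq q V i →+ X.seq q V j) _

lemma TSpectrum.trans_succ (X : TSpectrum T) (q : ℤ) (V : D) [IsCofibrant V] {i j : ℕ} (h : i ≤ j) :
    X.trans q V i (j + 1) (by omega) =
      (X.step V (firstExp q + j) (firstIdx q + j)).comp (X.trans q V i j h) :=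
  Nat.leRecOn_succ (C := fun j => X.seq q V i →+ X.seq q V j) h _

instance (X : TSpectrum T) (q : ℤ) (V : D) [IsCofibrant V] :
    DirectedSystem (X.seq q V) (fun i j h => X.trans q V i j h) where
  map_self i x := by rw [X.trans_self]; rfl
  map_map k j i hij hjk x := by
    induction k, hjk using Nat.le_induction with
    | base => rw [X.trans_self]; rfl
    | succ k hjk ih =>
      rw [X.trans_succ q V hjk, X.trans_succ q V (hij.trans hjk)]
      exact congrArg (X.step V (firstExp q + k) (firstIdx q + k)) ih

/-- The stable homotopy group `π_q^V(X)`: the colimit of the groups `[V ∧ T^{q+m}, X_m]`, for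
`q + m ≥ 1`, along the maps `f ↦ σ ∘ (f ∧ T)`. -/
def TSpectrum.Pi (X : TSpectrum T) (q : ℤ) (V : D) [IsCofibrant V] :=
  DirectLimit (X.seq q V) (X.trans q V)

instance (X : TSpectrum T) (q : ℤ) (V : D) [IsCofibrant V] : AddGroup (X.Pi q V) :=
  inferInstanceAs (AddGroup (DirectLimit (X.seq q V) (X.trans q V)))

/-- The class in `π_q^V(X)` of a map `f ∈ [V ∧ T^{k+1}, X_m]`, where `k + 1 = q + m`. -/
def TSpectrum.Pi.mk {X : TSpectrum T} {q : ℤ} {V : D} [IsCofibrant V] (m k : ℕ)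
    (h : (k : ℤ) + 1 = q + m) (f : HoHom (smashPow T (V ⊗ T) k) (X.obj m)) : X.Pi q V :=
  have h₁ : k = firstExp q + (m - firstIdx q) := by
    simp only [firstExp, firstIdx]; omega
  have h₂ : m = firstIdx q + (m - firstIdx q) := by
    simp only [firstIdx]; omega
  Quotient.mk _ ⟨m - firstIdx q, cast (congrArg₂ (fun k m => Level T V k (X.obj m)) h₁ h₂) f⟩

lemma TSpectrum.Pi.mk_eq {X : TSpectrum T} {q : ℤ} {V : D} [IsCofibrant V] (n : ℕ)
    (h : ((firstExp q + n : ℕ) : ℤ) + 1 = q + (firstIdx q + n : ℕ)) (f : X.seq q V n) :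
    TSpectrum.Pi.mk (firstIdx q + n) (firstExp q + n) h f =
      (Quotient.mk _ ⟨n, f⟩ : DirectLimit (X.seq q V) (X.trans q V)) := by
  have aux : ∀ (n' : ℕ) (_ : n' = n) (e : X.seq q V n = X.seq q V n'),
      (Quotient.mk _ ⟨n', cast e f⟩ : DirectLimit (X.seq q V) (X.trans q V)) =
        Quotient.mk _ ⟨n, f⟩ := by
    rintro n' rfl e; rfl
  exact aux (firstIdx q + n - firstIdx q) (by omega) _

lemma TSpectrum.Pi.mk_succ {X : TSpectrum T} {q : ℤ} {V : D} [IsCofibrant V] (m k : ℕ)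
    (h : (k : ℤ) + 1 = q + m) (f : HoHom (smashPow T (V ⊗ T) k) (X.obj m)) :
    (TSpectrum.Pi.mk (m + 1) (k + 1) (by omega) (hoSmash T f ≫ hoMap (X.σ m)) : X.Pi q V) =
      TSpectrum.Pi.mk m k h f := by
  obtain ⟨n, rfl, rfl⟩ : ∃ n, k = firstExp q + n ∧ m = firstIdx q + n :=
    ⟨m - firstIdx q, by simp only [firstExp, firstIdx]; omega, by simp only [firstIdx]; omega⟩
  rw [TSpectrum.Pi.mk_eq n h f]
  refine (TSpectrum.Pi.mk_eq (n + 1) (by omega) _).trans ?_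
  have := DirectLimit.mk_apply (f := X.trans q V) n (n + 1) f (by omega)
  rw [X.trans_succ q V le_rfl, X.trans_self] at this
  exact this

lemma TSpectrum.step_midMap (X : TSpectrum T) (V : D) [IsCofibrant V] (k m : ℕ) (a : HoHom T T)
    (f : Level T V k (X.obj m)) :
    X.step V k m (midMap T V k a ≫ f : HoHom _ _) =
      (midMap T V (k + 1) a ≫ X.step V k m f : HoHom _ _) := by
  have aux : ∀ {A B C E : D} (a : HoHom A B) (f : HoHom B C) (s : HoHom (C ⊗ T) E),
      hoSmash T (a ≫ f) ≫ s = hoSmash T a ≫ hoSmash T f ≫ s := fun a f s => by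
    rw [hoSmash_comp, Category.assoc]
  exact aux (midMap T V k a) f (hoMap (X.σ m))

lemma TSpectrum.trans_midMap (X : TSpectrum T) (q : ℤ) (V : D) [IsCofibrant V] (i j : ℕ)
    (h : i ≤ j) (a : HoHom T T) (f : X.seq q V i) :
    X.trans q V i j h (midMap T V _ a ≫ f : HoHom _ _) =
      (midMap T V _ a ≫ X.trans q V i j h f : HoHom _ _) := by
  induction j, h using Nat.le_induction with
  | base => rw [X.trans_self]; rfl
  | succ j h ih =>
    rw [X.trans_succ q V h]
    exact (congrArg (X.step V _ _) ih).trans (X.step_midMap V _ _ a _)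

/-- The sign of `T` acts on `π_q^V(X)` by `[f] ↦ [f ∘ (V ∧ s ∧ T^k)]`. -/
def TSpectrum.Pi.signAct [SmashSign T] {X : TSpectrum T} {q : ℤ} {V : D} [IsCofibrant V] :
    X.Pi q V → X.Pi q V :=
  DirectLimit.map (X.trans q V) (X.trans q V)
    (fun n f => (midMap T V (firstExp q + n) (SmashSign.s (T := T)) ≫ f : HoHom _ _))
    (fun i j h f => X.trans_midMap q V i j h _ f)

end

end

section

variable {D : Type u} [Category.{v} D] [ModelCategory D] [HasZeroObject D] [MonoidalCategory D]
  [SymmetricCategory D] [MonoidalClosed D] [MonoidalModelCategory D]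
  {T : D} [IsCofibrant T] [SmashPreservesWeakEquivalences T] [HoCogroup T] [SmashSign T]

/-! ### The action of the injection monoid -/

/-- For `γ ∈ Σ_m`, the map `f ↦ γ ∘ f ∘ (V ∧ |γ| ∧ T^k)` on `[V ∧ T^{k+1}, X_m]`. -/
def SymSpectrum.twist (X : SymSpectrum T) (V : D) [IsCofibrant V] (k : ℕ) {m : ℕ}
    (γ : Equiv.Perm (Fin m)) (f : Level T V k (X.obj m)) : Level T V k (X.obj m) :=
  (midMap T V k (permSign (SmashSign.s (T := T)) γ) ≫ f ≫ hoMap (X.act m γ) : HoHom _ _)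

lemma SymSpectrum.twist_one (X : SymSpectrum T) (V : D) [IsCofibrant V] (k : ℕ) {m : ℕ}
    (f : Level T V k (X.obj m)) : X.twist V k 1 f = f := by
  have aux : ∀ {A B : D} {a : HoHom A A} {b : HoHom B B} (f : HoHom A B), a = 𝟙 _ → b = 𝟙 _ →
      a ≫ f ≫ b = f := by
    rintro A B a b f rfl rfl; rw [Category.id_comp, Category.comp_id]
  exact aux f ((congrArg _ (permSign_one _ m)).trans (midMap_id T V k T))
    ((congrArg _ (map_one (X.act m))).trans ((toHo D).map_id _))

lemma SymSpectrum.twist_twist (X : SymSpectrum T) (V : D) [IsCofibrant V] (k : ℕ) {m : ℕ}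
    (γ γ' : Equiv.Perm (Fin m)) (f : Level T V k (X.obj m)) :
    X.twist V k γ (X.twist V k γ' f) = X.twist V k (γ * γ') f := by
  have aux : ∀ {A B : D} {a a' a'' : HoHom A A} {b b' b'' : HoHom B B} (f : HoHom A B),
      a ≫ a' = a'' → b' ≫ b = b'' → a ≫ (a' ≫ f ≫ b') ≫ b = a'' ≫ f ≫ b'' := by
    rintro A B a a' a'' b b' b'' f rfl rfl; simp only [Category.assoc]
  refine aux f ?_ ?_
  · rw [← midMap_comp, permSign_mul SmashSign.s_comp_s]
  · rw [map_mul]; exact ((toHo D).map_comp _ _).symm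

lemma SymSpectrum.step_twist (X : SymSpectrum T) (V : D) [IsCofibrant V] (k : ℕ) {m : ℕ}
    (γ : Equiv.Perm (Fin m)) (f : Level T V k (X.obj m)) :
    X.step V k m (X.twist V k γ f) =
      X.twist V (k + 1) (blockSum γ (1 : Equiv.Perm (Fin 1))) (X.step V k m f) := by
  have aux : ∀ {A B C : D} {a : HoHom A A} (f : HoHom A B) {b : B ⟶ B} {s : B ⊗ T ⟶ C} {c : C ⟶ C},
      b ▷ T ≫ s = s ≫ c → hoSmash T (a ≫ f ≫ hoMap b) ≫ hoMap s =
        hoSmash T a ≫ (hoSmash T f ≫ hoMap s) ≫ hoMap c := by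
    intro A B C a f b s c h
    rw [hoSmash_comp, hoSmash_comp, hoSmash_hoMap, Category.assoc, Category.assoc, Category.assoc,
      ← (toHo D).map_comp, h, (toHo D).map_comp]
  refine (aux (a := midMap T V k (permSign SmashSign.s γ)) f (X.equivariant_one m γ)).trans ?_
  rw [SymSpectrum.twist, permSign_blockSum_one]
  rfl

lemma SymSpectrum.twist_swap (X : SymSpectrum T) (V : D) [IsCofibrant V] (k m : ℕ)
    (f : Level T V k (X.obj m)) :
    X.twist V (k + 2) (blockSum (1 : Equiv.Perm (Fin m)) (Equiv.swap (0 : Fin 2) 1))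
      (X.step V (k + 1) (m + 1) (X.step V k m f)) = X.step V (k + 1) (m + 1) (X.step V k m f) := by
  have aux : ∀ {A B C E : D} (f : HoHom A B) {s : B ⊗ T ⟶ C} {s' : C ⊗ T ⟶ E} {e : E ⟶ E},
      swapLast T B ≫ s ▷ T ≫ s' = s ▷ T ≫ s' ≫ e →
      hoMap (swapLast T A) ≫ (hoSmash T (hoSmash T f ≫ hoMap s) ≫ hoMap s') ≫ hoMap e =
        hoSmash T (hoSmash T f ≫ hoMap s) ≫ hoMap s' := by
    intro A B C E f s s' e h
    have h₁ : swapLast T B ≫ swapLast T B = 𝟙 _ := by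
      simp only [swapLast, Category.assoc, Iso.inv_hom_id_assoc]
      rw [← MonoidalCategory.whiskerLeft_comp_assoc, SymmetricCategory.symmetry]
      simp
    have h₂ : s ▷ T ≫ s' = swapLast T B ≫ s ▷ T ≫ s' ≫ e := by
      rw [← h, ← Category.assoc, h₁, Category.id_comp]
    have h₃ : hoMap (s ▷ T) ≫ hoMap s' =
        hoMap (swapLast T B) ≫ hoMap (s ▷ T) ≫ hoMap s' ≫ hoMap e := by
      rw [← (toHo D).map_comp, h₂]; simp
    simp only [hoSmash_comp, hoSmash_hoMap, Category.assoc]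
    rw [h₃, ← Category.assoc (hoMap (swapLast T A)), hoSmash_naturality_swapLast, Category.assoc]
  refine Eq.trans ?_ (aux (f : HoHom _ _) (X.equivariant_swap m))
  rw [SymSpectrum.twist, permSign_swap, ← SmashSign.swapLast_eq]
  rfl

lemma swap_eq_blockSum_one {m x : ℕ} (hx : x + 1 < m) :
    (Equiv.swap ⟨x, by omega⟩ ⟨x + 1, by omega⟩ : Equiv.Perm (Fin (m + 1))) =
      blockSum (Equiv.swap ⟨x, by omega⟩ ⟨x + 1, hx⟩) (1 : Equiv.Perm (Fin 1)) := by
  ext i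
  rw [blockSum_val]
  simp only [Equiv.swap_apply_def, Fin.ext_iff]
  split_ifs <;> simp <;> omega

lemma swap_eq_one_blockSum (m : ℕ) :
    (Equiv.swap ⟨m, by omega⟩ ⟨m + 1, by omega⟩ : Equiv.Perm (Fin (m + 2))) =
      blockSum (1 : Equiv.Perm (Fin m)) (Equiv.swap (0 : Fin 2) 1) := by
  ext i
  rw [blockSum_val]
  simp only [Equiv.swap_apply_def, Fin.ext_iff]
  split_ifs <;> simp_all <;> omega

lemma SymSpectrum.twist_swap_trans (X : SymSpectrum T) (q : ℤ) (V : D) [IsCofibrant V] {i j : ℕ}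
    (h : i ≤ j) (f : X.seq q V i) (x : ℕ) (hx : firstIdx q + i ≤ x) (hx' : x + 1 < firstIdx q + j) :
    X.twist V _ (Equiv.swap ⟨x, by omega⟩ ⟨x + 1, hx'⟩) (X.trans q V i j h f) =
      X.trans q V i j h f := by
  induction j, h using Nat.le_induction with
  | base => omega
  | succ j h ih =>
    rcases Nat.lt_or_ge (x + 1) (firstIdx q + j) with hlt | hge
    · have e := swap_eq_blockSum_one hlt
      rw [X.trans_succ q V h]
      refine (congrArg (X.twist V (firstExp q + j + 1) (m := firstIdx q + j + 1) ·
        (X.step V _ _ (X.trans q V i j h f))) e).trans ?_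
      exact (X.step_twist V _ _ _).symm.trans (congrArg _ (ih hlt))
    · obtain ⟨j, rfl⟩ : ∃ j', j = j' + 1 := ⟨j - 1, by omega⟩
      obtain rfl : x = firstIdx q + j := by omega
      have hij : i ≤ j := by omega
      rw [X.trans_succ q V h, X.trans_succ q V hij]
      refine (congrArg (X.twist V (firstExp q + j + 2) (m := firstIdx q + j + 2) ·
        (X.step V _ _ (X.step V _ _ (X.trans q V i j hij f)))) (swap_eq_one_blockSum _)).trans ?_
      exact X.twist_swap V _ _ _

lemma SymSpectrum.twist_trans (X : SymSpectrum T) (q : ℤ) (V : D) [IsCofibrant V] {i j : ℕ}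
    (h : i ≤ j) (f : X.seq q V i) (δ : Equiv.Perm (Fin (firstIdx q + j)))
    (hδ : ∀ x : Fin (firstIdx q + j), (x : ℕ) < firstIdx q + i → δ x = x) :
    X.twist V _ δ (X.trans q V i j h f) = X.trans q V i j h f := by
  let H : Submonoid (Equiv.Perm (Fin (firstIdx q + j))) :=
    { carrier := {δ | X.twist V _ δ (X.trans q V i j h f) = X.trans q V i j h f}
      one_mem' := X.twist_one V _ _
      mul_mem' := fun {δ δ'} hδ hδ' =>
        (X.twist_twist V _ δ δ' _).symm.trans ((congrArg (X.twist V _ δ) hδ').trans hδ) }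
  refine perm_mem_of_fix (a := firstIdx q + i) H ?_ δ hδ
  exact fun x hx hx' => X.twist_swap_trans q V h f x hx hx'

lemma SymSpectrum.exists_trans_twist (X : SymSpectrum T) (q : ℤ) (V : D) [IsCofibrant V] {i j : ℕ}
    (h : i ≤ j) (f : X.seq q V i) (γ : Equiv.Perm (Fin (firstIdx q + i))) :
    ∃ γ' : Equiv.Perm (Fin (firstIdx q + j)),
      (∀ (x : ℕ) (hx : x < firstIdx q + i), (γ' ⟨x, by omega⟩ : ℕ) = γ ⟨x, hx⟩) ∧
      X.trans q V i j h (X.twist V _ γ f) = X.twist V _ γ' (X.trans q V i j h f) := by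
  induction j, h using Nat.le_induction with
  | base =>
    refine ⟨γ, fun _ _ => rfl, ?_⟩
    rw [X.trans_self]; rfl
  | succ j h ih =>
    obtain ⟨γ', h₁, h₂⟩ := ih
    refine ⟨blockSum (m := firstIdx q + j) (n := 1) γ' 1, fun x hx => ?_, ?_⟩
    · rw [← h₁ x hx]
      exact (blockSum_val γ' (1 : Equiv.Perm (Fin 1)) _).trans
        (dif_pos (show x < firstIdx q + j by omega))
    · rw [X.trans_succ q V h]
      exact (congrArg (X.step V _ _) h₂).trans (X.step_twist V _ γ' _)

lemma SymSpectrum.twist_congr (X : SymSpectrum T) (q : ℤ) (V : D) [IsCofibrant V] {i j j' : ℕ}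
    (h : i ≤ j) (h' : i ≤ j') (f : X.seq q V i) (γ : Equiv.Perm (Fin (firstIdx q + j)))
    (γ' : Equiv.Perm (Fin (firstIdx q + j')))
    (hγ : ∀ (x : ℕ) (hx : x < firstIdx q + i),
      (γ ⟨x, by omega⟩ : ℕ) = γ' ⟨x, by omega⟩) :
    (Quotient.mk _ ⟨j, X.twist V _ γ (X.trans q V i j h f)⟩ :
      DirectLimit (X.seq q V) (X.trans q V)) =
    Quotient.mk _ ⟨j', X.twist V _ γ' (X.trans q V i j' h' f)⟩ := by
  obtain ⟨n, hn, hn'⟩ : ∃ n, j ≤ n ∧ j' ≤ n := ⟨max j j', le_max_left _ _, le_max_right _ _⟩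
  obtain ⟨δ, h₁, h₂⟩ := X.exists_trans_twist q V hn (X.trans q V i j h f) γ
  obtain ⟨δ', h₁', h₂'⟩ := X.exists_trans_twist q V hn' (X.trans q V i j' h' f) γ'
  refine Quotient.sound ⟨n, hn, hn', ?_⟩
  refine h₂.trans (Eq.trans ?_ h₂'.symm)
  have e : X.trans q V j n hn (X.trans q V i j h f) = X.trans q V i n (h.trans hn) f :=
    DirectedSystem.map_map' (f := X.trans q V) h hn f
  have e' : X.trans q V j' n hn' (X.trans q V i j' h' f) = X.trans q V i n (h.trans hn) f :=
    DirectedSystem.map_map' (f := X.trans q V) h' hn' f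
  rw [e, e']
  have key := X.twist_trans q V (h.trans hn) f (δ'⁻¹ * δ) (fun x hx => by
    rw [Equiv.Perm.mul_apply, Equiv.Perm.inv_eq_iff_eq]
    ext
    exact (h₁ x (by omega)).trans ((hγ x hx).trans (h₁' x (by omega)).symm))
  have := congrArg (X.twist V _ δ') key
  rwa [X.twist_twist, mul_inv_cancel_left] at this

/-- The action of `g ∈ M` on the class of `f ∈ [V ∧ T^{q+m}, X_m]`: choose `n ≥ m` and `γ ∈ Σ_n`
with `γ = g` on `{0, …, m - 1}`, and apply `f ↦ γ ∘ f ∘ (V ∧ |γ| ∧ T^{q+n-1})` to the image of `f`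
in `[V ∧ T^{q+n}, X_n]`. -/
def SymSpectrum.injAct (X : SymSpectrum T) (q : ℤ) (V : D) [IsCofibrant V] (g : InjMonoid) :
    X.Pi q V → X.Pi q V :=
  DirectLimit.lift (X.trans q V)
    (fun i f =>
      (Quotient.mk _ ⟨(g.exists_perm i (firstIdx q)).choose,
        X.twist V _ (g.exists_perm i (firstIdx q)).choose_spec.choose_spec.choose
          (X.trans q V i _ (g.exists_perm i (firstIdx q)).choose_spec.choose f)⟩ :
        DirectLimit (X.seq q V) (X.trans q V)))
    (fun i j h f => by
      let p := g.exists_perm i (firstIdx q)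
      let p' := g.exists_perm j (firstIdx q)
      have e := X.twist_congr q V p.choose_spec.choose (h.trans p'.choose_spec.choose) f
        p.choose_spec.choose_spec.choose p'.choose_spec.choose_spec.choose (fun x hx =>
          (p.choose_spec.choose_spec.choose_spec
            ⟨x, by have := p.choose_spec.choose; omega⟩ hx).trans
          (p'.choose_spec.choose_spec.choose_spec
            ⟨x, by have := p'.choose_spec.choose; omega⟩ (by dsimp only; omega)).symm)
      have e' := DirectedSystem.map_map' (f := X.trans q V) h p'.choose_spec.choose f
      rw [← e'] at e
      exact e)

lemma SymSpectrum.injAct_mk (X : SymSpectrum T) (q : ℤ) (V : D) [IsCofibrant V] (g : InjMonoid)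
    {i j : ℕ} (h : i ≤ j) (f : X.seq q V i) (γ : Equiv.Perm (Fin (firstIdx q + j)))
    (hγ : ∀ (x : ℕ) (hx : x < firstIdx q + i), (γ ⟨x, by omega⟩ : ℕ) = g x) :
    X.injAct q V g (Quotient.mk _ ⟨i, f⟩ : DirectLimit (X.seq q V) (X.trans q V)) =
    (Quotient.mk _ ⟨j, X.twist V _ γ (X.trans q V i j h f)⟩ :
      DirectLimit (X.seq q V) (X.trans q V)) :=
  X.twist_congr q V _ _ f _ _ fun x hx =>
    ((g.exists_perm i (firstIdx q)).choose_spec.choose_spec.choose_spec ⟨x, by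
      have := (g.exists_perm i (firstIdx q)).choose_spec.choose; omega⟩ hx).trans (hγ x hx).symm

instance (X : SymSpectrum T) (q : ℤ) (V : D) [IsCofibrant V] : MulAction InjMonoid (X.Pi q V) where
  smul := X.injAct q V
  one_smul x := by
    induction x using Quotient.ind with | _ x =>
    obtain ⟨i, f⟩ := x
    refine (X.injAct_mk q V 1 le_rfl f 1 (fun _ _ => rfl)).trans ?_
    rw [X.trans_self, X.twist_one]
    rfl
  mul_smul g g' x := by
    induction x using Quotient.ind with | _ x =>
    obtain ⟨i, f⟩ := x
    obtain ⟨j, hj, γ', hγ'⟩ := g'.exists_perm i (firstIdx q)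
    obtain ⟨n, hn, γ, hγ⟩ := g.exists_perm j (firstIdx q)
    obtain ⟨δ, h₁, h₂⟩ := X.exists_trans_twist q V hn (X.trans q V i j hj f) γ'
    have e : X.trans q V j n hn (X.trans q V i j hj f) = X.trans q V i n (hj.trans hn) f :=
      DirectedSystem.map_map' (f := X.trans q V) hj hn f
    refine (X.injAct_mk q V (g * g') (hj.trans hn) f (γ * δ) (fun x hx => ?_)).trans ?_
    · have hx' : (δ ⟨x, by omega⟩ : ℕ) = g' x :=
        (h₁ x (by omega)).trans (hγ' ⟨x, by omega⟩ hx)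
      have hlt : (δ ⟨x, by omega⟩ : ℕ) < firstIdx q + j := by
        rw [h₁ x (by omega)]; exact (γ' ⟨x, by omega⟩).2
      exact (hγ _ hlt).trans (congrArg g hx')
    · rw [← X.twist_twist, ← e, ← h₂]
      refine Eq.trans ?_ (congrArg (X.injAct q V g)
        (X.injAct_mk q V g' hj f γ' (fun x hx => hγ' ⟨x, by omega⟩ hx)).symm)
      exact (X.injAct_mk q V g hn _ γ (fun x hx => hγ ⟨x, by omega⟩ hx)).symm

end

section

variable {D : Type u} [Category.{v} D] [ModelCategory D] [MonoidalCategory D]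
  [SymmetricCategory D] [MonoidalClosed D]

/-! ### The maps inducing the isomorphisms -/

/-- The map `A ∧ T ∧ T^{k+1} ⟶ A ∧ T^{k+1} ∧ T` that moves the first factor `T` to the end. -/
def rotate (T A : D) : ∀ k : ℕ, smashPow T (A ⊗ T) (k + 1) ⟶ smashPow T (A ⊗ T) k ⊗ T
  | 0 => swapLast T A
  | k + 1 => rotate T A k ▷ T ≫ swapLast T (smashPow T (A ⊗ T) k)

/-- The map `A ∧ T ∧ T^{k+1} ⟶ T ∧ A ∧ T^{k+1}` that exchanges `A` and the first factor `T`. -/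
def toFront (T A : D) : ∀ k : ℕ, smashPow T (A ⊗ T) (k + 1) ⟶ T ⊗ smashPow T (A ⊗ T) k
  | 0 => (β_ A T).hom ▷ T ≫ (α_ T A T).hom
  | k + 1 => toFront T A k ▷ T ≫ (α_ T (smashPow T (A ⊗ T) k) T).hom

variable {T : D} [SmashPreservesWeakEquivalences T]

/-- For `f : V ∧ T^{k+1} ⟶ Hom(T, Y)` in `Ho(D)`, the adjoint map `V ∧ T^{k+1} ∧ T ⟶ Y`, composed
with the map `V ∧ T ∧ T^{k+1} ⟶ V ∧ T^{k+1} ∧ T` moving the first factor `T` to the end. -/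
def loopAdjoint {V Y : D} {k : ℕ} (f : HoHom (smashPow T (V ⊗ T) k) ((ihom T).obj Y)) :
    HoHom (smashPow T (V ⊗ T) (k + 1)) Y :=
  hoMap (rotate T V k) ≫ hoSmash T f ≫ hoMap (evRight T Y)

/-- For `f : V ∧ T^{k+1} ⟶ Y` in `Ho(D)`, the map `T ∧ f`, composed with the map
`V ∧ T ∧ T^{k+1} ⟶ T ∧ V ∧ T^{k+1}` exchanging `V` and `T`. -/
def smashLeft {V Y : D} {k : ℕ} (f : HoHom (smashPow T (V ⊗ T) k) Y) :
    HoHom (smashPow T (V ⊗ T) (k + 1)) (T ⊗ Y) :=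
  hoMap (toFront T V k) ≫ hoSmashLeft T f

end

section

variable {D : Type u} [Category.{v} D] [ModelCategory D] [MonoidalCategory D]
  [SymmetricCategory D] [MonoidalClosed D] {T : D}

/-- A spectrum is level fibrant if all its levels are fibrant. -/
def TSpectrum.LevelFibrant (X : TSpectrum T) : Prop := ∀ n, IsFibrant (X.obj n)

/-- Maps of symmetric spectra. -/
structure SymSpectrum.Hom (X Y : SymSpectrum T) where
  app : ∀ n, X.obj n ⟶ Y.obj n
  comm : ∀ n, app n ▷ T ≫ Y.σ n = X.σ n ≫ app (n + 1)
  equivariant : ∀ (n : ℕ) (γ : Equiv.Perm (Fin n)), X.act n γ ≫ app n = app n ≫ Y.act n γ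

/-- A map of symmetric spectra `X ⟶ Y` is a level fibrant replacement of `X` if it is a weak
equivalence on every level and `Y` is level fibrant. -/
def SymSpectrum.Hom.IsLevelFibrantReplacement {X Y : SymSpectrum T} (j : X.Hom Y) : Prop :=
  (∀ n, WeakEquivalence (j.app n)) ∧ Y.LevelFibrant

end

section

variable {D : Type u} [Category.{v} D] [ModelCategory D] [HasZeroObject D] [MonoidalCategory D]
  [SymmetricCategory D] [MonoidalClosed D] [MonoidalModelCategory D]
  {T : D} [IsCofibrant T] [SmashPreservesWeakEquivalences T] [HoCogroup T] [SmashSign T]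

/-- A symmetric spectrum is semistable (with respect to the class `𝓑` of cofibrant objects) if the
injection monoid acts trivially on all its stable homotopy groups `π_q^V` with `V ∈ 𝓑`. -/
def SymSpectrum.Semistable (𝓑 : Set (CofibrantObject D)) (X : SymSpectrum T) : Prop :=
  ∀ (q : ℤ), ∀ V ∈ 𝓑, ∀ (g : InjMonoid) (x : X.Pi q V.obj), g • x = x

/-- `φ : π_{q+1}^V(sh X) ≅ π_q^V(X)` is the isomorphism `[f] ↦ [f]`, for
`f : V ∧ T^{(q+1)+m} ⟶ X_{1+m} = (sh X)_m`, and it is compatible with the sign of `T`. -/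
def TSpectrum.IsShIso (X : TSpectrum T) (q : ℤ) (V : D) [IsCofibrant V]
    (φ : X.sh.Pi (q + 1) V ≃+ X.Pi q V) : Prop :=
  (∀ (m k : ℕ) (h : (k : ℤ) + 1 = q + 1 + m) (f : HoHom (smashPow T (V ⊗ T) k) (X.obj (1 + m))),
    φ (Pi.mk (X := X.sh) m k h f) = Pi.mk (1 + m) k (by omega) f) ∧
  ∀ x, φ (Pi.signAct x) = Pi.signAct (φ x)

/-- `φ : π_q^V(Ω X) ≅ π_{q+1}^V(X)` is the isomorphism given by adjunction, and it is compatible with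
the sign of `T`. -/
def TSpectrum.IsLoopIso (X : TSpectrum T) (q : ℤ) (V : D) [IsCofibrant V]
    (φ : X.loop.Pi q V ≃+ X.Pi (q + 1) V) : Prop :=
  (∀ (m k : ℕ) (h : (k : ℤ) + 1 = q + m)
    (f : HoHom (smashPow T (V ⊗ T) k) ((ihom T).obj (X.obj m))),
    φ (Pi.mk (X := X.loop) m k h f) = Pi.mk m (k + 1) (by omega) (loopAdjoint f)) ∧
  ∀ x, φ (Pi.signAct x) = Pi.signAct (φ x)

/-- `φ : π_q^V(X) ≅ π_{1+q}^V(T ∧ X)` is the isomorphism given by `T ∧ -`, and it is compatible with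
the sign of `T`. -/
def TSpectrum.IsSmashIso (X : TSpectrum T) (q : ℤ) (V : D) [IsCofibrant V]
    (φ : X.Pi q V ≃+ X.smash.Pi (1 + q) V) : Prop :=
  (∀ (m k : ℕ) (h : (k : ℤ) + 1 = q + m) (f : HoHom (smashPow T (V ⊗ T) k) (X.obj m)),
    φ (Pi.mk m k h f) = Pi.mk (X := X.smash) m (k + 1) (by omega) (smashLeft f)) ∧
  ∀ x, φ (Pi.signAct x) = Pi.signAct (φ x)

end

end StableHtpy

end

noncomputable section

namespace StableHtpy

section

variable {D : Type u} [Category.{v} D] [ModelCategory D] [MonoidalCategory D] [SymmetricCategory D]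
  [MonoidalClosed D] [MonoidalModelCategory D]

/-! ### Smash products of maps of `Ho(D)` on both sides -/

/-! All three isomorphisms come from maps between the groups $[V\wedge T^{k+1},X_m]$ that commute
with stabilisation $f\mapsto\sigma\circ(f\wedge T)$. For $\mathrm{sh}X$ they are identities, and
only a cofinal reindexing of the colimit happens.

The cases $\Omega X$ and $T\wedge X$ are two instances of one construction, `suspend`: a map
$e:W\wedge T\to Y$ sends $f$ to $e\circ(f\wedge T)\circ\rho$, where $\rho$ (`rotate`) moves the
first factor $T$ to the end. For $\Omega X$ the map $e$ is the evaluation, for $T\wedge X$ it is the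
symmetry. Stabilisation adds a factor $T$ on the right, so $\rho$ acquires one more exchange of two
factors $T$; it cancels the exchange by which $e$ fails to commute strictly with the structure maps
(`suspend_step`).

Additivity is not formal, because sums use the first factor $T$, which $\rho$ displaces.
Precomposition with $\rho$ turns the sum defined by the last factor into the one defined by the
first (`rotate_lastAdd`), and the two sums agree by Eckmann-Hilton (`lastAdd_eq_midAdd`). The
interchange law needed there is bifunctoriality of the smash product in $\mathrm{Ho}(\mathcal D)$,
proved by writing maps between cofibrant objects as fractions. The sign axioms make $\rho$ a power
of the sign (`hoMap_rotate`); hence it is invertible and commutes with the sign action.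

For $\Omega X$ the level maps are bijective by the derived adjunction (`bijective_hoSmash_evRight`).
For $T\wedge X$ they are bijective only in the colimit: $T\wedge f$ determines $f\wedge T$ and hence
the stabilisation of $f$, and the stabilisation of $g:V\wedge T^{k+1}\to T\wedge X_m$ is, up to
sign, $T\wedge f$ for $f$ the composite of $g$ with $T\wedge X_m\cong X_m\wedge T\to X_{m+1}$
(`smashLeft_comp_braiding`).

Equivariance for $\mathcal M$ is checked on the level maps, since $g$ acts through a permutation and
its sign (`LevelwiseHom.map_smul`). Semistability then transfers along equivariant bijections. For
$\mathrm{sh}X$ one also needs that $W$ is trivial once $W(1)$ is (`InjMonoid.smul_eq_of_plus_one`):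
transpositions moving the first element are conjugate to transpositions fixing it, and every
injection is such a transposition times an injection fixing the first element. -/

lemma hoMap_comp {A B C : D} (f : A ⟶ B) (g : B ⟶ C) : hoMap (f ≫ g) = hoMap f ≫ hoMap g :=
  (toHo D).map_comp f g

lemma hoMap_id (A : D) : hoMap (𝟙 A) = 𝟙 ((toHo D).obj A) := (toHo D).map_id A

/-- For a map `f : A ⟶ A'` of `D`, the maps `f ∧ B` are natural in `B` with respect to `Ho(D)`. -/
lemma cofSmash_whiskerRight {A A' B B' : D} [IsCofibrant A] [IsCofibrant A'] [IsCofibrant B]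
    [IsCofibrant B'] (f : A ⟶ A') (g : HoHom B B') :
    cofSmash A g ≫ hoMap (f ▷ B') = hoMap (f ▷ B) ≫ cofSmash A' g := by
  -- Here $g=r^{-1}g'$ with $r$ a weak equivalence of cofibrant objects. As $A'\wedge r$ is
  -- invertible in $\mathrm{Ho}(\mathcal D)$, the claim reduces to the interchange law for maps of
  -- $\mathcal D$.
  obtain ⟨Z, _, g', r, _, h⟩ := exists_ho_fraction g
  have := whiskerLeft_weakEquivalence_of_cofibrant A' r
  have := isIso_hoMap (A' ◁ r)
  have key : ∀ {X Y : D} [IsCofibrant X] [IsCofibrant Y] (g : X ⟶ Y),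
      cofSmash A (hoMap g) ≫ hoMap (f ▷ Y) = hoMap (f ▷ X) ≫ cofSmash A' (hoMap g) := fun g => by
    rw [cofSmash_hoMap, cofSmash_hoMap, ← hoMap_comp, ← hoMap_comp, whisker_exchange]
  rw [← cancel_mono (hoMap (A' ◁ r)), ← cofSmash_hoMap A' r, Category.assoc, Category.assoc,
    ← key, ← Category.assoc, ← cofSmash_comp, ← cofSmash_comp, h, key]

/-- The map `f ∧ W` of `Ho(D)`, for `W` cofibrant and a map `f` of `Ho(D)` between objects that are
cofibrant in `D`. -/
def cofSmashRight (W : D) [IsCofibrant W] {A B : D} [IsCofibrant A] [IsCofibrant B]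
    (f : HoHom A B) : HoHom (A ⊗ W) (B ⊗ W) :=
  hoMap (β_ A W).hom ≫ cofSmash W f ≫ hoMap (β_ B W).inv

lemma cofSmashRight_hoMap (W : D) [IsCofibrant W] {A B : D} [IsCofibrant A] [IsCofibrant B]
    (f : A ⟶ B) : cofSmashRight W (hoMap f) = hoMap (f ▷ W) := by
  rw [cofSmashRight, cofSmash_hoMap, ← hoMap_comp, ← hoMap_comp,
    ← BraidedCategory.braiding_naturality_left_assoc, Iso.hom_inv_id, Category.comp_id]

lemma cofSmashRight_comp (W : D) [IsCofibrant W] {A B C : D} [IsCofibrant A] [IsCofibrant B]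
    [IsCofibrant C] (f : HoHom A B) (g : HoHom B C) :
    cofSmashRight W (f ≫ g) = cofSmashRight W f ≫ cofSmashRight W g := by
  have h : hoMap (β_ B W).inv ≫ hoMap (β_ B W).hom = 𝟙 _ := by
    rw [← hoMap_comp, Iso.inv_hom_id, hoMap_id]
  simp only [cofSmashRight, cofSmash_comp, Category.assoc, reassoc_of% h]

lemma whiskerRight_weakEquivalence_of_cofibrant (W : D) [IsCofibrant W] {A B : D} [IsCofibrant A]
    [IsCofibrant B] (f : A ⟶ B) [hf : WeakEquivalence f] : WeakEquivalence (f ▷ W) := by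
  have h := whiskerLeft_weakEquivalence_of_cofibrant W f
  rw [weakEquivalence_iff] at h ⊢
  refine ((weakEquivalences D).arrow_mk_iso_iff (Arrow.isoMk (β_ A W) (β_ B W) ?_)).2 h
  exact (BraidedCategory.braiding_naturality_left f W).symm

/-- Bifunctoriality: `(f ∧ B') ∘ (A ∧ g) = (A' ∧ g) ∘ (f ∧ B)` in `Ho(D)`. -/
lemma cofSmash_exchange {A A' B B' : D} [IsCofibrant A] [IsCofibrant A'] [IsCofibrant B]
    [IsCofibrant B'] (f : HoHom A A') (g : HoHom B B') :
    cofSmash A g ≫ cofSmashRight B' f = cofSmashRight B f ≫ cofSmash A' g := by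
  -- Only $f$ has to be written as a fraction; `cofSmash_whiskerRight` already allows an arbitrary
  -- $g$ of $\mathrm{Ho}(\mathcal D)$.
  obtain ⟨Z, _, f', r, _, h⟩ := exists_ho_fraction f
  have := whiskerRight_weakEquivalence_of_cofibrant B' r
  have := isIso_hoMap (r ▷ B')
  rw [← cancel_mono (hoMap (r ▷ B')), Category.assoc, Category.assoc, cofSmash_whiskerRight,
    ← cofSmashRight_hoMap, ← cofSmashRight_hoMap, ← cofSmashRight_comp, ← Category.assoc,
    ← cofSmashRight_comp, h, cofSmashRight_hoMap, cofSmashRight_hoMap, cofSmash_whiskerRight]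

/-- The two sides agree on maps of $\mathcal D$, hence on fractions. The point is to make
bifunctoriality, available for `cofSmashRight`, usable for `hoSmash`. -/
lemma hoSmash_eq_cofSmashRight (T : D) [IsCofibrant T] [SmashPreservesWeakEquivalences T]
    {A B : D} [IsCofibrant A] [IsCofibrant B] (f : HoHom A B) :
    hoSmash T f = cofSmashRight T f := by
  obtain ⟨Z, _, f', r, _, h⟩ := exists_ho_fraction f
  have := SmashPreservesWeakEquivalences.smash (T := T) r inferInstance
  have := isIso_hoMap (r ▷ T)
  rw [← cancel_mono (hoMap (r ▷ T)), ← hoSmash_hoMap, ← hoSmash_comp, h, hoSmash_hoMap,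
    hoSmash_hoMap, ← cofSmashRight_hoMap T r, ← cofSmashRight_comp, h, cofSmashRight_hoMap]

lemma cofSmash_hoSmash_exchange (T : D) [IsCofibrant T] [SmashPreservesWeakEquivalences T]
    {A A' : D} [IsCofibrant A] [IsCofibrant A'] (f : HoHom A A') (g : HoHom T T) :
    cofSmash A g ≫ hoSmash T f = hoSmash T f ≫ cofSmash A' g := by
  rw [hoSmash_eq_cofSmashRight, cofSmash_exchange]

/-- The smash product with `T` on the left is conjugate to the one on the right. -/
lemma hoSmashLeft_eq (T : D) [SmashPreservesWeakEquivalences T] {A B : D} (f : HoHom A B) :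
    hoSmashLeft T f = hoMap (β_ A T).inv ≫ hoSmash T f ≫ hoMap (β_ B T).hom := by
  have hL {X Y : D} (g : X ⟶ Y) : hoSmashLeft T (hoMap g) = hoMap (T ◁ g) := by
    have := Functor.congr_hom (Localization.Construction.fac (W := weakEquivalences D)
      (tensorLeft T ⋙ toHo D) (fun _ _ f hf =>
      have := whiskerLeft_weakEquivalence T f ((weakEquivalence_iff f).2 hf)
      isIso_hoMap (T ◁ f))) g
    simpa using! this
  -- The symmetry is natural on $\mathcal D$; the universal property of the localization extends
  -- this to all maps of $\mathrm{Ho}(\mathcal D)$, with no cofibrancy needed.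
  let τ : toHo D ⋙ hoSmashFunctor T ⟶ toHo D ⋙ hoSmashLeftFunctor T :=
    { app := fun X => hoMap (β_ X T).hom
      naturality := fun X Y g => by
        change hoSmash T (hoMap g) ≫ hoMap (β_ Y T).hom =
          hoMap (β_ X T).hom ≫ hoSmashLeft T (hoMap g)
        rw [hL, hoSmash_hoMap, ← hoMap_comp, ← hoMap_comp,
          BraidedCategory.braiding_naturality_left] }
  have h := (Localization.Construction.natTransExtension τ).naturality f
  have hτ (X : D) : (Localization.Construction.natTransExtension τ).app ((toHo D).obj X) =
    hoMap (β_ X T).hom := Localization.Construction.NatTransExtension.app_eq τ X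
  rw [hτ, hτ] at h
  have h' : hoMap (β_ A T).inv ≫ hoMap (β_ A T).hom = 𝟙 _ := by
    rw [← hoMap_comp, Iso.inv_hom_id, hoMap_id]
  exact ((congrArg (hoMap (β_ A T).inv ≫ ·) h).trans
    ((Category.assoc _ _ _).symm.trans
      ((congrArg (· ≫ hoSmashLeft T f) h').trans (Category.id_comp _)))).symm

/-! ### Moving a factor to the end -/

/-- The map `A ∧ B ∧ T^{k+1} ⟶ A ∧ T^{k+1} ∧ B` that moves the factor `B` to the end. -/
def moveToEnd (T A B : D) : ∀ k : ℕ, smashPow T (A ⊗ B) (k + 1) ⟶ smashPow T (A ⊗ T) k ⊗ B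
  | 0 => (α_ A B T).hom ≫ A ◁ (β_ B T).hom ≫ (α_ A T B).inv
  | k + 1 => moveToEnd T A B k ▷ T ≫
      (α_ (smashPow T (A ⊗ T) k) B T).hom ≫ smashPow T (A ⊗ T) k ◁ (β_ B T).hom ≫
        (α_ (smashPow T (A ⊗ T) k) T B).inv

/-- The moved factor is allowed to be arbitrary in `moveToEnd` so that naturality in it can be
applied to the comultiplication $T\to T\vee T$. -/
lemma moveToEnd_self (T A : D) (k : ℕ) : moveToEnd T A T k = rotate T A k := by
  induction k with
  | zero => rfl
  | succ k ih => rw [moveToEnd, ih]; rfl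

lemma moveToEnd_naturality (T A : D) {B B' : D} (b : B ⟶ B') (k : ℕ) :
    smashPowMap T (A ◁ b) (k + 1) ≫ moveToEnd T A B' k =
      moveToEnd T A B k ≫ smashPow T (A ⊗ T) k ◁ b := by
  -- Naturality of passing a single factor $T$; it serves the base case and every inductive step.
  have aux (E : D) : (E ◁ b) ▷ T ≫ (α_ E B' T).hom ≫ E ◁ (β_ B' T).hom ≫ (α_ E T B').inv =
      ((α_ E B T).hom ≫ E ◁ (β_ B T).hom ≫ (α_ E T B).inv) ≫ (E ⊗ T) ◁ b := by
    rw [associator_naturality_middle_assoc, ← MonoidalCategory.whiskerLeft_comp_assoc,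
      BraidedCategory.braiding_naturality_left, MonoidalCategory.whiskerLeft_comp_assoc]
    simp
  induction k with
  | zero => exact aux A
  | succ k ih =>
    have h : smashPowMap T (A ◁ b) (k + 1) ▷ T ≫ moveToEnd T A B' k ▷ T =
        moveToEnd T A B k ▷ T ≫ (smashPow T (A ⊗ T) k ◁ b) ▷ T := by
      rw [← comp_whiskerRight, ih, comp_whiskerRight]
    change smashPowMap T (A ◁ b) (k + 1) ▷ T ≫ moveToEnd T A B' k ▷ T ≫ _ = (_ ≫ _) ≫ _
    rw [reassoc_of% h, Category.assoc]
    congr 1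
    exact aux _

/-- By the hexagon identity, the symmetry that carries the last $T$ to the front passes it across
the neighbouring $T$ first, and this undoes the exchange in `rotate` since the symmetry squares to
the identity. -/
lemma toFront_eq (T A : D) (k : ℕ) :
    toFront T A k = rotate T A k ≫ (β_ (smashPow T (A ⊗ T) k) T).hom := by
  have aux (E : D) : (β_ E T).hom ▷ T ≫ (α_ T E T).hom =
      ((α_ E T T).hom ≫ E ◁ (β_ T T).hom ≫ (α_ E T T).inv) ≫ (β_ (E ⊗ T) T).hom := by
    rw [BraidedCategory.braiding_tensor_left_hom]
    simp [← MonoidalCategory.whiskerLeft_comp_assoc]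
  induction k with
  | zero => exact aux A
  | succ k ih =>
    have step {E F : D} {t : E ⟶ T ⊗ F} {r : E ⟶ F ⊗ T} (h : t = r ≫ (β_ F T).hom) :
        t ▷ T ≫ (α_ T F T).hom =
          (r ▷ T ≫ (α_ F T T).hom ≫ F ◁ (β_ T T).hom ≫ (α_ F T T).inv) ≫ (β_ (F ⊗ T) T).hom := by
      rw [h, comp_whiskerRight_assoc, aux]
      simp only [Category.assoc]
    exact step ih

end

section

variable {D : Type u} [Category.{v} D] [ModelCategory D] [MonoidalCategory D] [SymmetricCategory D]
  [MonoidalClosed D] [MonoidalModelCategory D]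
  {T : D} [IsCofibrant T] [SmashPreservesWeakEquivalences T]

/-! ### Additivity of moving a factor to the end -/

instance smashPow_isCofibrant (A : D) [IsCofibrant A] (k : ℕ) : IsCofibrant (smashPow T A k) :=
  isCofibrant_smashPow T A k

/-- Naturality in $\mathcal D$ extends to maps of $\mathrm{Ho}(\mathcal D)$ through fractions. This
generality is needed because the comultiplication exists only in $\mathrm{Ho}(\mathcal D)$. -/
lemma midMap_moveToEnd (V : D) [IsCofibrant V] (k : ℕ) {B B' : D} [IsCofibrant B] [IsCofibrant B']
    (b : HoHom B B') :
    midMap T V (k + 1) b ≫ hoMap (moveToEnd T V B' k) =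
      hoMap (moveToEnd T V B k) ≫ cofSmash (smashPow T (V ⊗ T) k) b := by
  obtain ⟨Z, _, b', r, _, h⟩ := exists_ho_fraction b
  have key : ∀ {X Y : D} [IsCofibrant X] [IsCofibrant Y] (g : X ⟶ Y),
      midMap T V (k + 1) (hoMap g) ≫ hoMap (moveToEnd T V Y k) =
      hoMap (moveToEnd T V X k) ≫ cofSmash (smashPow T (V ⊗ T) k) (hoMap g) := fun g => by
    rw [midMap, cofSmash_hoMap, hoPow_hoMap, cofSmash_hoMap, ← hoMap_comp, ← hoMap_comp,
      moveToEnd_naturality]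
  have := whiskerLeft_weakEquivalence_of_cofibrant (smashPow T (V ⊗ T) k) r
  have := isIso_hoMap (smashPow T (V ⊗ T) k ◁ r)
  rw [← cancel_mono (hoMap (smashPow T (V ⊗ T) k ◁ r)), ← cofSmash_hoMap _ r, Category.assoc,
    Category.assoc, ← key, ← Category.assoc, ← midMap_comp, ← cofSmash_comp, h, key]

variable [HoCogroup T] {V : D} [IsCofibrant V] {k : ℕ} {Y : D}

/-- The sum of two maps `A ∧ T ⟶ Y` in `Ho(D)`, given by the comultiplication of the last
factor `T`. -/
abbrev lastAdd {A : D} [IsCofibrant A] (f g : HoHom (A ⊗ T) Y) : HoHom (A ⊗ T) Y :=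
  midAdd (T := T) (V := A) (k := 0) f g

lemma cofSmash_add {A : D} [IsCofibrant A] {C : D} [IsCofibrant C] (a b : HoHom T C)
    (u : HoHom (A ⊗ C) Y) :
    cofSmash A (a + b) ≫ u = lastAdd (cofSmash A a ≫ u) (cofSmash A b ≫ u) :=
  midMap_add (T := T) (V := A) (k := 0) a b u

lemma midMap_add_comp {C : D} [IsCofibrant C] (a b : HoHom T C) {E : D}
    (u : HoHom (smashPow T (V ⊗ C) k) E) (w : HoHom E Y) :
    midMap T V k (a + b) ≫ u ≫ w = midAdd (midMap T V k a ≫ u ≫ w) (midMap T V k b ≫ u ≫ w) :=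
  midMap_add a b (u ≫ w)

/-- The additions defined by the first and by the last factor `T` distribute over each other. -/
lemma lastAdd_midAdd (a b c d : HoHom (smashPow T (V ⊗ T) (k + 1)) Y) :
    lastAdd (A := smashPow T (V ⊗ T) k) (midAdd (k := k + 1) a b) (midAdd (k := k + 1) c d) =
      midAdd (k := k + 1) (lastAdd (A := smashPow T (V ⊗ T) k) a c)
        (lastAdd (A := smashPow T (V ⊗ T) k) b d) := by
  let A := smashPow T (V ⊗ T) k
  let Q := smashPow T (V ⊗ (T ⨿ T)) k
  let l : HoHom T (T ⨿ T) := hoMap coprod.inl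
  let r : HoHom T (T ⨿ T) := hoMap coprod.inr
  let M (x : HoHom T (T ⨿ T)) : HoHom A Q := midMap T V k x
  -- The four maps are assembled into one $u$ on $V\wedge(T\vee T)\wedge T^k\wedge(T\vee T)$: $a,b$
  -- use the left summand of the last factor and $c,d$ the right one, while $a,c$ use the left
  -- summand of the first factor. Both sides of the claim are $u$ precomposed with the
  -- comultiplication in both places.
  obtain ⟨u₁, ⟨ha, hb⟩, -⟩ := existsUnique_midMap_desc T V (k + 1) a b
  obtain ⟨u₂, ⟨hc, hd⟩, -⟩ := existsUnique_midMap_desc T V (k + 1) c d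
  obtain ⟨u, hu₁, hu₂⟩ : ∃ u : HoHom (Q ⊗ (T ⨿ T)) Y,
      cofSmash Q l ≫ u = u₁ ∧ cofSmash Q r ≫ u = u₂ :=
    (existsUnique_midMap_desc T Q 0 (Y := Y) u₁ u₂).exists
  -- Bifunctoriality: maps applied to the first and to the last factor $T$ commute. This is the only
  -- input that relates the two additions.
  have ex (x y : HoHom T (T ⨿ T)) : midMap T V (k + 1) x ≫ cofSmash Q y ≫ u =
      cofSmash A y ≫ cofSmashRight (T ⨿ T) (M x) ≫ u := by
    have h : (midMap T V (k + 1) x : HoHom (A ⊗ T) (Q ⊗ T)) = cofSmashRight T (M x) :=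
      hoSmash_eq_cofSmashRight T (M x)
    refine Eq.trans (congrArg (· ≫ cofSmash Q y ≫ u) h) ?_
    have e := congrArg (· ≫ u) (cofSmash_exchange (M x) y)
    exact (Category.assoc _ _ _).symm.trans (e.symm.trans (Category.assoc _ _ _))
  have h₁ (y : HoHom T (T ⨿ T)) : midMap T V (k + 1) (l + r) ≫ cofSmash Q y ≫ u =
      midAdd (V := V) (k := k + 1) (midMap T V (k + 1) l ≫ cofSmash Q y ≫ u)
        (midMap T V (k + 1) r ≫ cofSmash Q y ≫ u) :=
    midMap_add l r _
  have h₂ (x : HoHom T (T ⨿ T)) : midMap T V (k + 1) x ≫ cofSmash Q (l + r) ≫ u =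
      lastAdd (A := A) (midMap T V (k + 1) x ≫ cofSmash Q l ≫ u)
        (midMap T V (k + 1) x ≫ cofSmash Q r ≫ u) := by
    refine (ex x (l + r)).trans ((cofSmash_add l r _).trans ?_)
    exact congrArg₂ (lastAdd (A := A)) (ex x l).symm (ex x r).symm
  rw [← ha, ← hb, ← hc, ← hd, ← hu₁, ← hu₂]
  exact (congrArg₂ (lastAdd (A := A)) (h₁ l) (h₁ r)).symm.trans
    ((h₂ (l + r)).symm.trans ((h₁ (l + r)).trans (congrArg₂ midAdd (h₂ l) (h₂ r))))

/-- The additions defined by the first and by the last factor `T` agree (Eckmann-Hilton). -/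
lemma lastAdd_eq_midAdd [HasZeroObject D] (f g : HoHom (smashPow T (V ⊗ T) (k + 1)) Y) :
    lastAdd (A := smashPow T (V ⊗ T) k) f g = midAdd (k := k + 1) f g := by
  -- $G$ and $G'$ are the same set $[V\wedge T^{k+2},Y]$, with the group structure of the first
  -- factor $T$ on $G$ and of the last one on $G'$.
  let G := Level T V (k + 1) Y
  let G' := Level T (smashPow T (V ⊗ T) k) 0 Y
  have h₁ : EckmannHilton.IsUnital (X := G) (· + ·) 0 := EckmannHilton.AddZeroClass.IsUnital
  have h₂ : EckmannHilton.IsUnital (X := G') (· + ·) 0 := EckmannHilton.AddZeroClass.IsUnital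
  have h := EckmannHilton.mul (X := G) h₂ h₁ (fun a b c d => lastAdd_midAdd a b c d)
  exact congrFun (congrFun h f) g

/-- Comultiplying the first factor and then moving $T\vee T$ to the end is the same as moving $T$ to
the end and comultiplying it there. No sign enters, since the cogroup factor itself is moved. -/
lemma rotate_lastAdd (f g : HoHom (smashPow T (V ⊗ T) (k + 1)) Y) :
    hoMap (rotate T V k) ≫ lastAdd (A := smashPow T (V ⊗ T) k) f g =
      midAdd (k := k + 1) (hoMap (rotate T V k) ≫ f) (hoMap (rotate T V k) ≫ g) := by
  let A := smashPow T (V ⊗ T) k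
  obtain ⟨u, hf, hg⟩ : ∃ u : HoHom (A ⊗ (T ⨿ T)) Y, cofSmash A (hoMap coprod.inl) ≫ u = f ∧
      cofSmash A (hoMap coprod.inr) ≫ u = g :=
    (existsUnique_midMap_desc T A 0 (Y := Y) f g).exists
  have h (x : HoHom T (T ⨿ T)) : hoMap (rotate T V k) ≫ cofSmash A x ≫ u =
      midMap T V (k + 1) x ≫ hoMap (moveToEnd T V (T ⨿ T) k) ≫ u := by
    rw [← moveToEnd_self]
    exact (Category.assoc _ _ _).symm.trans
      ((congrArg (· ≫ u) (midMap_moveToEnd V k x).symm).trans (Category.assoc _ _ _))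
  have h' := midMap_add_comp (V := V) (k := k + 1) (hoMap coprod.inl) (hoMap coprod.inr)
    (hoMap (moveToEnd T V (T ⨿ T) k)) u
  rw [← h, ← h, ← h, hf, hg] at h'
  refine Eq.trans (congrArg (hoMap (rotate T V k) ≫ ·) ?_) h'
  rw [← hf, ← hg]
  exact (cofSmash_add _ _ _).symm

/-- Precomposition with the map that moves the first factor `T` to the end is additive. -/
lemma rotate_midAdd [HasZeroObject D] (f g : HoHom (smashPow T (V ⊗ T) (k + 1)) Y) :
    hoMap (rotate T V k) ≫ midAdd (k := k + 1) f g =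
      midAdd (k := k + 1) (hoMap (rotate T V k) ≫ f) (hoMap (rotate T V k) ≫ g) := by
  rw [← lastAdd_eq_midAdd]
  exact rotate_lastAdd f g

end

section

variable {D : Type u} [Category.{v} D] [ModelCategory D] [MonoidalCategory D] [SymmetricCategory D]
  [MonoidalClosed D] [MonoidalModelCategory D]
  {T : D} [IsCofibrant T] [SmashPreservesWeakEquivalences T] [SmashSign T]

/-! ### Signs -/

/-- The symmetry of $T\wedge T$ is $(-1)_T\wedge T$ by the sign axiom for $\Sigma_2$; smashing with
$A$ on the left and reassociating gives the claim. -/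
lemma hoMap_swapLast (A : D) [IsCofibrant A] :
    hoMap (swapLast T A) = hoSmash T (cofSmash A (SmashSign.s (T := T))) := by
  have h := cofSmash_hoSmash A T (SmashSign.s (T := T))
  rw [← SmashSign.braiding_eq, cofSmash_hoMap] at h
  rw [swapLast, hoMap_comp, hoMap_comp, ← Category.assoc, ← h, Category.assoc, ← hoMap_comp,
    Iso.hom_inv_id, hoMap_id, Category.comp_id]

/-- The axiom $(-1)_T\wedge T=T\wedge(-1)_T$ lets a sign pass from one factor $T$ to the adjacent
one. Iterated in `cofSmash_smashPow_sign`, it brings a sign on the last factor to the first, where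
the sign action is defined. -/
lemma cofSmash_tensor_sign (A : D) [IsCofibrant A] :
    cofSmash (A ⊗ T) (SmashSign.s (T := T)) = hoSmash T (cofSmash A (SmashSign.s (T := T))) := by
  have h := cofSmash_hoSmash A T (SmashSign.s (T := T))
  rw [SmashSign.smash_eq, ← cofSmash_cofSmash] at h
  have := isIso_hoMap (α_ A T T).hom
  exact ((cancel_mono _).1 h).symm

lemma cofSmash_smashPow_sign (V : D) [IsCofibrant V] (k : ℕ) :
    cofSmash (smashPow T (V ⊗ T) k) (SmashSign.s (T := T)) =
      midMap T V (k + 1) (SmashSign.s (T := T)) := by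
  induction k with
  | zero => exact cofSmash_tensor_sign V
  | succ k ih => exact (cofSmash_tensor_sign _).trans (congrArg (hoSmash T) ih)

/-- The action of the sign of `T` on maps out of `V ∧ T^{k+1}`. -/
abbrev midSign (T V : D) [IsCofibrant T] [SmashPreservesWeakEquivalences T] [SmashSign T]
    [IsCofibrant V] (k : ℕ) : HoHom (smashPow T (V ⊗ T) k) (smashPow T (V ⊗ T) k) :=
  midMap T V k (SmashSign.s (T := T))

lemma midSign_comp_self (V : D) [IsCofibrant V] (k : ℕ) :
    midSign T V k ≫ midSign T V k = 𝟙 _ := by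
  rw [← midMap_comp, SmashSign.s_comp_s, midMap_id]

/-- Moving the first factor `T` to the end is the identity or the sign. -/
lemma hoMap_rotate (V : D) [IsCofibrant V] (k : ℕ) :
    (hoMap (rotate T V k) : HoHom (smashPow T (V ⊗ T) (k + 1)) (smashPow T (V ⊗ T) (k + 1))) =
      midMap T V (k + 1) (if Even k then SmashSign.s (T := T) else 𝟙 _) := by
  -- The factor passes $k+1$ others, each passage contributing one sign, so the total is
  -- $(-1)^{k+1}$.
  induction k with
  | zero => exact hoMap_swapLast V
  | succ k ih =>
    have h : hoMap (rotate T V (k + 1)) =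
        hoSmash T (hoMap (rotate T V k)) ≫ hoMap (swapLast T (smashPow T (V ⊗ T) k)) := by
      rw [hoSmash_hoMap, ← hoMap_comp]; rfl
    refine h.trans ?_
    rw [SmashSign.swapLast_eq]
    refine (congrArg (hoSmash T · ≫ midSign T V (k + 2)) ih).trans ?_
    refine (midMap_comp T V (k + 2) _ _).symm.trans (congrArg _ ?_)
    by_cases hk : Even k
    · simp [hk, Nat.even_add_one, SmashSign.s_comp_s]
    · simp [hk, Nat.even_add_one]

/-- In `Ho(D)`, exchanging the last two factors of `(X ∧ T) ∧ T` after `f ∧ T` is the sign. -/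
lemma hoSmash_swapLast {V : D} [IsCofibrant V] {k : ℕ} {X : D}
    (f : HoHom (smashPow T (V ⊗ T) k) (X ⊗ T)) :
    hoSmash T f ≫ hoMap (swapLast T X) = midSign T V (k + 1) ≫ hoSmash T f := by
  -- Since $X$ need not be cofibrant, it is replaced by a cofibrant $Q$; $p\wedge T$ is still
  -- invertible in $\mathrm{Ho}(\mathcal D)$. For $Q$ the exchange is a sign on the last factor,
  -- which slides through $f\wedge T$ by bifunctoriality.
  obtain ⟨Q, p, _, _⟩ : ∃ (Q : D) (p : Q ⟶ X), IsCofibrant Q ∧ WeakEquivalence p :=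
    ⟨_, CofibrantObject.HoCat.pResolutionObj X, inferInstance, inferInstance⟩
  have := SmashPreservesWeakEquivalences.smash (T := T) p inferInstance
  have := isIso_hoMap (p ▷ T)
  obtain ⟨f, rfl⟩ : ∃ f', f = f' ≫ hoMap (p ▷ T) := ⟨f ≫ inv (hoMap (p ▷ T)), by simp⟩
  have h : cofSmash (smashPow T (V ⊗ T) k) (SmashSign.s (T := T)) ≫ hoSmash T f =
      hoSmash T f ≫ cofSmash (Q ⊗ T) (SmashSign.s (T := T)) := cofSmash_hoSmash_exchange T f _
  rw [cofSmash_smashPow_sign, cofSmash_tensor_sign, ← hoMap_swapLast] at h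
  rw [hoSmash_comp, hoSmash_hoMap, Category.assoc, ← hoMap_comp, ← swapLast_naturality, hoMap_comp,
    ← Category.assoc, ← h]
  exact Category.assoc _ _ _

end

section

variable {D : Type u} [Category.{v} D] [ModelCategory D] [MonoidalCategory D] [SymmetricCategory D]
  [MonoidalClosed D] [MonoidalModelCategory D]

/-! ### The derived adjunction between `- ∧ T` and `Hom(T, -)` -/

/-- $T$ is cofibrant, so $T\wedge-$ preserves cofibrations and trivial cofibrations; by adjunction
of lifting properties $\mathrm{Hom}(T,-)$ preserves fibrations and, in the next lemma, trivial
fibrations. -/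
lemma ihom_map_fibration (T : D) [IsCofibrant T] {A B : D} (p : A ⟶ B) [Fibration p] :
    Fibration ((ihom T).map p) := by
  rw [fibration_iff, ← trivialCofibrations_rlp]
  intro X Y i hi
  obtain ⟨hi₁, hi₂⟩ := (mem_trivialCofibrations_iff i).1 hi
  have := (whiskerLeft_cofibration T i).1
  have := (whiskerLeft_cofibration T i).2 hi₂
  rw [← (ihom.adjunction T).hasLiftingProperty_iff]
  change HasLiftingProperty (T ◁ i) p
  infer_instance

lemma ihom_map_weakEquivalence (T : D) [IsCofibrant T] {A B : D} (p : A ⟶ B) [Fibration p]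
    [WeakEquivalence p] : WeakEquivalence ((ihom T).map p) := by
  have h : trivialFibrations D ((ihom T).map p) := by
    rw [← cofibrations_rlp]
    intro X Y i hi
    have : Cofibration i := (cofibration_iff i).2 hi
    have := (whiskerLeft_cofibration T i).1
    rw [← (ihom.adjunction T).hasLiftingProperty_iff]
    change HasLiftingProperty (T ◁ i) p
    infer_instance
  exact ((mem_trivialFibrations_iff _).1 h).2

instance ihom_isFibrant (T Y : D) [IsCofibrant T] [IsFibrant Y] : IsFibrant ((ihom T).obj Y) := by
  have := ihom_map_fibration T (terminal.from Y)
  rwa [isFibrant_iff_of_isTerminal ((ihom T).map (terminal.from Y))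
    (IsTerminal.isTerminalObj (ihom T) _ terminalIsTerminal)]

/-- The map `A ⟶ Hom(T, Y)` adjoint to `A ∧ T ⟶ Y`. -/
def curryRight {T A Y : D} (f : A ⊗ T ⟶ Y) : A ⟶ (ihom T).obj Y :=
  MonoidalClosed.curry ((β_ A T).inv ≫ f)

lemma curryRight_evRight {T A Y : D} (f : A ⊗ T ⟶ Y) : curryRight f ▷ T ≫ evRight T Y = f := by
  rw [evRight, BraidedCategory.braiding_naturality_left_assoc, ← MonoidalClosed.uncurry_eq,
    curryRight, MonoidalClosed.uncurry_curry, Iso.hom_inv_id_assoc]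

/-- For `A` cofibrant and `Y` fibrant, adjunction induces a bijection
`[A, Hom(T, Y)] ≅ [A ∧ T, Y]`. -/
lemma bijective_hoSmash_evRight (T : D) [IsCofibrant T] [SmashPreservesWeakEquivalences T]
    (A Y : D) [IsCofibrant A] [IsFibrant Y] :
    Function.Bijective
      (fun f : HoHom A ((ihom T).obj Y) => hoSmash T f ≫ hoMap (evRight T Y)) := by
  constructor
  · intro f g h
    -- $A$ is cofibrant and $\mathrm{Hom}(T,Y)$ is fibrant, so both classes are represented by maps
    -- of $\mathcal D$.
    obtain ⟨f, rfl⟩ := map_surjective_of_isLocalization (toHo D) _ _ f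
    obtain ⟨g, rfl⟩ := map_surjective_of_isLocalization (toHo D) _ _ g
    have h' : hoMap (f ▷ T ≫ evRight T Y) = hoMap (g ▷ T ≫ evRight T Y) := by
      rw [hoMap_comp, hoMap_comp, ← hoSmash_hoMap, ← hoSmash_hoMap]; exact h
    -- For a good path object $P$ of the fibrant object $Y$ the projection $p_0$ is a trivial
    -- fibration, so $\mathrm{Hom}(T,P)$ is again a path object. The adjoint of the homotopy $H$ is
    -- the required homotopy into it.
    obtain ⟨P, _, ⟨H⟩⟩ := ((RightHomotopyRel.iff_map_eq (toHo D) _ _).2 h').exists_good_pathObject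
    have h₀ : curryRight H.h ≫ (ihom T).map P.p₀ = f := evRight_ext T <| by
      rw [comp_whiskerRight_assoc, evRight_naturality, ← Category.assoc, curryRight_evRight, H.h₀]
    have h₁ : curryRight H.h ≫ (ihom T).map P.p₁ = g := evRight_ext T <| by
      rw [comp_whiskerRight_assoc, evRight_naturality, ← Category.assoc, curryRight_evRight, H.h₁]
    have := ihom_map_weakEquivalence T P.p₀
    have e₀ : (ihom T).map P.ι ≫ (ihom T).map P.p₀ = 𝟙 _ := by
      rw [← Functor.map_comp, P.ι_p₀, CategoryTheory.Functor.map_id]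
    have e₁ : (ihom T).map P.ι ≫ (ihom T).map P.p₁ = 𝟙 _ := by
      rw [← Functor.map_comp, P.ι_p₁, CategoryTheory.Functor.map_id]
    have : WeakEquivalence ((ihom T).map P.ι) := by
      have : WeakEquivalence ((ihom T).map P.ι ≫ (ihom T).map P.p₀) := by
        rw [e₀]; infer_instance
      exact weakEquivalence_of_postcomp _ ((ihom T).map P.p₀)
    exact (RightHomotopyRel.iff_map_eq (toHo D) _ _).1
      ⟨{ P := (ihom T).obj P.P
         p₀ := (ihom T).map P.p₀
         p₁ := (ihom T).map P.p₁
         ι := (ihom T).map P.ι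
         ι_p₀ := e₀
         ι_p₁ := e₁ }, ⟨⟨curryRight H.h, h₀, h₁⟩⟩⟩
  · intro f
    obtain ⟨f, rfl⟩ := map_surjective_of_isLocalization (toHo D) _ _ f
    refine ⟨hoMap (curryRight f), ?_⟩
    dsimp only
    rw [hoSmash_hoMap, ← hoMap_comp, curryRight_evRight]

end

section

variable {D : Type u} [Category.{v} D] [ModelCategory D] [MonoidalCategory D] [SymmetricCategory D]
  [MonoidalClosed D] [MonoidalModelCategory D]
  {T : D} [IsCofibrant T] [SmashPreservesWeakEquivalences T]

/-! ### The maps on `[V ∧ T^{k+1}, -]` that raise the degree -/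

variable {V : D} [IsCofibrant V] {k : ℕ}

/-- For `e : W ∧ T ⟶ Y`, the map that sends `f : V ∧ T^{k+1} ⟶ W` to the composition of `f ∧ T` and
`e` with the map `V ∧ T ∧ T^{k+1} ⟶ V ∧ T^{k+1} ∧ T` moving the first factor `T` to the end. -/
def suspend {W Y : D} (e : W ⊗ T ⟶ Y) (f : HoHom (smashPow T (V ⊗ T) k) W) :
    HoHom (smashPow T (V ⊗ T) (k + 1)) Y :=
  hoMap (rotate T V k) ≫ hoSmash T f ≫ hoMap e

/-- $T\wedge f$ is $f\wedge T$ conjugated by symmetries, and the symmetry on the source cancels the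
one in `toFront_eq`. Hence $T\wedge X$ is treated by the same argument as $\Omega X$. -/
lemma smashLeft_eq_suspend {Y : D} (f : HoHom (smashPow T (V ⊗ T) k) Y) :
    smashLeft f = suspend (β_ Y T).hom f := by
  have h : hoMap (β_ (smashPow T (V ⊗ T) k) T).hom ≫ hoMap (β_ (smashPow T (V ⊗ T) k) T).inv =
      𝟙 _ := by
    rw [← hoMap_comp, Iso.hom_inv_id, hoMap_id]
  rw [smashLeft, toFront_eq, hoSmashLeft_eq, hoMap_comp, suspend, Category.assoc, reassoc_of% h]

/-- Smashing with $T$ on the right and composing with $e$ keep the sum of the first factor. Only the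
rotation is an issue, and it is settled by Eckmann-Hilton through `rotate_midAdd`. -/
lemma suspend_midAdd [HoCogroup T] [HasZeroObject D] {W Y : D} (e : W ⊗ T ⟶ Y)
    (f g : HoHom (smashPow T (V ⊗ T) k) W) :
    suspend e (midAdd f g) = midAdd (k := k + 1) (suspend e f) (suspend e g) := by
  have h : hoSmash T (midAdd f g) ≫ hoMap e =
      midAdd (k := k + 1) (hoSmash T f ≫ hoMap e) (hoSmash T g ≫ hoMap e) := by
    rw [hoSmash_midAdd]; exact midAdd_comp _ _ _
  exact (congrArg (hoMap (rotate T V k) ≫ ·) h).trans (rotate_midAdd _ _)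

lemma suspend_comp {W W' Y Y' : D} {e : W ⊗ T ⟶ Y} {e' : W' ⊗ T ⟶ Y'} {a : W ⟶ W'} {b : Y ⟶ Y'}
    (h : a ▷ T ≫ e' = e ≫ b) (f : HoHom (smashPow T (V ⊗ T) k) W) :
    suspend e' (f ≫ hoMap a) = suspend e f ≫ hoMap b := by
  rw [suspend, suspend, hoSmash_comp, hoSmash_hoMap, Category.assoc, ← hoMap_comp, h, hoMap_comp,
    Category.assoc, Category.assoc]

lemma swapLast_swapLast (A : D) : swapLast T A ≫ swapLast T A = 𝟙 _ := by
  simp only [swapLast, Category.assoc, Iso.inv_hom_id_assoc]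
  rw [← MonoidalCategory.whiskerLeft_comp_assoc, SymmetricCategory.symmetry]
  simp

/-- The rotation on the longer source ends with one additional exchange. Naturality of the exchange
carries it past $f\wedge T\wedge T$, where it cancels the exchange in the hypothesis. -/
lemma suspend_step {W W' Y Y' : D} {e : W ⊗ T ⟶ Y} {e' : W' ⊗ T ⟶ Y'} {s : W ⊗ T ⟶ W'}
    {s' : Y ⊗ T ⟶ Y'} (h : s ▷ T ≫ e' = swapLast T W ≫ e ▷ T ≫ s')
    (f : HoHom (smashPow T (V ⊗ T) k) W) :
    suspend (T := T) (V := V) (k := k + 1) e' (hoSmash T f ≫ hoMap s) =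
      hoSmash T (suspend e f) ≫ hoMap s' := by
  have aux : ∀ {A B : D} (r : A ⟶ B ⊗ T) (f : HoHom B W),
      hoMap (r ▷ T ≫ swapLast T B) ≫ hoSmash T (hoSmash T f ≫ hoMap s) ≫ hoMap e' =
        hoSmash T (hoMap r ≫ hoSmash T f ≫ hoMap e) ≫ hoMap s' := by
    intro A B r f
    have hf := hoSmash_naturality_swapLast (T := T) (A := B) (B := W) f
    have hs : hoMap (swapLast T W) ≫ hoMap (swapLast T W) = 𝟙 _ := by
      rw [← hoMap_comp, swapLast_swapLast, hoMap_id]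
    rw [hoSmash_comp, hoSmash_hoMap, Category.assoc, ← hoMap_comp, h, hoMap_comp, hoMap_comp,
      hoMap_comp, Category.assoc, reassoc_of% hf, reassoc_of% hs, hoSmash_comp, hoSmash_comp,
      hoSmash_hoMap, hoSmash_hoMap]
    simp only [Category.assoc]
  exact aux (rotate T V k) f

/-! ### Suspension and the sign of $T$ -/

section

variable [SmashSign T]

/-- The rotation is itself the sign or the identity, so it commutes with the sign, whichever factor
$T$ the latter is placed on. -/
lemma suspend_midSign {W Y : D} (e : W ⊗ T ⟶ Y) (f : HoHom (smashPow T (V ⊗ T) k) W) :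
    suspend e (midSign T V k ≫ f) = midSign T V (k + 1) ≫ suspend e f := by
  have h : hoMap (rotate T V k) ≫ midSign T V (k + 1) =
      midSign T V (k + 1) ≫ hoMap (rotate T V k) := by
    refine (congrArg (· ≫ midSign T V (k + 1)) (hoMap_rotate V k)).trans
      (Eq.trans ?_ (congrArg (midSign T V (k + 1) ≫ ·) (hoMap_rotate V k)).symm)
    rw [← midMap_comp, ← midMap_comp]
    split_ifs
    · rfl
    · rw [Category.id_comp, Category.comp_id]
  have aux : ∀ {A B C : D} {r : HoHom A (B ⊗ T)} {a : HoHom B B} {b : HoHom A A} {c : HoHom C C}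
      (f : HoHom B W), r ≫ hoSmash T a = b ≫ r →
      r ≫ hoSmash T (a ≫ f) ≫ hoMap e = b ≫ r ≫ hoSmash T f ≫ hoMap e := by
    intro A B C r a b c f h
    rw [hoSmash_comp, Category.assoc, reassoc_of% h]
  exact aux (C := T) (c := 𝟙 _) f h

lemma suspend_midMap_permSign {W Y : D} (e : W ⊗ T ⟶ Y) (f : HoHom (smashPow T (V ⊗ T) k) W)
    {n : ℕ} (γ : Equiv.Perm (Fin n)) :
    suspend e (midMap T V k (permSign (SmashSign.s (T := T)) γ) ≫ f) =
      midMap T V (k + 1) (permSign (SmashSign.s (T := T)) γ) ≫ suspend e f := by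
  rw [permSign]
  split_ifs
  · rw [midMap_id, midMap_id, Category.id_comp, Category.id_comp]
  · exact suspend_midSign e f

/-- Source and target are definitionally the same object, so the rotation can be squared; being a
power of the sign, it is its own inverse in $\mathrm{Ho}(\mathcal D)$. -/
lemma isIso_hoMap_rotate (V : D) [IsCofibrant V] (k : ℕ) : IsIso (hoMap (rotate T V k)) := by
  have : (hoMap (rotate T V k) : HoHom _ (smashPow T (V ⊗ T) (k + 1))) ≫ hoMap (rotate T V k) =
      𝟙 _ := by
    refine (congrArg₂ (· ≫ ·) (hoMap_rotate V k) (hoMap_rotate V k)).trans ?_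
    rw [← midMap_comp]
    split_ifs
    · rw [SmashSign.s_comp_s, midMap_id]
    · rw [Category.comp_id, midMap_id]
  exact ⟨_, this, this⟩

lemma bijective_loopAdjoint (Y : D) [IsFibrant Y] : Function.Bijective
    (loopAdjoint : HoHom (smashPow T (V ⊗ T) k) ((ihom T).obj Y) → HoHom _ Y) := by
  have := isIso_hoMap_rotate (T := T) V k
  have h : Function.Bijective (fun f : HoHom (smashPow T (V ⊗ T) k ⊗ T) Y =>
      hoMap (rotate T V k) ≫ f) :=
    ⟨fun f g h => (cancel_epi _).1 h, fun f => ⟨inv (hoMap (rotate T V k)) ≫ f, by simp⟩⟩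
  exact h.comp (bijective_hoSmash_evRight T _ Y)

/-- This is the injectivity half for $T\wedge X$: $f$ itself is not recovered, but $f\wedge T$ is,
and that determines the stabilisation of $f$. -/
lemma hoSmash_eq_of_smashLeft_eq {Y : D} {f g : HoHom (smashPow T (V ⊗ T) k) Y}
    (h : smashLeft f = smashLeft g) : hoSmash T f = hoSmash T g := by
  have := isIso_hoMap_rotate (T := T) V k
  rw [smashLeft_eq_suspend, smashLeft_eq_suspend, suspend, suspend, cancel_epi] at h
  exact (cancel_mono (hoMap (β_ Y T).hom)).1 h

/-- Up to sign, `g : V ∧ T^{k+1} ⟶ T ∧ X` is stably of the form `T ∧ f`. -/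
lemma smashLeft_comp_braiding {X X' : D} (g : HoHom (smashPow T (V ⊗ T) k) (T ⊗ X))
    (s : X ⊗ T ⟶ X') :
    smashLeft (g ≫ hoMap (β_ X T).inv ≫ hoMap s) =
      hoMap (rotate T V k) ≫ midSign T V (k + 1) ≫
        hoSmash T g ≫ hoMap ((α_ T X T).hom ≫ T ◁ s) := by
  -- By the hexagon identity, the symmetry of $X\wedge T$ with $T$ splits off the exchange of the
  -- two factors $T$. That exchange becomes the sign by `hoSmash_swapLast`.
  have e : (s ▷ T ≫ (β_ X' T).hom) =
      swapLast T X ≫ (β_ X T).hom ▷ T ≫ (α_ T X T).hom ≫ T ◁ s := by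
    rw [BraidedCategory.braiding_naturality_left, BraidedCategory.braiding_tensor_left_hom]
    simp [swapLast]
  have aux : ∀ {A : D} {t : HoHom (A ⊗ T) (A ⊗ T)} (g : HoHom A (T ⊗ X)),
      hoSmash T (g ≫ hoMap (β_ X T).inv) ≫ hoMap (swapLast T X) =
        t ≫ hoSmash T (g ≫ hoMap (β_ X T).inv) →
      hoSmash T (g ≫ hoMap (β_ X T).inv ≫ hoMap s) ≫ hoMap (β_ X' T).hom =
        t ≫ hoSmash T g ≫ hoMap ((α_ T X T).hom ≫ T ◁ s) := by
    intro A t g h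
    have hβ : hoMap ((β_ X T).inv ▷ T) ≫ hoMap ((β_ X T).hom ▷ T) = 𝟙 _ := by
      rw [← hoMap_comp, inv_hom_whiskerRight, hoMap_id]
    rw [← Category.assoc g, hoSmash_comp, hoSmash_hoMap, Category.assoc, ← hoMap_comp, e,
      hoMap_comp, hoMap_comp, reassoc_of% h, hoSmash_comp, hoSmash_hoMap, Category.assoc,
      reassoc_of% hβ]
  rw [smashLeft_eq_suspend]
  exact congrArg (hoMap (rotate T V k) ≫ ·) (aux g (hoSmash_swapLast (g ≫ hoMap (β_ X T).inv)))

end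

end

section

variable {D : Type u} [Category.{v} D] [ModelCategory D] [HasZeroObject D] [MonoidalCategory D]
  [SymmetricCategory D] [MonoidalClosed D] [MonoidalModelCategory D]
  {T : D} [IsCofibrant T] [SmashPreservesWeakEquivalences T] [HoCogroup T]
  {V : D} [IsCofibrant V]

/-! ### Elements of stable homotopy groups -/

/-- The element `f'` is the image of `f` under an iteration of the maps `f ↦ σ ∘ (f ∧ T)`. -/
inductive TSpectrum.Reaches (X : TSpectrum T) {k m : ℕ} (f : Level T V k (X.obj m)) :
    ∀ {k' m' : ℕ}, Level T V k' (X.obj m') → Prop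
  | refl : Reaches X f f
  | step {k' m' : ℕ} {f' : Level T V k' (X.obj m')} :
      Reaches X f f' → Reaches X f (X.step V k' m' f')

lemma TSpectrum.Reaches.eq_add {X : TSpectrum T} {k m : ℕ} {f : Level T V k (X.obj m)} {k' m' : ℕ}
    {f' : Level T V k' (X.obj m')} (h : X.Reaches f f') : ∃ n, k' = k + n ∧ m' = m + n := by
  induction h with
  | refl => exact ⟨0, rfl, rfl⟩
  | step _ ih =>
    obtain ⟨n, rfl, rfl⟩ := ih
    exact ⟨n + 1, rfl, rfl⟩

lemma TSpectrum.reaches_trans (X : TSpectrum T) (q : ℤ) {i j : ℕ} (h : i ≤ j) (f : X.seq q V i) :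
    X.Reaches f (X.trans q V i j h f) := by
  induction j, h using Nat.le_induction with
  | base => rw [X.trans_self]; exact .refl
  | succ j h ih => rw [X.trans_succ q V h]; exact .step ih

/-- Converse of `reaches_trans`. The relation `Reaches` carries free indices, which avoids
transports when index functions such as $m\mapsto 1+m$ are applied; the price is the heterogeneous
equality here. -/
lemma TSpectrum.Reaches.heq_trans {X : TSpectrum T} {q : ℤ} {i : ℕ} {f : X.seq q V i} {k' m' : ℕ}
    {f' : Level T V k' (X.obj m')} (h : X.Reaches f f') :
    ∃ (j : ℕ) (hij : i ≤ j), k' = firstExp q + j ∧ m' = firstIdx q + j ∧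
      HEq f' (X.trans q V i j hij f) := by
  induction h with
  | refl => exact ⟨i, le_rfl, rfl, rfl, by rw [X.trans_self]; exact HEq.rfl⟩
  | step _ ih =>
    obtain ⟨j, hij, rfl, rfl, h⟩ := ih
    refine ⟨j + 1, by omega, rfl, rfl, heq_of_eq ?_⟩
    rw [X.trans_succ q V hij, eq_of_heq h]
    rfl

lemma first_eq (q : ℤ) (n : ℕ) :
    ((firstExp q + n : ℕ) : ℤ) + 1 = q + (firstIdx q + n : ℕ) := by
  simp only [firstExp, firstIdx]; omega

lemma exists_eq_first {q : ℤ} {m k : ℕ} (h : (k : ℤ) + 1 = q + m) :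
    ∃ n, k = firstExp q + n ∧ m = firstIdx q + n :=
  ⟨m - firstIdx q, by simp only [firstExp, firstIdx]; omega, by simp only [firstIdx]; omega⟩

namespace TSpectrum.Pi

variable {X : TSpectrum T} {q : ℤ}

lemma exists_mk (x : X.Pi q V) : ∃ (m k : ℕ) (h : (k : ℤ) + 1 = q + m)
    (f : Level T V k (X.obj m)), Pi.mk m k h f = x := by
  induction x using Quotient.ind with | _ x =>
  obtain ⟨n, f⟩ := x
  exact ⟨_, _, first_eq q n, f, Pi.mk_eq n _ f⟩

lemma mk_add (m k : ℕ) (h : (k : ℤ) + 1 = q + m) (f g : Level T V k (X.obj m)) :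
    (Pi.mk m k h (f + g : Level T V k (X.obj m)) : X.Pi q V) = Pi.mk m k h f + Pi.mk m k h g := by
  obtain ⟨n, rfl, rfl⟩ := exists_eq_first h
  refine (Pi.mk_eq n h _).trans (Eq.trans ?_ (congrArg₂ (· + ·) (Pi.mk_eq n h f)
    (Pi.mk_eq n h g)).symm)
  exact (DirectLimit.add_def (f := X.trans q V) n f g).symm

lemma mk_zero (m k : ℕ) (h : (k : ℤ) + 1 = q + m) :
    (Pi.mk m k h (0 : Level T V k (X.obj m)) : X.Pi q V) = 0 := by
  have := mk_add (X := X) m k h (0 : Level T V k (X.obj m)) 0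
  rw [add_zero] at this
  exact left_eq_add.1 this

lemma mk_reaches {m k m' k' : ℕ} {f : Level T V k (X.obj m)} {f' : Level T V k' (X.obj m')}
    (hf : X.Reaches f f') (h : (k : ℤ) + 1 = q + m) (h' : (k' : ℤ) + 1 = q + m') :
    (Pi.mk m' k' h' f' : X.Pi q V) = Pi.mk m k h f := by
  induction hf with
  | refl => rfl
  | @step k' m' f' hf ih =>
    obtain ⟨n, rfl, rfl⟩ := hf.eq_add
    have h'' : ((k + n : ℕ) : ℤ) + 1 = q + (m + n : ℕ) := by omega
    exact (Pi.mk_succ (m + n) (k + n) h'' f').trans (ih h'')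

/-- An element of a directed colimit of groups vanishes only if it already vanishes at some finite
stage. -/
lemma reaches_zero {m k : ℕ} (h : (k : ℤ) + 1 = q + m) {f : Level T V k (X.obj m)}
    (hf : (Pi.mk m k h f : X.Pi q V) = 0) :
    ∃ k' m', X.Reaches f (0 : Level T V k' (X.obj m')) := by
  obtain ⟨n, rfl, rfl⟩ := exists_eq_first h
  obtain ⟨j, hij, e⟩ :=
    (DirectLimit.exists_eq_zero (f := X.trans q V) ⟨n, f⟩).1 ((Pi.mk_eq n h f).symm.trans hf)
  exact ⟨_, _, e ▸ X.reaches_trans q hij f⟩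

lemma signAct_mk [SmashSign T] (m k : ℕ) (h : (k : ℤ) + 1 = q + m) (f : Level T V k (X.obj m)) :
    Pi.signAct (Pi.mk m k h f : X.Pi q V) = Pi.mk m k h (midSign T V k ≫ f) := by
  obtain ⟨n, rfl, rfl⟩ := exists_eq_first h
  exact (congrArg Pi.signAct (Pi.mk_eq n h f)).trans (Pi.mk_eq n h _).symm

end TSpectrum.Pi

/-! ### Maps of stable homotopy groups that are defined on the levels -/

variable (V) in
/-- A compatible family of homomorphisms `[V ∧ T^{k+1}, X_m] ⟶ [V ∧ T^{κ k+1}, Y_{μ m}]`. -/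
structure LevelwiseHom (X Y : TSpectrum T) (q q' : ℤ) where
  μ : ℕ → ℕ
  κ : ℕ → ℕ
  degree {m k : ℕ} : (k : ℤ) + 1 = q + m → (κ k : ℤ) + 1 = q' + μ m
  μ_succ (m : ℕ) : μ (m + 1) = μ m + 1
  κ_succ (k : ℕ) : κ (k + 1) = κ k + 1
  hom (m k : ℕ) : Level T V k (X.obj m) → Level T V (κ k) (Y.obj (μ m))
  map_add {m k : ℕ} (f g : Level T V k (X.obj m)) : hom m k (f + g) = hom m k f + hom m k g
  step {m k : ℕ} (f : Level T V k (X.obj m)) :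
    HEq (hom (m + 1) (k + 1) (X.step V k m f)) (Y.step V (κ k) (μ m) (hom m k f))

namespace LevelwiseHom

variable {X Y : TSpectrum T} {q q' : ℤ} (F : LevelwiseHom V X Y q q')

lemma reaches_step {k' m' : ℕ}
    {f' : Level T V k' (Y.obj m')} {m₁ k₁ : ℕ} {f₁ : Level T V k₁ (X.obj m₁)}
    (h : Y.Reaches f' (F.hom m₁ k₁ f₁)) :
    Y.Reaches f' (F.hom (m₁ + 1) (k₁ + 1) (X.step V k₁ m₁ f₁)) := by
  -- The indices are generalised so that `κ_succ` and `μ_succ` can be substituted, which turns the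
  -- heterogeneous equality into an equality.
  have aux : ∀ {k m : ℕ} (hk : k = F.κ k₁ + 1) (hm : m = F.μ m₁ + 1) (z : Level T V k (Y.obj m)),
      HEq z (Y.step V (F.κ k₁) (F.μ m₁) (F.hom m₁ k₁ f₁)) → Y.Reaches f' z := by
    rintro _ _ rfl rfl z hz
    rw [eq_of_heq hz]
    exact .step h
  exact aux (F.κ_succ _) (F.μ_succ _) _ (F.step f₁)

lemma reaches {m k m' k' : ℕ} {f : Level T V k (X.obj m)} {f' : Level T V k' (X.obj m')}
    (h : X.Reaches f f') : Y.Reaches (F.hom m k f) (F.hom m' k' f') := by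
  induction h with
  | refl => exact .refl
  | step _ ih => exact F.reaches_step ih

/-- Stabilising after the level map is the same as stabilising before it. This pulls the vanishing
of an image back to a statement about a stabilisation of $f$. -/
lemma exists_reaches {m k m' k' : ℕ} {f : Level T V k (X.obj m)} {f' : Level T V k' (Y.obj m')}
    (h : Y.Reaches (F.hom m k f) f') :
    ∃ (m₁ k₁ : ℕ) (f₁ : Level T V k₁ (X.obj m₁)), X.Reaches f f₁ ∧ k' = F.κ k₁ ∧ m' = F.μ m₁ ∧
      HEq f' (F.hom m₁ k₁ f₁) := by
  induction h with
  | refl => exact ⟨m, k, f, .refl, rfl, rfl, HEq.rfl⟩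
  | step _ ih =>
    obtain ⟨m₁, k₁, f₁, h, rfl, rfl, e⟩ := ih
    refine ⟨m₁ + 1, k₁ + 1, _, .step h, (F.κ_succ _).symm, (F.μ_succ _).symm, ?_⟩
    rw [eq_of_heq e]
    exact (F.step f₁).symm

/-- The homomorphism of stable homotopy groups induced by a family of homomorphisms. -/
def map : X.Pi q V →+ Y.Pi q' V :=
  AddMonoidHom.mk' (DirectLimit.lift (X.trans q V)
      (fun i f => (TSpectrum.Pi.mk _ _ (F.degree (first_eq q i)) (F.hom _ _ f) : Y.Pi q' V))
      (fun _ _ h f => (TSpectrum.Pi.mk_reaches (F.reaches (X.reaches_trans q h f)) _ _).symm)) <| by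
    intro x y
    induction x, y using DirectLimit.induction₂ (X.trans q V) with | _ n f g =>
    refine (congrArg _ (DirectLimit.add_def (f := X.trans q V) n f g)).trans ?_
    exact (congrArg (TSpectrum.Pi.mk _ _ (F.degree (first_eq q n))) (F.map_add f g)).trans
      (TSpectrum.Pi.mk_add _ _ _ _ _)

lemma map_mk (m k : ℕ) (h : (k : ℤ) + 1 = q + m) (f : Level T V k (X.obj m)) :
    F.map (TSpectrum.Pi.mk m k h f) =
      TSpectrum.Pi.mk (F.μ m) (F.κ k) (F.degree h) (F.hom m k f) := by
  obtain ⟨n, rfl, rfl⟩ := exists_eq_first h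
  exact congrArg F.map (TSpectrum.Pi.mk_eq n h f)

lemma hom_zero (m k : ℕ) : F.hom m k 0 = 0 := by
  have := F.map_add (0 : Level T V k (X.obj m)) 0
  rw [add_zero] at this
  exact left_eq_add.1 this

/-- Levelwise injectivity is more than is needed: it suffices that each kernel element dies after
one stabilisation. The weaker condition is the one that is checked for $T\wedge X$. -/
lemma map_injective (hF : ∀ (m k : ℕ) (f : Level T V k (X.obj m)),
    F.hom m k f = 0 → X.step V k m f = 0) : Function.Injective F.map := by
  rw [injective_iff_map_eq_zero]
  intro x hx
  obtain ⟨m, k, h, f, rfl⟩ := TSpectrum.Pi.exists_mk x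
  rw [map_mk] at hx
  obtain ⟨k', m', h'⟩ := TSpectrum.Pi.reaches_zero _ hx
  obtain ⟨m₁, k₁, f₁, h₁, rfl, rfl, e⟩ := F.exists_reaches h'
  have h₂ := TSpectrum.Reaches.step h₁
  rw [hF m₁ k₁ f₁ (eq_of_heq e).symm] at h₂
  obtain ⟨n, hn, hn'⟩ := h₂.eq_add
  rw [← TSpectrum.Pi.mk_reaches h₂ h (by rw [hn, hn']; push_cast; omega), TSpectrum.Pi.mk_zero]

/-- The isomorphism of stable homotopy groups induced by a family of homomorphisms that is
injective and surjective in the colimit. -/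
def equiv (hF : ∀ (m k : ℕ) (f : Level T V k (X.obj m)), F.hom m k f = 0 → X.step V k m f = 0)
    (hF' : ∀ y : Y.Pi q' V, ∃ x, F.map x = y) : X.Pi q V ≃+ Y.Pi q' V :=
  AddEquiv.ofBijective F.map ⟨F.map_injective hF, hF'⟩

lemma map_signAct [SmashSign T] (hF : ∀ (m k : ℕ) (f : Level T V k (X.obj m)),
      F.hom m k (midSign T V k ≫ f : HoHom _ _) = (midSign T V (F.κ k) ≫ F.hom m k f : HoHom _ _))
    (x : X.Pi q V) : F.map (TSpectrum.Pi.signAct x) = TSpectrum.Pi.signAct (F.map x) := by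
  obtain ⟨m, k, h, f, rfl⟩ := TSpectrum.Pi.exists_mk x
  rw [TSpectrum.Pi.signAct_mk, map_mk]
  refine (F.map_mk m k h _).trans ?_
  rw [TSpectrum.Pi.signAct_mk]
  exact congrArg _ (hF m k f)

end LevelwiseHom

end

section

variable {D : Type u} [Category.{v} D] [ModelCategory D] [HasZeroObject D] [MonoidalCategory D]
  [SymmetricCategory D] [MonoidalClosed D] [MonoidalModelCategory D]
  {T : D} [IsCofibrant T] [SmashPreservesWeakEquivalences T] [HoCogroup T] [SmashSign T]
  {V : D} [IsCofibrant V]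

/-! ### The action of the injection monoid -/

/-- The permutation `γ` agrees with `g` on `{0, …, m₀ - 1}`. -/
def InjMonoid.Agrees (g : InjMonoid) (m₀ : ℕ) {m : ℕ} (γ : Equiv.Perm (Fin m)) : Prop :=
  ∀ x : Fin m, (x : ℕ) < m₀ → (γ x : ℕ) = g x

/-- The action may be computed on any stabilisation $f'$ of $f$ and with any permutation agreeing
with $g$ on the first $m$ elements, $m$ being the level of $f$, not of $f'$. -/
lemma SymSpectrum.smul_mk (X : SymSpectrum T) {q : ℤ} (g : InjMonoid) {m k m' k' : ℕ}
    {f : Level T V k (X.obj m)} {f' : Level T V k' (X.obj m')} (hf : X.Reaches f f')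
    (h : (k : ℤ) + 1 = q + m) (h' : (k' : ℤ) + 1 = q + m') (γ : Equiv.Perm (Fin m'))
    (hγ : g.Agrees m γ) :
    g • (TSpectrum.Pi.mk m k h f : X.Pi q V) = TSpectrum.Pi.mk m' k' h' (X.twist V k' γ f') := by
  obtain ⟨i, rfl, rfl⟩ := exists_eq_first h
  obtain ⟨j, hij, rfl, rfl, e⟩ := hf.heq_trans
  obtain rfl := eq_of_heq e
  refine (congrArg (g • ·) (TSpectrum.Pi.mk_eq i h f)).trans ?_
  refine (X.injAct_mk q V g hij f γ fun x hx => hγ _ hx).trans ?_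
  exact (TSpectrum.Pi.mk_eq j h' _).symm

lemma SymSpectrum.exists_agrees (X : SymSpectrum T) {q : ℤ} (g : InjMonoid) (x : X.Pi q V) :
    ∃ (m k m' k' : ℕ) (f : Level T V k (X.obj m)) (f' : Level T V k' (X.obj m'))
      (γ : Equiv.Perm (Fin m')) (h : (k : ℤ) + 1 = q + m) (_ : (k' : ℤ) + 1 = q + m'),
      X.Reaches f f' ∧ g.Agrees m γ ∧ TSpectrum.Pi.mk m k h f = x := by
  induction x using Quotient.ind with | _ x =>
  obtain ⟨i, f⟩ := x
  obtain ⟨N, hN, γ, hγ⟩ := g.exists_perm i (firstIdx q)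
  exact ⟨_, _, _, _, f, _, γ, first_eq q i, first_eq q N, X.reaches_trans q hN f, hγ,
    TSpectrum.Pi.mk_eq i _ f⟩

/-- Equivariance reduces to intertwining the twist by $\gamma$ with the twist by some $\gamma'$. The
map $\rho$ is $g\mapsto 1+g$ for $\mathrm{sh}X$ and the identity in all other cases. -/
lemma LevelwiseHom.map_smul {X Y : SymSpectrum T} {q q' : ℤ}
    (F : LevelwiseHom V X.toTSpectrum Y.toTSpectrum q q') (ρ : InjMonoid → InjMonoid)
    (hF : ∀ (m k : ℕ) (γ : Equiv.Perm (Fin m)), ∃ γ' : Equiv.Perm (Fin (F.μ m)),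
      (∀ (g : InjMonoid) (m₀ : ℕ), g.Agrees m₀ γ → (ρ g).Agrees (F.μ m₀) γ') ∧
      ∀ f : Level T V k (X.obj m), F.hom m k (X.twist V k γ f) = Y.twist V (F.κ k) γ' (F.hom m k f))
    (g : InjMonoid) (x : X.Pi q V) : F.map (g • x) = ρ g • F.map x := by
  obtain ⟨m, k, m', k', f, f', γ, h, h', hf, hγ, rfl⟩ := X.exists_agrees g x
  obtain ⟨γ', hγ', e⟩ := hF m' k' γ
  rw [X.smul_mk g hf h h' γ hγ, F.map_mk, F.map_mk,
    Y.smul_mk (ρ g) (F.reaches hf) (F.degree h) (F.degree h') γ' (hγ' g m hγ), e]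

end

section

/-! ### The shift of the injection monoid -/

/-- A transposition, as an element of the injection monoid. -/
def InjMonoid.swap (a b : ℕ) : InjMonoid := (Equiv.swap a b).toEmbedding

lemma InjMonoid.ext {f g : InjMonoid} (h : ∀ x, f x = g x) : f = g := DFunLike.ext _ _ h

lemma InjMonoid.mul_apply (f g : InjMonoid) (x : ℕ) : (f * g) x = f (g x) := rfl

lemma InjMonoid.swap_apply (a b x : ℕ) : swap a b x = Equiv.swap a b x := rfl

lemma InjMonoid.plus_apply (n : ℕ) (f : InjMonoid) (x : ℕ) :
    plus n f x = if x < n then x else f (x - n) + n := rfl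

/-- Injectivity keeps $g(x+1)$ away from $g(0)=0$, so the truncated subtraction in $x\mapsto
g(x+1)-1$ loses nothing. -/
lemma InjMonoid.exists_plus_one (g : InjMonoid) (h : g 0 = 0) : ∃ f : InjMonoid, f.plus 1 = g := by
  have hg (x : ℕ) : g (x + 1) ≠ 0 := fun e => by
    have := g.injective (e.trans h.symm); omega
  have hf : Function.Injective (fun x => g (x + 1) - 1) := fun x y e => by
    have := hg x
    have := hg y
    dsimp only at e
    have := g.injective (show g (x + 1) = g (y + 1) by omega)
    omega
  let f : InjMonoid := (⟨_, hf⟩ : ℕ ↪ ℕ)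
  have hf' (x : ℕ) : f x = g (x + 1) - 1 := rfl
  refine ⟨f, InjMonoid.ext fun x => ?_⟩
  rw [plus_apply, hf']
  rcases x with - | x
  · exact h.symm
  · have := hg x
    rw [if_neg (by omega), Nat.add_sub_cancel]
    omega

/-- If all injections that fix the first element act trivially, then the action is trivial. -/
lemma InjMonoid.smul_eq_of_plus_one {W : Type*} [MulAction InjMonoid W]
    (h : ∀ (g : InjMonoid) (x : W), g.plus 1 • x = x) (g : InjMonoid) (x : W) : g • x = x := by
  have h₀ (g : InjMonoid) (hg : g 0 = 0) (x : W) : g • x = x := by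
    obtain ⟨f, rfl⟩ := g.exists_plus_one hg
    exact h f x
  have hswap (a : ℕ) (ha : a ≠ 0) (x : W) : swap 0 a • x = x := by
    -- The transposition $(0\,a)$ is the conjugate of $(a\;a{+}1)$ by $(0\;a{+}1)$. The middle
    -- factor fixes $0$ and acts trivially, and the outer ones then cancel although nothing is known
    -- about each of them.
    have e : swap 0 a = swap 0 (a + 1) * swap a (a + 1) * swap 0 (a + 1) := by
      refine InjMonoid.ext fun y => ?_
      simp only [mul_apply, swap_apply, Equiv.swap_apply_def]
      grind
    have e' : swap 0 (a + 1) * swap 0 (a + 1) = 1 := by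
      refine InjMonoid.ext fun y => ?_
      simp only [mul_apply, swap_apply, Equiv.swap_apply_self]
      rfl
    rw [e, mul_smul, mul_smul, h₀ (swap a (a + 1)), ← mul_smul, e', one_smul]
    rw [swap_apply, Equiv.swap_apply_of_ne_of_ne (by omega) (by omega)]
  by_cases hg : g 0 = 0
  · exact h₀ g hg x
  · have e : g = swap 0 (g 0) * (swap 0 (g 0) * g) := by
      refine InjMonoid.ext fun y => ?_
      simp only [mul_apply, swap_apply, Equiv.swap_apply_self]
    rw [e, mul_smul, hswap _ hg, h₀]
    rw [mul_apply, swap_apply, Equiv.swap_apply_right]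

end

section

variable {D : Type u} [Category.{v} D] [ModelCategory D] [HasZeroObject D] [MonoidalCategory D]
  [SymmetricCategory D] [MonoidalClosed D] [MonoidalModelCategory D]
  {T : D} [IsCofibrant T] [SmashPreservesWeakEquivalences T] [HoCogroup T]
  {V : D} [IsCofibrant V]

/-! ### The stable homotopy groups of `sh X` -/

variable (V) in
/-- The identities `[V ∧ T^{(q+1)+m}, (sh X)_m] = [V ∧ T^{q+(1+m)}, X_{1+m}]`. -/
def TSpectrum.shHom (X : TSpectrum T) (q : ℤ) : LevelwiseHom V X.sh X (q + 1) q where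
  μ m := 1 + m
  κ k := k
  degree h := by push_cast; omega
  μ_succ _ := rfl
  κ_succ _ := rfl
  hom _ _ f := f
  map_add _ _ := rfl
  step _ := HEq.rfl

/-- The level $X_0$ does not occur in $\mathrm{sh}X$, so a class is stabilised once before it is
lifted. -/
lemma TSpectrum.shHom_surjective (X : TSpectrum T) (q : ℤ) (y : X.Pi q V) :
    ∃ x, (X.shHom V q).map x = y := by
  have aux : ∀ (M k m : ℕ) (h : (k : ℤ) + 1 = q + M) (f : Level T V k (X.obj M)), M = 1 + m →
      ∃ x, (X.shHom V q).map x = Pi.mk M k h f := by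
    rintro _ k m h f rfl
    exact ⟨Pi.mk (X := X.sh) m k (by push_cast at h; omega) f,
      (X.shHom V q).map_mk m k (by push_cast at h; omega) f⟩
  obtain ⟨m, k, h, f, rfl⟩ := Pi.exists_mk y
  obtain ⟨x, hx⟩ := aux (m + 1) (k + 1) m (by push_cast; omega) (X.step V k m f) (Nat.add_comm _ _)
  exact ⟨x, hx.trans (Pi.mk_succ m k h f)⟩

variable (V) in
/-- The isomorphism `π_{q+1}^V(sh X) ≅ π_q^V(X)`. -/
def TSpectrum.shEquiv (X : TSpectrum T) (q : ℤ) : X.sh.Pi (q + 1) V ≃+ X.Pi q V :=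
  (X.shHom V q).equiv (fun m k _ hf => (congrArg (X.sh.step V k m) hf).trans (map_zero _))
    (X.shHom_surjective q)

lemma TSpectrum.isShIso_shEquiv [SmashSign T] (X : TSpectrum T) (q : ℤ) :
    X.IsShIso q V (X.shEquiv V q) :=
  ⟨fun m k h f => (X.shHom V q).map_mk m k h f, (X.shHom V q).map_signAct fun _ _ _ => rfl⟩

lemma InjMonoid.Agrees.plus_one {g : InjMonoid} {m₀ m : ℕ} {γ : Equiv.Perm (Fin m)}
    (h : g.Agrees m₀ γ) :
    (g.plus 1).Agrees (1 + m₀) (blockSum (1 : Equiv.Perm (Fin 1)) γ) := by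
  intro x hx
  rw [blockSum_val, InjMonoid.plus_apply]
  split_ifs with hx'
  · rfl
  · rw [h _ (show (x : ℕ) - 1 < m₀ by omega), Nat.add_comm]

variable (V) in
/-- The isomorphism `π_{q+1}^V(sh X) ≅ π_q^V(X)` for a symmetric spectrum `X`. -/
def SymSpectrum.shEquiv (X : SymSpectrum T) (q : ℤ) : X.sh.Pi (q + 1) V ≃+ X.Pi q V :=
  X.toTSpectrum.shEquiv V q

/-- On $(\mathrm{sh}X)_m=X_{1+m}$ the permutation $\gamma$ acts as $1+\gamma$, which has the same
sign as $\gamma$ and agrees with $1+g$ where $\gamma$ agrees with $g$. -/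
lemma SymSpectrum.shEquiv_smul [SmashSign T] (X : SymSpectrum T) (q : ℤ) (g : InjMonoid)
    (x : X.sh.Pi (q + 1) V) :
    X.shEquiv V q (g • x) = g.plus 1 • X.shEquiv V q x := by
  refine LevelwiseHom.map_smul (X := X.sh) (Y := X) (X.toTSpectrum.shHom V q)
    (InjMonoid.plus 1) (fun m k γ => ⟨blockSum (1 : Equiv.Perm (Fin 1)) γ,
      fun g m₀ h => h.plus_one, fun f => ?_⟩) g x
  have h : permSign (SmashSign.s (T := T)) (blockSum (1 : Equiv.Perm (Fin 1)) γ) =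
      permSign (SmashSign.s (T := T)) γ := by
    simp [permSign, sign_blockSum]
  have aux : ∀ {A B : D} {a a' : HoHom A A} (f : HoHom A B) (b : HoHom B B), a = a' →
      a ≫ f ≫ b = a' ≫ f ≫ b := by
    rintro A B a _ f b rfl; rfl
  exact aux (f : HoHom _ _) _ (congrArg (midMap T V k) h.symm)

/-! ### The stable homotopy groups of `Ω X` and `T ∧ X` -/

variable (V) in
/-- Compatible maps `X_n ∧ T ⟶ Y_n` induce maps `[V ∧ T^{q+n}, X_n] ⟶ [V ∧ T^{q+1+n}, Y_n]`. -/
def TSpectrum.suspendHom {X Y : TSpectrum T} (e : ∀ n, X.obj n ⊗ T ⟶ Y.obj n)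
    (he : ∀ n, X.σ n ▷ T ≫ e (n + 1) = swapLast T (X.obj n) ≫ e n ▷ T ≫ Y.σ n) {q q' : ℤ}
    (hq : q' = q + 1) : LevelwiseHom V X Y q q' where
  μ m := m
  κ k := k + 1
  degree h := by push_cast; omega
  μ_succ _ := rfl
  κ_succ _ := rfl
  hom m _ f := suspend (e m) f
  map_add {m _} f g := suspend_midAdd (e m) f g
  step {m _} f := heq_of_eq (suspend_step (he m) f)

lemma TSpectrum.suspendHom_signAct [SmashSign T] {X Y : TSpectrum T}
    (e : ∀ n, X.obj n ⊗ T ⟶ Y.obj n)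
    (he : ∀ n, X.σ n ▷ T ≫ e (n + 1) = swapLast T (X.obj n) ≫ e n ▷ T ≫ Y.σ n) {q q' : ℤ}
    (hq : q' = q + 1) (x : X.Pi q V) :
    (suspendHom V e he hq).map (Pi.signAct x) = Pi.signAct ((suspendHom V e he hq).map x) :=
  (suspendHom V e he hq).map_signAct (fun m _ f => suspend_midSign (e m) f) x

/-- The same $\gamma$ works on both sides: its sign commutes with suspension, and its action on the
target passes through $e$ by equivariance. -/
lemma SymSpectrum.suspendHom_smul [SmashSign T] {X Y : SymSpectrum T}
    (e : ∀ n, X.obj n ⊗ T ⟶ Y.obj n)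
    (he : ∀ n, X.σ n ▷ T ≫ e (n + 1) = swapLast T (X.obj n) ≫ e n ▷ T ≫ Y.σ n)
    (he' : ∀ (n : ℕ) (γ : Equiv.Perm (Fin n)),
      (X.act n γ : X.obj n ⟶ X.obj n) ▷ T ≫ e n = e n ≫ Y.act n γ) {q q' : ℤ}
    (hq : q' = q + 1) (g : InjMonoid) (x : X.Pi q V) :
    (TSpectrum.suspendHom V e he hq).map (g • x) =
      g • (TSpectrum.suspendHom V e he hq).map x := by
  refine LevelwiseHom.map_smul (X := X) (Y := Y) (TSpectrum.suspendHom V e he hq) id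
    (fun m k γ => ⟨γ, fun g m₀ h => h, fun f => ?_⟩) g x
  refine (suspend_midMap_permSign (e m) (f ≫ hoMap (X.act m γ) : HoHom _ _) γ).trans ?_
  exact congrArg (midMap T V (k + 1) (permSign (SmashSign.s (T := T)) γ) ≫ ·)
    (suspend_comp (he' m γ) f)

variable (V) in
/-- The maps `[V ∧ T^{q+m}, Hom(T, X_m)] ⟶ [V ∧ T^{q+1+m}, X_m]` given by adjunction. -/
def TSpectrum.loopHom (X : TSpectrum T) (q : ℤ) : LevelwiseHom V X.loop X q (q + 1) :=
  suspendHom V (fun n => evRight T (X.obj n)) (fun n => loopσ_evRight T (X.σ n)) rfl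

section

variable [SmashSign T]

variable (V) in
/-- The isomorphism `π_q^V(Ω X) ≅ π_{q+1}^V(X)` for a level fibrant spectrum `X`. -/
def TSpectrum.loopEquiv (X : TSpectrum T) (hX : X.LevelFibrant) (q : ℤ) :
    X.loop.Pi q V ≃+ X.Pi (q + 1) V :=
  (X.loopHom V q).equiv
    (fun m k f hf => by
      have := hX m
      have h₀ : f = 0 := (bijective_loopAdjoint (X.obj m)).1
        (hf.trans ((X.loopHom V q).hom_zero m k).symm)
      exact (congrArg (X.loop.step V k m) h₀).trans (map_zero _))
    (fun y => by
      obtain ⟨m, k, h, f, rfl⟩ := Pi.exists_mk y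
      -- A class given on $V\wedge T^{k+1}$ with $k=0$ is not of the form produced by the
      -- adjunction, whose sources are $V\wedge T^{k'+2}$. One stabilisation makes room for the
      -- additional factor $T$.
      have := hX (m + 1)
      obtain ⟨f', hf'⟩ := (bijective_loopAdjoint (V := V) (T := T) (k := k) (X.obj (m + 1))).2
        (X.step V k m f : HoHom _ _)
      refine ⟨Pi.mk (X := X.loop) (m + 1) k (by push_cast; omega) f', ?_⟩
      refine ((X.loopHom V q).map_mk (m + 1) k (by push_cast; omega) f').trans ?_
      refine Eq.trans ?_ (Pi.mk_succ m k h f)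
      exact congrArg (Pi.mk (m + 1) (k + 1) (by push_cast; omega)) hf')

lemma TSpectrum.isLoopIso_loopEquiv (X : TSpectrum T) (hX : X.LevelFibrant) (q : ℤ) :
    X.IsLoopIso q V (X.loopEquiv V hX q) :=
  ⟨fun m k h f => (X.loopHom V q).map_mk m k h f, suspendHom_signAct _ _ rfl⟩

variable (V) in
/-- The isomorphism `π_q^V(Ω X) ≅ π_{q+1}^V(X)` for a level fibrant symmetric spectrum `X`. -/
def SymSpectrum.loopEquiv (X : SymSpectrum T) (hX : X.LevelFibrant) (q : ℤ) :
    X.loop.Pi q V ≃+ X.Pi (q + 1) V :=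
  X.toTSpectrum.loopEquiv V hX q

lemma SymSpectrum.loopEquiv_smul (X : SymSpectrum T) (hX : X.LevelFibrant) (q : ℤ) (g : InjMonoid)
    (x : X.loop.Pi q V) :
    X.loopEquiv V hX q (g • x) = g • X.loopEquiv V hX q x :=
  suspendHom_smul (X := X.loop) (Y := X) _ _ (fun n γ => evRight_naturality T (X.act n γ)) rfl g x

end

/-- The structure map of $T\wedge X$ leaves the new left factor $T$ alone, whereas moving the last
$T$ across $X_n\wedge T$ also passes the structure factor; the exchange accounts for this. -/
lemma smash_braiding (X : TSpectrum T) (n : ℕ) :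
    X.σ n ▷ T ≫ (β_ (X.obj (n + 1)) T).hom =
      swapLast T (X.obj n) ≫ (β_ (X.obj n) T).hom ▷ T ≫ X.smash.σ n := by
  change _ = swapLast T (X.obj n) ≫ (β_ (X.obj n) T).hom ▷ T ≫ (α_ _ _ _).hom ≫ T ◁ X.σ n
  rw [BraidedCategory.braiding_naturality_left, BraidedCategory.braiding_tensor_left_hom]
  simp [swapLast]

variable (V) in
/-- The maps `[V ∧ T^{q+m}, X_m] ⟶ [V ∧ T^{1+q+m}, T ∧ X_m]` given by `T ∧ -`. -/
def TSpectrum.smashHom (X : TSpectrum T) (q : ℤ) : LevelwiseHom V X X.smash q (1 + q) :=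
  suspendHom V (Y := X.smash) (fun n => (β_ (X.obj n) T).hom) (smash_braiding X) (add_comm _ _)

lemma TSpectrum.smashHom_map_mk (X : TSpectrum T) (q : ℤ) (m k : ℕ) (h : (k : ℤ) + 1 = q + m)
    (f : HoHom (smashPow T (V ⊗ T) k) (X.obj m)) : (X.smashHom V q).map (Pi.mk m k h f) =
      Pi.mk (X := X.smash) m (k + 1) (by push_cast; omega) (smashLeft f) :=
  ((X.smashHom V q).map_mk m k h f).trans
    (congrArg (Pi.mk (X := X.smash) m (k + 1) (by push_cast; omega)) (smashLeft_eq_suspend f).symm)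

/-! ### Bijectivity of $T\wedge-$ in the colimit -/

section

variable [SmashSign T]

lemma TSpectrum.smashHom_surjective (X : TSpectrum T) (q : ℤ) (y : X.smash.Pi (1 + q) V) :
    ∃ x, (X.smashHom V q).map x = y := by
  obtain ⟨m, k, h, g, rfl⟩ := Pi.exists_mk y
  have h' : (k : ℤ) + 1 = q + (m + 1 : ℕ) := by push_cast; omega
  suffices ∃ f, smashLeft f = X.smash.step V k m g by
    obtain ⟨f, hf⟩ := this
    refine ⟨Pi.mk (m + 1) k h' f, (X.smashHom_map_mk q (m + 1) k h' f).trans ?_⟩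
    exact (congrArg (Pi.mk (X := X.smash) (m + 1) (k + 1) (by push_cast; omega)) hf).trans
      (Pi.mk_succ m k h g)
  -- The factor $T$ of the target $T\wedge X_m$ is absorbed by the structure map of $X$, so $f$
  -- lands one level higher.
  let f : HoHom (smashPow T (V ⊗ T) k) (X.obj (m + 1)) :=
    (g : HoHom _ _) ≫ hoMap (β_ (X.obj m) T).inv ≫ hoMap (X.σ m)
  have hf : smashLeft f = hoMap (rotate T V k) ≫ midSign T V (k + 1) ≫
      (X.smash.step V k m g : HoHom _ _) := smashLeft_comp_braiding (g : HoHom _ _) (X.σ m)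
  have hs {Y : D} (u : HoHom (smashPow T (V ⊗ T) (k + 1)) Y) :
      midSign T V (k + 1) ≫ midSign T V (k + 1) ≫ u = u := by
    rw [← Category.assoc, midSign_comp_self, Category.id_comp]
  have hr := congrArg (· ≫ midSign T V (k + 1) ≫ (X.smash.step V k m g : HoHom _ _))
    (hoMap_rotate (T := T) V k)
  -- $T\wedge f$ differs from the stabilisation of $g$ by the rotation and one sign. For even $k$
  -- the rotation is the sign and the two cancel; for odd $k$ it is the identity, and $f$ is
  -- corrected by a sign.
  by_cases hk : Even k
  · rw [if_pos hk] at hr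
    exact ⟨f, hf.trans (hr.trans (hs _))⟩
  · rw [if_neg hk, midMap_id] at hr
    refine ⟨midSign T V k ≫ f, ?_⟩
    rw [smashLeft_eq_suspend, suspend_midSign, ← smashLeft_eq_suspend]
    exact (congrArg (midSign T V (k + 1) ≫ ·)
      (hf.trans (hr.trans (Category.id_comp _)))).trans (hs _)

variable (V) in
/-- The isomorphism `π_q^V(X) ≅ π_{1+q}^V(T ∧ X)`. -/
def TSpectrum.smashEquiv (X : TSpectrum T) (q : ℤ) : X.Pi q V ≃+ X.smash.Pi (1 + q) V :=
  (X.smashHom V q).equiv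
    (fun m k f hf => by
      -- $T\wedge f=T\wedge 0$ yields $f\wedge T=0\wedge T$, so the stabilisations of $f$ and of $0$
      -- coincide.
      have e : smashLeft f = smashLeft (0 : Level T V k (X.obj m)) :=
        (smashLeft_eq_suspend f).trans (hf.trans (((X.smashHom V q).hom_zero m k).symm.trans
          (smashLeft_eq_suspend (0 : Level T V k (X.obj m))).symm))
      exact (congrArg (· ≫ hoMap (X.σ m)) (hoSmash_eq_of_smashLeft_eq e)).trans
        (map_zero (X.step V k m)))
    (X.smashHom_surjective q)

lemma TSpectrum.isSmashIso_smashEquiv (X : TSpectrum T) (q : ℤ) :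
    X.IsSmashIso q V (X.smashEquiv V q) :=
  ⟨fun m k h f => X.smashHom_map_mk q m k h f, suspendHom_signAct _ _ _⟩

variable (V) in
/-- The isomorphism `π_q^V(X) ≅ π_{1+q}^V(T ∧ X)` for a symmetric spectrum `X`. -/
def SymSpectrum.smashEquiv (X : SymSpectrum T) (q : ℤ) : X.Pi q V ≃+ X.smash.Pi (1 + q) V :=
  X.toTSpectrum.smashEquiv V q

lemma SymSpectrum.smashEquiv_smul (X : SymSpectrum T) (q : ℤ) (g : InjMonoid) (x : X.Pi q V) :
    X.smashEquiv V q (g • x) = g • X.smashEquiv V q x :=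
  suspendHom_smul (X := X) (Y := X.smash) _ _
    (fun n γ => BraidedCategory.braiding_naturality_left (X.act n γ : X.obj n ⟶ X.obj n) T) _ g x

/-! ### Level equivalences and semistability -/

variable (V) in
/-- The maps `[V ∧ T^{q+m}, X_m] ⟶ [V ∧ T^{q+m}, Y_m]` induced by a map of spectra. -/
def SymSpectrum.Hom.levelwiseHom {X Y : SymSpectrum T} (j : X.Hom Y) (q : ℤ) :
    LevelwiseHom V X.toTSpectrum Y.toTSpectrum q q where
  μ m := m
  κ k := k
  degree h := h
  μ_succ _ := rfl
  κ_succ _ := rfl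
  hom m _ f := ((f : HoHom _ _) ≫ hoMap (j.app m) : HoHom _ _)
  map_add {m _} f g := midAdd_comp f g (hoMap (j.app m))
  step {m k} f := heq_of_eq <| by
    have aux : ∀ {A B B' C C' : D} (f : HoHom A B) {s : B ⊗ T ⟶ C} {s' : B' ⊗ T ⟶ C'} {a : B ⟶ B'}
        {b : C ⟶ C'}, a ▷ T ≫ s' = s ≫ b →
        (hoSmash T f ≫ hoMap s) ≫ hoMap b = hoSmash T (f ≫ hoMap a) ≫ hoMap s' := by
      intro A B B' C C' f s s' a b h
      rw [hoSmash_comp, hoSmash_hoMap, Category.assoc, Category.assoc, ← hoMap_comp, ← hoMap_comp,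
        h]
    exact aux (f : HoHom _ _) (j.comm m)

lemma SymSpectrum.Hom.map_smul {X Y : SymSpectrum T} (j : X.Hom Y) (q : ℤ) (g : InjMonoid)
    (x : X.Pi q V) : (j.levelwiseHom V q).map (g • x) = g • (j.levelwiseHom V q).map x := by
  refine LevelwiseHom.map_smul (j.levelwiseHom V q) id
    (fun m k γ => ⟨γ, fun g m₀ h => h, fun f => ?_⟩) g x
  have aux : ∀ {A B C : D} (a : HoHom A A) (f : HoHom A B) {b : B ⟶ B} {s : B ⟶ C} {c : C ⟶ C},
      b ≫ s = s ≫ c → (a ≫ f ≫ hoMap b) ≫ hoMap s = a ≫ (f ≫ hoMap s) ≫ hoMap c := by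
    intro A B C a f b s c h
    rw [Category.assoc, Category.assoc, Category.assoc, ← hoMap_comp, ← hoMap_comp, h]
  exact aux _ (f : HoHom _ _) (j.equivariant m γ)

/-- Each $X_n\to Y_n$ is invertible in $\mathrm{Ho}(\mathcal D)$, so the maps of groups are
bijective before passing to the colimit. -/
lemma SymSpectrum.Hom.map_bijective {X Y : SymSpectrum T} (j : X.Hom Y)
    (hj : ∀ n, WeakEquivalence (j.app n)) (q : ℤ) :
    Function.Bijective (j.levelwiseHom V q).map := by
  have hj' (n : ℕ) : IsIso (hoMap (j.app n)) :=
    have := hj n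
    isIso_hoMap (j.app n)
  constructor
  · refine (j.levelwiseHom V q).map_injective fun m k f hf => ?_
    have h₀ : f = 0 := (cancel_mono (hoMap (j.app m))).1
      (hf.trans ((j.levelwiseHom V q).hom_zero m k).symm)
    rw [h₀, map_zero]
  · intro y
    obtain ⟨m, k, h, f, rfl⟩ := TSpectrum.Pi.exists_mk y
    refine ⟨TSpectrum.Pi.mk m k h ((f : HoHom _ _) ≫ inv (hoMap (j.app m))), ?_⟩
    refine ((j.levelwiseHom V q).map_mk m k h _).trans (congrArg (TSpectrum.Pi.mk m k h) ?_)
    exact (Category.assoc _ _ _).trans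
      ((congrArg ((f : HoHom _ _) ≫ ·) (IsIso.inv_hom_id _)).trans (Category.comp_id _))

/-! ### Transfer of semistability -/

variable (𝓑 : Set (CofibrantObject D))

lemma SymSpectrum.semistable_iff_of_levelEquivalence {X Y : SymSpectrum T} (j : X.Hom Y)
    (hj : ∀ n, WeakEquivalence (j.app n)) : X.Semistable 𝓑 ↔ Y.Semistable 𝓑 := by
  refine forall_congr' fun q => forall₂_congr fun V _ => forall_congr' fun g => ?_
  have hb := j.map_bijective (V := V.obj) hj q
  rw [hb.2.forall]
  exact forall_congr' fun x => by rw [← j.map_smul, hb.1.eq_iff]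

lemma SymSpectrum.semistable_smash_iff (X : SymSpectrum T) :
    X.Semistable 𝓑 ↔ X.smash.Semistable 𝓑 := by
  have key (q : ℤ) (V : D) [IsCofibrant V] (g : InjMonoid) :
      (∀ x : X.Pi q V, g • x = x) ↔ ∀ x : X.smash.Pi (1 + q) V, g • x = x := by
    rw [(X.smashEquiv V q).surjective.forall]
    exact forall_congr' fun x => by
      rw [← (X.smashEquiv V q).injective.eq_iff, X.smashEquiv_smul]
  constructor
  · intro h q V hV g
    -- Degrees range over all integers, so the shift by one in the isomorphism reaches every
    -- homotopy group of $T\wedge X$.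
    obtain ⟨q, rfl⟩ : ∃ q', q = 1 + q' := ⟨q - 1, by omega⟩
    exact (key q V.obj g).1 (h q V hV g)
  · exact fun h q V hV g => (key q V.obj g).2 (h (1 + q) V hV g)

lemma SymSpectrum.semistable_loop_iff (X : SymSpectrum T) (hX : X.LevelFibrant) :
    X.Semistable 𝓑 ↔ X.loop.Semistable 𝓑 := by
  have key (q : ℤ) (V : D) [IsCofibrant V] (g : InjMonoid) :
      (∀ x : X.Pi (q + 1) V, g • x = x) ↔ ∀ x : X.loop.Pi q V, g • x = x := by
    rw [(X.loopEquiv V hX q).surjective.forall]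
    exact forall_congr' fun x => by
      rw [← (X.loopEquiv V hX q).injective.eq_iff]
      rw [X.loopEquiv_smul]
  constructor
  · exact fun h q V hV g => (key q V.obj g).1 (h (q + 1) V hV g)
  · intro h q V hV g
    obtain ⟨q, rfl⟩ : ∃ q', q = q' + 1 := ⟨q - 1, by omega⟩
    exact (key q V.obj g).2 (h q V hV g)

/-- Here the isomorphism only identifies $\pi(\mathrm{sh}X)$ with the restricted module $\pi(X)(1)$.
Triviality of $\pi(X)$ clearly passes to it; the converse is the algebraic statement
`InjMonoid.smul_eq_of_plus_one`. -/
lemma SymSpectrum.semistable_sh_iff (X : SymSpectrum T) :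
    X.Semistable 𝓑 ↔ X.sh.Semistable 𝓑 := by
  have key (q : ℤ) (V : D) [IsCofibrant V] (g : InjMonoid) :
      (∀ x : X.Pi q V, g.plus 1 • x = x) ↔ ∀ x : X.sh.Pi (q + 1) V, g • x = x := by
    rw [(X.shEquiv V q).surjective.forall]
    refine forall_congr' fun x => ?_
    rw [← (X.shEquiv V q).injective.eq_iff]
    rw [X.shEquiv_smul]
  constructor
  · intro h q V hV g
    obtain ⟨q, rfl⟩ : ∃ q', q = q' + 1 := ⟨q - 1, by omega⟩
    exact (key q V.obj g).1 (h q V hV _)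
  · exact fun h q V hV => InjMonoid.smul_eq_of_plus_one fun g =>
      (key q V.obj g).2 (h (q + 1) V hV g)

end

end

end StableHtpy

end

theorem proposition2p19 {D : Type u} [Category.{v} D] [ModelCategory D] [HasZeroObject D]
    [MonoidalCategory D] [SymmetricCategory D] [MonoidalClosed D]
    [StableHtpy.MonoidalModelCategory D] (T : D) [IsCofibrant T]
    [StableHtpy.SmashPreservesWeakEquivalences T] [StableHtpy.HoCogroup T]
    [StableHtpy.SmashSign T] (𝓑 : Set (CofibrantObject D)) :
    -- the isomorphisms for a spectrum `X`
    (∀ (X : StableHtpy.TSpectrum T) (q : ℤ), ∀ V ∈ 𝓑,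
      (∃ φ : X.sh.Pi (q + 1) V.obj ≃+ X.Pi q V.obj, X.IsShIso q V.obj φ) ∧
      (X.LevelFibrant →
        ∃ φ : X.loop.Pi q V.obj ≃+ X.Pi (q + 1) V.obj, X.IsLoopIso q V.obj φ) ∧
      (∃ φ : X.Pi q V.obj ≃+ X.smash.Pi (1 + q) V.obj, X.IsSmashIso q V.obj φ)) ∧
    -- for a symmetric spectrum `X` they respect the action of the injection monoid
    (∀ (X : StableHtpy.SymSpectrum T) (q : ℤ), ∀ V ∈ 𝓑,
      (∃ φ : X.sh.Pi (q + 1) V.obj ≃+ X.Pi q V.obj, X.IsShIso q V.obj φ ∧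
        ∀ (g : StableHtpy.InjMonoid) (x : X.sh.Pi (q + 1) V.obj), φ (g • x) = g.plus 1 • φ x) ∧
      (X.LevelFibrant →
        ∃ φ : X.loop.Pi q V.obj ≃+ X.Pi (q + 1) V.obj, X.IsLoopIso q V.obj φ ∧
          ∀ (g : StableHtpy.InjMonoid) (x : X.loop.Pi q V.obj), φ (g • x) = g • φ x) ∧
      (∃ φ : X.Pi q V.obj ≃+ X.smash.Pi (1 + q) V.obj, X.IsSmashIso q V.obj φ ∧
        ∀ (g : StableHtpy.InjMonoid) (x : X.Pi q V.obj), φ (g • x) = g • φ x)) ∧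
    -- semistability of `X`, `T ∧ X`, `sh X` and `Ω J X`
    (∀ X : StableHtpy.SymSpectrum T,
      (X.Semistable 𝓑 ↔ X.smash.Semistable 𝓑) ∧
      (X.Semistable 𝓑 ↔ X.sh.Semistable 𝓑) ∧
      ∀ (Y : StableHtpy.SymSpectrum T) (j : X.Hom Y), j.IsLevelFibrantReplacement →
        (X.Semistable 𝓑 ↔ Y.loop.Semistable 𝓑)) := by
  refine ⟨fun X q V _ => ⟨⟨_, X.isShIso_shEquiv q⟩, fun hX => ⟨_, X.isLoopIso_loopEquiv hX q⟩,
      ⟨_, X.isSmashIso_smashEquiv q⟩⟩,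
    fun X q V _ => ⟨⟨_, X.isShIso_shEquiv q, X.shEquiv_smul q⟩,
      fun hX => ⟨_, X.isLoopIso_loopEquiv hX q, X.loopEquiv_smul hX q⟩,
      ⟨_, X.isSmashIso_smashEquiv q, X.smashEquiv_smul q⟩⟩,
    fun X => ⟨X.semistable_smash_iff 𝓑, X.semistable_sh_iff 𝓑, fun Y j hj => ?_⟩⟩
  -- Semistability passes from $X$ to $JX$ along the level equivalence; then $JX$ is level fibrant
  -- and the loop isomorphism applies.
  exact (StableHtpy.SymSpectrum.semistable_iff_of_levelEquivalence 𝓑 j hj.1).trans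
    (Y.semistable_loop_iff 𝓑 hj.2)
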